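/- All rings are associative and unital, and all complexes are unbounded cochain complexes. Write $\mathsf{Hot}(\mathsf E)$ for the homotopy category of complexes over an additive category $\mathsf E$. *Coacyclic and contraacyclic complexes.* Let $A$ be a ring. A complex of left $A$-modules is *coacyclic* (respectively, *contraacyclic*) if it belongs to the minimal full triangulated subcategory of $\mathsf{Hot}(A\text{-}\mathrm{mod})$ that contains the total complexes of all short exact sequences of complexes of left $A$-modules and is closed under infinite direct sums (respectively, infinite products). *Semiderived categories.* For a ring homomorphism $A\to R$, the $R/A$-semicoderived category $\mathsf D^{\mathsf{sico}}_A(R\text{-}\mathrm{mod})$ is the quotient of $\mathsf{Hot}(R\text{-}\mathrm{mod})$ by the thick subcategory of complexes that are coacyclic as complexes of left $A$-modules. For a ring homomorphism $B\to S$, the $S/B$-semicontraderived category $\mathsf D^{\mathsf{sictr}}_B(S\text{-}\mathrm{mod})$ is the quotient of $\mathsf{Hot}(S\text{-}\mathrm{mod})$ by the thick subcategory of complexes that are contraacyclic as complexes of left $B$-modules. *Derived categories of relatively adjusted modules.* Let $R\text{-}\mathrm{mod}_{A\text{-}\mathrm{inj}}$ be the full subcategory of left $R$-modules that are injective as left $A$-modules,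 and let $\mathsf D(R\text{-}\mathrm{mod}_{A\text{-}\mathrm{inj}})$ be the quotient of $\mathsf{Hot}(R\text{-}\mathrm{mod}_{A\text{-}\mathrm{inj}})$ by the thick subcategory of complexes that are contractible as complexes of left $A$-modules. Similarly, let $S\text{-}\mathrm{mod}_{B\text{-}\mathrm{proj}}$ be the full subcategory of left $S$-modules that are projective as left $B$-modules, and let $\mathsf D(S\text{-}\mathrm{mod}_{B\text{-}\mathrm{proj}})$ be the quotient of $\mathsf{Hot}(S\text{-}\mathrm{mod}_{B\text{-}\mathrm{proj}})$ by the thick subcategory of complexes that are contractible as complexes of left $B$-modules. A ring is *left* (*right*) *coherent* if all its finitely generated left (right) ideals are finitely presented. A left module $J$ over a left coherent ring $A$ is *fp-injective* if the functor $\operatorname{Hom}_A(-,J)$ takes short exact sequences of finitely presented left $A$-modules to short exact sequences. **Theorem.** (a) Let $A\to R$ be a homomorphism of rings. Assume that $A$ is left coherent, that $R$ is a flat right $A$-module, and that every fp-injective left $A$-module has finite injective dimension. Then the triangulated functor $$\mathsf D(R\text{-}\mathrm{mod}_{A\text{-}\mathrm{inj}})\longrightarrow \mathsf D^{\mathsf{sico}}_A(R\text{-}\mathrm{mod})$$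 induced by the embedding $R\text{-}\mathrm{mod}_{A\text{-}\mathrm{inj}}\to R\text{-}\mathrm{mod}$ is an equivalence of triangulated categories. (b) Let $B\to S$ be a homomorphism of rings. Assume that $B$ is right coherent, that $S$ is a projective left $B$-module, and that every flat left $B$-module has finite projective dimension. Then the triangulated functor $$\mathsf D(S\text{-}\mathrm{mod}_{B\text{-}\mathrm{proj}})\longrightarrow \mathsf D^{\mathsf{sictr}}_B(S\text{-}\mathrm{mod})$$ induced by the embedding $S\text{-}\mathrm{mod}_{B\text{-}\mathrm{proj}}\to S\text{-}\mathrm{mod}$ is an equivalence of triangulated categories. -/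

import Mathlib

open CategoryTheory CategoryTheory.Limits
open scoped TensorProduct ZeroObject

universe v u

namespace Semiderived

noncomputable section

/-! ### Coherence, flatness, fp-injectivity, finite dimensions -/

/-- A ring is left coherent if all its finitely generated left ideals are finitely presented. -/
def IsLeftCoherent (A : Type u) [Ring A] : Prop :=
  ∀ I : Ideal A, I.FG → Module.FinitePresentation A I

/-- A ring `B` is right coherent if the opposite ring is left coherent
(left ideals of the opposite ring are right ideals of `B`). -/
def IsRightCoherent (B : Type u) [Ring B] : Prop :=
  IsLeftCoherent Bᵐᵒᵖ

section Tensor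

variable (A : Type u) [Ring A] (N : Type u) [AddCommGroup N] [Module Aᵐᵒᵖ N]
  (M : Type u) [AddCommGroup M] [Module A M]

/-- The subgroup of `N ⊗[ℤ] M` generated by the elements `n a ⊗ m - n ⊗ a m`. -/
def balancingSubgroup : AddSubgroup (N ⊗[ℤ] M) :=
  AddSubgroup.closure
    {t | ∃ (n : N) (a : A) (m : M), t = (MulOpposite.op a • n) ⊗ₜ[ℤ] m - n ⊗ₜ[ℤ] (a • m)}

/-- The tensor product `N ⊗_A M` of a right `A`-module `N` and a left `A`-module `M`
over a noncommutative ring `A`. -/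
abbrev BalancedTensor : Type u := (N ⊗[ℤ] M) ⧸ balancingSubgroup A N M

variable {A N M} {N' : Type u} [AddCommGroup N'] [Module Aᵐᵒᵖ N']
  {M' : Type u} [AddCommGroup M'] [Module A M']

/-- The functoriality of the tensor product `N ⊗_A M` in both arguments. -/
def BalancedTensor.map (g : N →ₗ[Aᵐᵒᵖ] N') (h : M →ₗ[A] M') :
    BalancedTensor A N M →+ BalancedTensor A N' M' :=
  QuotientAddGroup.map _ _
    (TensorProduct.map g.toAddMonoidHom.toIntLinearMap
      h.toAddMonoidHom.toIntLinearMap).toAddMonoidHom (by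
    rw [balancingSubgroup, AddSubgroup.closure_le]
    rintro _ ⟨n, a, m, rfl⟩
    refine AddSubgroup.subset_closure ⟨g n, a, h m, ?_⟩
    simp)

end Tensor

/-- A left module `M` is flat if `- ⊗_A M` preserves injectivity of maps of right modules. -/
def IsFlatLeft {A : Type u} [Ring A] (M : ModuleCat.{u} A) : Prop :=
  ∀ ⦃N N' : ModuleCat.{u} Aᵐᵒᵖ⦄ (g : N ⟶ N'), Function.Injective g.hom →
    Function.Injective (BalancedTensor.map g.hom (LinearMap.id : M →ₗ[A] M))

/-- A right module `N` is flat if `N ⊗_A -` preserves injectivity of maps of left modules. -/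
def IsFlatRight {A : Type u} [Ring A] (N : ModuleCat.{u} Aᵐᵒᵖ) : Prop :=
  ∀ ⦃M M' : ModuleCat.{u} A⦄ (h : M ⟶ M'), Function.Injective h.hom →
    Function.Injective (BalancedTensor.map (LinearMap.id : N →ₗ[Aᵐᵒᵖ] N) h.hom)

/-- A left module `J` is fp-injective if the functor `Hom(-, J)` takes short exact sequences of
finitely presented left modules to short exact sequences; as this functor is left exact, this
means that the maps to `J` from the left term extend to the middle term. -/
def IsFpInjective {A : Type u} [Ring A] (J : ModuleCat.{u} A) : Prop :=
  ∀ S : ShortComplex (ModuleCat.{u} A), S.ShortExact →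
    Module.FinitePresentation A S.X₁ → Module.FinitePresentation A S.X₂ →
    Module.FinitePresentation A S.X₃ → ∀ φ : S.X₁ ⟶ J, ∃ ψ : S.X₂ ⟶ J, S.f ≫ ψ = φ

/-- For a ring map `f : A →+* R`, the ring `R` viewed as a left `A`-module. -/
abbrev leftModule {A R : Type u} [Ring A] [Ring R] (f : A →+* R) : ModuleCat.{u} A :=
  (ModuleCat.restrictScalars f).obj (ModuleCat.of R R)

/-- For a ring map `f : A →+* R`, the ring `R` viewed as a right `A`-module. -/
abbrev rightModule {A R : Type u} [Ring A] [Ring R] (f : A →+* R) : ModuleCat.{u} Aᵐᵒᵖ :=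
  (ModuleCat.restrictScalars (RingHom.op f)).obj (ModuleCat.of Rᵐᵒᵖ R)

/-! ### Coacyclic and contraacyclic complexes -/

/-- The homotopy category of unbounded cochain complexes. -/
abbrev Hot (C : Type u) [Category.{v} C] [Preadditive C] :=
  HomotopyCategory C (ComplexShape.up ℤ)

/-- The functor between homotopy categories that applies an additive functor termwise. -/
abbrev hotMap {C D : Type*} [Category* C] [Category* D] [Preadditive C] [Preadditive D]
    (F : C ⥤ D) [F.Additive] : Hot C ⥤ Hot D :=
  F.mapHomotopyCategory (ComplexShape.up ℤ)

section Acyclicity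

variable (C : Type u) [Category.{v} C] [Abelian C]

variable {C} in
/-- The total complex of a short exact sequence `K → L → M` of complexes, as an object of the
homotopy category: the cone of the canonical morphism `cone(K → L) → M`. Up to isomorphism and
shift, this is the total complex of the bicomplex with the three rows (or columns) `K`, `L`,
`M`. -/
def totalComplex (S : ShortComplex (CochainComplex C ℤ)) : Hot C :=
  (HomotopyCategory.quotient C (ComplexShape.up ℤ)).obj
    (CochainComplex.mappingCone (CochainComplex.mappingCone.descShortComplex S))

variable {C} in
/-- A (strictly full) triangulated subcategory of the homotopy category which contains the total
complexes of all short exact sequences of complexes. -/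
structure ContainsTotals (P : ObjectProperty (Hot C)) : Prop where
  isTriangulated : P.IsTriangulated
  isClosedUnderIsomorphisms : P.IsClosedUnderIsomorphisms
  total (S : ShortComplex (CochainComplex C ℤ)) (hS : S.ShortExact) : P (totalComplex S)

/-- A complex is coacyclic if it belongs to the minimal triangulated subcategory of the
homotopy category which contains the total complexes of short exact sequences of complexes and
is closed under infinite direct sums. -/
def coacyclic : ObjectProperty (Hot C) := fun X ↦
  ∀ P : ObjectProperty (Hot C), ContainsTotals P →
    (∀ J : Type v, P.IsClosedUnderColimitsOfShape (Discrete J)) → P X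

/-- A complex is contraacyclic if it belongs to the minimal triangulated subcategory of the
homotopy category which contains the total complexes of short exact sequences of complexes and
is closed under infinite products. -/
def contraacyclic : ObjectProperty (Hot C) := fun X ↦
  ∀ P : ObjectProperty (Hot C), ContainsTotals P →
    (∀ J : Type v, P.IsClosedUnderLimitsOfShape (Discrete J)) → P X

end Acyclicity

section Intersection

/-- The intersection of the properties `P` that satisfy `Φ`. -/
def inter {T : Type*} [Category* T] (Φ : ObjectProperty T → Prop) : ObjectProperty T :=
  fun X ↦ ∀ P, Φ P → P X

lemma inter_iso {T : Type*} [Category* T] (Φ : ObjectProperty T → Prop) (h : ∀ P, Φ P → P.IsClosedUnderIsomorphisms) :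
    (inter Φ).IsClosedUnderIsomorphisms where
  of_iso e hX P hP := by
    have := h P hP
    exact P.prop_of_iso e (hX P hP)

lemma inter_triangulated {T : Type*} [Category* T] [HasZeroObject T] [HasShift T ℤ]
    [Preadditive T] [∀ n : ℤ, (shiftFunctor T n).Additive] [Pretriangulated T]
    (Φ : ObjectProperty T → Prop)
    (h : ∀ P, Φ P → P.IsClosedUnderIsomorphisms) (h' : ∀ P, Φ P → P.IsTriangulated) :
    (inter Φ).IsTriangulated := by
  have := inter_iso Φ h
  exact
    { exists_zero := ⟨0, isZero_zero T, fun P hP ↦ by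
        have := h P hP
        have := h' P hP
        exact P.prop_zero⟩
      isStableUnderShiftBy := fun n ↦ ⟨fun X hX P hP ↦ by
        have := h' P hP
        exact P.le_shift n _ (hX P hP)⟩
      toIsTriangulatedClosed₂ := .mk' fun D hD h₁ h₃ P hP ↦ by
        have := h P hP
        have := h' P hP
        exact P.ext_of_isTriangulatedClosed₂ D hD (h₁ P hP) (h₃ P hP) }

end Intersection

/-- A complex is contractible if its identity is homotopic to zero, i.e. if it is a zero object
of the homotopy category. -/
def contractible {C : Type*} [Category* C] [Preadditive C] : ObjectProperty (Hot C) :=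
  fun X ↦ IsZero X

lemma contractible_quotient_iff {C : Type*} [Category* C] [Preadditive C]
    (K : CochainComplex C ℤ) :
    contractible ((HomotopyCategory.quotient C (ComplexShape.up ℤ)).obj K) ↔
      Nonempty (Homotopy (𝟙 K) 0) :=
  HomotopyCategory.isZero_quotient_obj_iff K

instance {C : Type*} [Category* C] [Preadditive C] :
    (contractible (C := C)).IsClosedUnderIsomorphisms where
  of_iso e h := IsZero.of_iso h e.symm

instance {C : Type*} [Category* C] [Preadditive C] [HasZeroObject C] [HasBinaryBiproducts C] :
    (contractible (C := C)).IsTriangulated where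
  exists_zero := ⟨0, isZero_zero _, isZero_zero _⟩
  isStableUnderShiftBy n := ⟨fun _ h ↦ Functor.map_isZero (shiftFunctor _ n) h⟩
  toIsTriangulatedClosed₂ := .mk' fun D hD h₁ h₃ ↦
    Pretriangulated.Triangle.isZero₂_of_isZero₁₃ D hD h₁ h₃

section Acyclicity

variable (C : Type u) [Category.{v} C] [Abelian C]

lemma coacyclic_eq : coacyclic C = inter fun P ↦ ContainsTotals P ∧
    ∀ J : Type v, P.IsClosedUnderColimitsOfShape (Discrete J) := by
  ext X
  exact ⟨fun h P hP ↦ h P hP.1 hP.2, fun h P h₁ h₂ ↦ h P ⟨h₁, h₂⟩⟩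

lemma contraacyclic_eq : contraacyclic C = inter fun P ↦ ContainsTotals P ∧
    ∀ J : Type v, P.IsClosedUnderLimitsOfShape (Discrete J) := by
  ext X
  exact ⟨fun h P hP ↦ h P hP.1 hP.2, fun h P h₁ h₂ ↦ h P ⟨h₁, h₂⟩⟩

instance : (coacyclic C).IsClosedUnderIsomorphisms := by
  rw [coacyclic_eq]
  exact inter_iso _ fun _ h ↦ h.1.isClosedUnderIsomorphisms

instance : (coacyclic C).IsTriangulated := by
  rw [coacyclic_eq]
  exact inter_triangulated _ (fun _ h ↦ h.1.isClosedUnderIsomorphisms)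
    fun _ h ↦ h.1.isTriangulated

instance : (contraacyclic C).IsClosedUnderIsomorphisms := by
  rw [contraacyclic_eq]
  exact inter_iso _ fun _ h ↦ h.1.isClosedUnderIsomorphisms

instance : (contraacyclic C).IsTriangulated := by
  rw [contraacyclic_eq]
  exact inter_triangulated _ (fun _ h ↦ h.1.isClosedUnderIsomorphisms)
    fun _ h ↦ h.1.isTriangulated

lemma contractible_le_coacyclic : contractible (C := C) ≤ coacyclic C :=
  fun _ hX ↦ (coacyclic C).prop_of_isZero hX

lemma contractible_le_contraacyclic : contractible (C := C) ≤ contraacyclic C :=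
  fun _ hX ↦ (contraacyclic C).prop_of_isZero hX

end Acyclicity

lemma closedUnderBinaryProducts_of_biprod {C : Type*} [Category* C] [Preadditive C]
    [HasBinaryBiproducts C] (P : ObjectProperty C) [P.IsClosedUnderIsomorphisms]
    (h : ∀ X Y, P X → P Y → P (X ⊞ Y)) : P.IsClosedUnderBinaryProducts where
  limitsOfShape_le := by
    rintro X ⟨p⟩
    have hp := h _ _ (p.prop_diag_obj (.mk .left)) (p.prop_diag_obj (.mk .right))
    exact P.prop_of_iso (IsLimit.conePointUniqueUpToIso (BinaryBiproduct.isLimit _ _)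
      ((IsLimit.postcomposeHomEquiv (diagramIsoPair p.diag) _).2 p.isLimit)) hp

/-! ### The semicoderived category and complexes of `A`-injective `R`-modules -/

section Semico

variable {A R : Type u} [Ring A] [Ring R] (f : A →+* R)

/-- Complexes of left `R`-modules that are coacyclic as complexes of left `A`-modules. -/
def semicoacyclic : ObjectProperty (Hot (ModuleCat.{u} R)) :=
  (coacyclic (ModuleCat.{u} A)).inverseImage (hotMap (ModuleCat.restrictScalars f))

instance : (semicoacyclic f).IsTriangulated := by
  unfold semicoacyclic
  infer_instance

instance : (semicoacyclic f).IsClosedUnderIsomorphisms := by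
  unfold semicoacyclic
  infer_instance

/-- The `R/A`-semicoderived category of left `R`-modules. -/
abbrev SemicoderivedCategory := (semicoacyclic f).trW.Localization

/-- The `A`-injective left `R`-modules. -/
def relInjective : ObjectProperty (ModuleCat.{u} R) :=
  fun M ↦ Injective ((ModuleCat.restrictScalars f).obj M)

instance : (relInjective f).IsClosedUnderIsomorphisms where
  of_iso e h := Injective.of_iso ((ModuleCat.restrictScalars f).mapIso e) h

instance : (relInjective f).ContainsZero where
  exists_zero := ⟨0, isZero_zero _,
    Injective.of_iso ((ModuleCat.restrictScalars f).mapZeroObject).symm inferInstance⟩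

instance : (relInjective f).IsClosedUnderFiniteProducts := by
  have : (relInjective f).IsClosedUnderBinaryProducts :=
    closedUnderBinaryProducts_of_biprod _ fun X Y hX hY ↦ by
      have : Injective ((ModuleCat.restrictScalars f).obj X) := hX
      have : Injective ((ModuleCat.restrictScalars f).obj Y) := hY
      have := preservesBinaryBiproducts_of_preservesBiproducts (ModuleCat.restrictScalars f)
      exact Injective.of_iso ((ModuleCat.restrictScalars f).mapBiprod X Y).symm inferInstance
  exact .mk'

instance : HasFiniteProducts (relInjective f).FullSubcategory := inferInstance

instance : HasBinaryBiproducts (relInjective f).FullSubcategory :=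
  HasBinaryBiproducts.of_hasBinaryProducts

/-- The embedding of the additive category of `A`-injective left `R`-modules into the category
of left `R`-modules, applied termwise to complexes. -/
abbrev relInjectiveHot : Hot (relInjective f).FullSubcategory ⥤ Hot (ModuleCat.{u} R) :=
  hotMap (relInjective f).ι

/-- Complexes of `A`-injective left `R`-modules that are contractible as complexes of left
`A`-modules. -/
def relInjectiveContractible : ObjectProperty (Hot (relInjective f).FullSubcategory) :=
  contractible.inverseImage (relInjectiveHot f ⋙ hotMap (ModuleCat.restrictScalars f))

instance : (relInjectiveContractible f).IsTriangulated := by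
  unfold relInjectiveContractible
  infer_instance

/-- The derived category of `A`-injective left `R`-modules: the quotient of the homotopy category
of complexes of `A`-injective left `R`-modules by the complexes that are contractible over `A`. -/
abbrev RelInjectiveDerivedCategory := (relInjectiveContractible f).trW.Localization

/-- The embedding of complexes takes the complexes contractible over `A` to complexes coacyclic
over `A`, hence is a morphism of localization data. -/
def relInjectiveLocalizer :
    LocalizerMorphism (relInjectiveContractible f).trW (semicoacyclic f).trW where
  functor := relInjectiveHot f
  map X Y φ hφ := by
    obtain ⟨Z, a, b, hT, hZ⟩ := hφ
    exact ⟨_, _, _, (relInjectiveHot f).map_distinguished _ hT,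
      contractible_le_coacyclic _ _ hZ⟩

instance : (relInjectiveLocalizer f).functor.CommShift ℤ :=
  inferInstanceAs ((relInjectiveHot f).CommShift ℤ)

/-- The functor from the derived category of `A`-injective left `R`-modules to the
`R/A`-semicoderived category induced by the embedding of `A`-injective left `R`-modules into
left `R`-modules. -/
abbrev semicoComparison : RelInjectiveDerivedCategory f ⥤ SemicoderivedCategory f :=
  (relInjectiveLocalizer f).localizedFunctor (relInjectiveContractible f).trW.Q
    (semicoacyclic f).trW.Q

end Semico

/-! ### The semicontraderived category and complexes of `B`-projective `S`-modules -/

section Semictr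

variable {B S : Type u} [Ring B] [Ring S] (g : B →+* S)

/-- Complexes of left `S`-modules that are contraacyclic as complexes of left `B`-modules. -/
def semicontraacyclic : ObjectProperty (Hot (ModuleCat.{u} S)) :=
  (contraacyclic (ModuleCat.{u} B)).inverseImage (hotMap (ModuleCat.restrictScalars g))

instance : (semicontraacyclic g).IsTriangulated := by
  unfold semicontraacyclic
  infer_instance

instance : (semicontraacyclic g).IsClosedUnderIsomorphisms := by
  unfold semicontraacyclic
  infer_instance

/-- The `S/B`-semicontraderived category of left `S`-modules. -/
abbrev SemicontraderivedCategory := (semicontraacyclic g).trW.Localization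

/-- The `B`-projective left `S`-modules. -/
def relProjective : ObjectProperty (ModuleCat.{u} S) :=
  fun M ↦ Projective ((ModuleCat.restrictScalars g).obj M)

instance : (relProjective g).IsClosedUnderIsomorphisms where
  of_iso e h := Projective.of_iso ((ModuleCat.restrictScalars g).mapIso e) h

instance : (relProjective g).ContainsZero where
  exists_zero := ⟨0, isZero_zero _,
    Projective.of_iso ((ModuleCat.restrictScalars g).mapZeroObject).symm inferInstance⟩

instance : (relProjective g).IsClosedUnderFiniteProducts := by
  have : (relProjective g).IsClosedUnderBinaryProducts :=
    closedUnderBinaryProducts_of_biprod _ fun X Y hX hY ↦ by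
      have : Projective ((ModuleCat.restrictScalars g).obj X) := hX
      have : Projective ((ModuleCat.restrictScalars g).obj Y) := hY
      have := preservesBinaryBiproducts_of_preservesBiproducts (ModuleCat.restrictScalars g)
      exact Projective.of_iso ((ModuleCat.restrictScalars g).mapBiprod X Y).symm inferInstance
  exact .mk'

instance : HasFiniteProducts (relProjective g).FullSubcategory := inferInstance

instance : HasBinaryBiproducts (relProjective g).FullSubcategory :=
  HasBinaryBiproducts.of_hasBinaryProducts

/-- The embedding of the additive category of `B`-projective left `S`-modules into the category
of left `S`-modules, applied termwise to complexes. -/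
abbrev relProjectiveHot : Hot (relProjective g).FullSubcategory ⥤ Hot (ModuleCat.{u} S) :=
  hotMap (relProjective g).ι

/-- Complexes of `B`-projective left `S`-modules that are contractible as complexes of left
`B`-modules. -/
def relProjectiveContractible : ObjectProperty (Hot (relProjective g).FullSubcategory) :=
  contractible.inverseImage (relProjectiveHot g ⋙ hotMap (ModuleCat.restrictScalars g))

instance : (relProjectiveContractible g).IsTriangulated := by
  unfold relProjectiveContractible
  infer_instance

/-- The derived category of `B`-projective left `S`-modules: the quotient of the homotopy category
of complexes of `B`-projective left `S`-modules by the complexes that are contractible over `B`. -/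
abbrev RelProjectiveDerivedCategory := (relProjectiveContractible g).trW.Localization

/-- The embedding of complexes takes the complexes contractible over `B` to complexes contraacyclic
over `B`, hence is a morphism of localization data. -/
def relProjectiveLocalizer :
    LocalizerMorphism (relProjectiveContractible g).trW (semicontraacyclic g).trW where
  functor := relProjectiveHot g
  map X Y φ hφ := by
    obtain ⟨Z, a, b, hT, hZ⟩ := hφ
    exact ⟨_, _, _, (relProjectiveHot g).map_distinguished _ hT,
      contractible_le_contraacyclic _ _ hZ⟩

instance : (relProjectiveLocalizer g).functor.CommShift ℤ :=
  inferInstanceAs ((relProjectiveHot g).CommShift ℤ)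

/-- The functor from the derived category of `B`-projective left `S`-modules to the
`S/B`-semicontraderived category induced by the embedding of `B`-projective left `S`-modules into
left `S`-modules. -/
abbrev semicontraComparison : RelProjectiveDerivedCategory g ⥤ SemicontraderivedCategory g :=
  (relProjectiveLocalizer g).localizedFunctor (relProjectiveContractible g).trW.Q
    (semicontraacyclic g).trW.Q

end Semictr

end

end Semiderived

/-! Both functors compare a Verdier quotient of a full subcategory with a Verdier quotient of the
ambient homotopy category. Two facts therefore suffice: on the subcategory the two classes of
acyclic complexes coincide, and every complex of modules is joined to the subcategory by a morphism
with acyclic cone. The formal part is `localizedFunctor_isEquivalence_of_right_resolutions` and its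
dual.

Coincidence. A morphism from the total complex of a short exact sequence to a complex of injectives
is null-homotopic (`homotopy_zero_of_injective`). The complexes with no nonzero maps in the homotopy
category to complexes of injectives form a triangulated subcategory closed under direct sums, hence
contain all coacyclic complexes. A coacyclic complex of injectives thus has zero identity, that is,
it is contractible. The case of projectives is dual.

Resolutions. A complex of `R`-modules embeds into a contractible complex of injective `R`-modules,
its cokernel does too, and so on forever. The direct sum totalization of this resolution is the
union of an increasing filtration that starts with the given complex and has cones of identity maps
as subquotients. A telescope presents such a union as the cokernel of an injective map between
direct sums, so the inclusion of the given complex has semicoacyclic cone (`trW_toSumTotal`).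

The terms of the totalization are infinite direct sums of injective `R`-modules, which need not be
injective. Flatness of `R` makes the summands injective over `A`, so the sums are fp-injective over
`A` and have finite injective dimension, uniformly in the degree because the direct sum of all the
terms is again fp-injective. A finite number of further embeddings, folded together by cones, then
leads to a complex of `A`-injective `R`-modules (`hasRightResolution_of_injectiveDimension`).

Part (b) is dual, with product totalizations, inverse limits and cotelescopes. The new ingredient is
that products of projective `B`-modules are flat when `B` is right coherent. Solutions of linear
equations in such products come from finitely many solutions in `B` (`SolvesEquations`); this makes
the character module injective and the module flat. -/

namespace Semiderived

/-! ### Localizer morphisms given by full subcategories with enough resolutions -/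

section Localizer

variable {C₁ C₂ D₁ D₂ : Type*} [Category* C₁] [Category* C₂] [Category* D₁] [Category* D₂]
  {W₁ : MorphismProperty C₁} {W₂ : MorphismProperty C₂} (Φ : LocalizerMorphism W₁ W₂)
  (L₁ : C₁ ⥤ D₁) [L₁.IsLocalization W₁] (L₂ : C₂ ⥤ D₂) [L₂.IsLocalization W₂]

open Localization

/-- If every object of the target admits a morphism in `W₂` to an object in the image of a fully
faithful localizer morphism which reflects the localized classes, then the localized functor is
an equivalence. -/
lemma localizedFunctor_isEquivalence_of_right_resolutions
    [W₁.HasLeftCalculusOfFractions] [W₂.HasLeftCalculusOfFractions]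
    [Φ.functor.Full] [Φ.functor.Faithful]
    (hW : ∀ ⦃X Y : C₁⦄ (s : X ⟶ Y), W₂ (Φ.functor.map s) → W₁ s)
    (hres : ∀ Y : C₂, ∃ (X : C₁) (s : Y ⟶ Φ.functor.obj X), W₂ s) :
    (Φ.localizedFunctor L₁ L₂).IsEquivalence := by
  let F := Φ.localizedFunctor L₁ L₂
  let e : Φ.functor ⋙ L₂ ≅ L₁ ⋙ F := CatCommSq.iso Φ.functor L₁ L₂ F
  have : L₁.EssSurj := Localization.essSurj L₁ W₁
  have : L₂.EssSurj := Localization.essSurj L₂ W₂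
  have h₁ : F.EssSurj := ⟨fun Z ↦ by
    obtain ⟨X, s, hs⟩ := hres (L₂.objPreimage Z)
    have := Localization.inverts L₂ W₂ s hs
    exact ⟨L₁.obj X, ⟨(e.symm.app X) ≪≫ (asIso (L₂.map s)).symm ≪≫ L₂.objObjPreimageIso Z⟩⟩⟩
  have h₂ : F.Full := by
    refine F.full_of_comp_essSurj L₁ (fun X₁ X₂ φ ↦ ?_)
    obtain ⟨φ', hφ'⟩ : ∃ φ', φ = e.inv.app X₁ ≫ φ' ≫ e.hom.app X₂ :=
      ⟨e.hom.app X₁ ≫ φ ≫ e.inv.app X₂, by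
        simp [dsimp% e.inv_hom_id_app_assoc, dsimp% e.inv_hom_id_app]⟩
    obtain ⟨f, hf⟩ := Localization.exists_leftFraction L₂ W₂ φ'
    -- The middle object of the fraction is arbitrary; composing both legs with a resolution of it
    -- puts the fraction in the image of `Φ`.
    obtain ⟨X₃, a, ha⟩ := hres f.Y'
    obtain ⟨s', hs'⟩ := Φ.functor.map_surjective (f.s ≫ a)
    obtain ⟨g', hg'⟩ := Φ.functor.map_surjective (f.f ≫ a)
    let g : W₁.LeftFraction X₁ X₂ :=
      { Y' := X₃
        f := g'
        s := s'
        hs := hW _ (by rw [hs']; exact W₂.comp_mem _ _ f.hs ha) }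
    have := Localization.inverts L₁ _ _ g.hs
    refine ⟨g.map L₁ (Localization.inverts _ _), ?_⟩
    rw [← cancel_mono (F.map (L₁.map g.s)), ← Functor.map_comp,
      MorphismProperty.LeftFraction.map_comp_map_s]
    simp [g, hφ', hf, ← dsimp% NatIso.naturality_1 e, hs', hg',
      dsimp% e.hom_inv_id_app_assoc]
  have h₃ : F.Faithful := by
    refine F.faithful_of_comp_essSurj L₁ (fun X₁ X₂ φ₁ φ₂ hφ ↦ ?_)
    obtain ⟨α, hα₁, hα₂⟩ := Localization.exists_leftFraction₂ L₁ W₁ φ₁ φ₂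
    have := Localization.inverts L₁ _ _ α.hs
    rw [← cancel_mono (L₁.map α.s), hα₁, hα₂]
    have h1 := MorphismProperty.LeftFraction.map_comp_map_s α.fst L₁ (Localization.inverts _ _)
    have h2 := MorphismProperty.LeftFraction.map_comp_map_s α.snd L₁ (Localization.inverts _ _)
    dsimp at h1 h2
    rw [h1, h2]
    have key : L₂.map (Φ.functor.map α.f) = L₂.map (Φ.functor.map α.f') := by
      have : F.map (L₁.map α.f) = F.map (L₁.map α.f') := by
        rw [← h1, ← h2, F.map_comp, F.map_comp, ← hα₁, ← hα₂, hφ]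
      rw [← dsimp% NatIso.naturality_2 e α.f, ← dsimp% NatIso.naturality_2 e α.f', this]
    -- Equality after localization is witnessed by a denominator, which is again prolonged to the
    -- image of `Φ`, where faithfulness applies.
    rw [MorphismProperty.map_eq_iff_postcomp L₂ W₂] at key
    obtain ⟨Y, s, hs, fac⟩ := key
    obtain ⟨X₃, a, ha⟩ := hres Y
    obtain ⟨t, ht⟩ := Φ.functor.map_surjective (s ≫ a)
    have := Localization.inverts L₁ W₁ t (hW _ (by rw [ht]; exact W₂.comp_mem _ _ hs ha))
    rw [← cancel_mono (L₁.map t), ← L₁.map_comp, ← L₁.map_comp]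
    congr 1
    apply Φ.functor.map_injective
    simp [ht, reassoc_of% fac]
  exact { faithful := h₃, full := h₂, essSurj := h₁ }

/-- If every object of the target admits a morphism in `W₂` from an object in the image of a fully
faithful localizer morphism which reflects the localized classes, then the localized functor is
an equivalence. -/
lemma localizedFunctor_isEquivalence_of_left_resolutions
    [W₁.HasRightCalculusOfFractions] [W₂.HasRightCalculusOfFractions]
    [Φ.functor.Full] [Φ.functor.Faithful]
    (hW : ∀ ⦃X Y : C₁⦄ (s : X ⟶ Y), W₂ (Φ.functor.map s) → W₁ s)
    (hres : ∀ Y : C₂, ∃ (X : C₁) (s : Φ.functor.obj X ⟶ Y), W₂ s) :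
    (Φ.localizedFunctor L₁ L₂).IsEquivalence := by
  have : Φ.op.functor.Full := inferInstanceAs Φ.functor.op.Full
  have : Φ.op.functor.Faithful := inferInstanceAs Φ.functor.op.Faithful
  have h := localizedFunctor_isEquivalence_of_right_resolutions Φ.op L₁.op L₂.op
    (fun X Y s hs ↦ hW s.unop hs) (fun Y ↦ by
      obtain ⟨X, s, hs⟩ := hres Y.unop
      exact ⟨Opposite.op X, s.op, hs⟩)
  let F := Φ.localizedFunctor L₁ L₂
  -- The localized functor of `Φ.op` is not literally `F.op`, but both complete the same square, and
  -- being an equivalence does not depend on the choice.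
  let : CatCommSq Φ.op.functor L₁.op L₂.op F.op :=
    ⟨NatIso.op (CatCommSq.iso Φ.functor L₁ L₂ F).symm⟩
  let := Φ.op.catCommSq L₁.op L₂.op
  have : Φ.op.IsLocalizedEquivalence :=
    .mk' Φ.op L₁.op L₂.op (Φ.op.localizedFunctor L₁.op L₂.op)
  have h' : F.op.IsEquivalence := Φ.op.isEquivalence L₁.op L₂.op F.op
  have : F.op.Full := inferInstance
  have : F.op.Faithful := inferInstance
  have : F.Full := ⟨fun {X Y} φ ↦ by
    obtain ⟨ψ, hψ⟩ := F.op.map_surjective φ.op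
    exact ⟨ψ.unop, Quiver.Hom.op_inj hψ⟩⟩
  have : F.Faithful := ⟨fun {X Y} φ ψ h ↦ Quiver.Hom.op_inj
    (F.op.map_injective (Quiver.Hom.unop_inj h))⟩
  have : F.EssSurj := ⟨fun Z ↦
    ⟨(F.op.objPreimage (Opposite.op Z)).unop, ⟨(F.op.objObjPreimageIso (Opposite.op Z)).unop.symm⟩⟩⟩
  exact { }

end Localizer

/-! ### The comparison functors are triangulated -/

section Comparison

variable {A R : Type u} [Ring A] [Ring R] (f : A →+* R)

instance : (relInjectiveLocalizer f).functor.IsTriangulated :=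
  inferInstanceAs (relInjectiveHot f).IsTriangulated

instance : (relProjectiveLocalizer f).functor.IsTriangulated :=
  inferInstanceAs (relProjectiveHot f).IsTriangulated

/-- Up to isomorphism, arrows of the quotient lift to the homotopy category, so its distinguished
triangles come from there; precomposed with the quotient functor, the comparison is a composite of
triangulated functors. -/
lemma semicoComparison_isTriangulated : (semicoComparison f).IsTriangulated := by
  have := Localization.essSurj_mapArrow (relInjectiveContractible f).trW.Q
    (relInjectiveContractible f).trW
  exact Functor.isTriangulated_of_precomp_iso
    (CatCommSq.iso (relInjectiveLocalizer f).functor (relInjectiveContractible f).trW.Q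
    (semicoacyclic f).trW.Q (semicoComparison f)).symm

lemma semicontraComparison_isTriangulated : (semicontraComparison f).IsTriangulated := by
  have := Localization.essSurj_mapArrow (relProjectiveContractible f).trW.Q
    (relProjectiveContractible f).trW
  exact Functor.isTriangulated_of_precomp_iso
    (CatCommSq.iso (relProjectiveLocalizer f).functor (relProjectiveContractible f).trW.Q
    (semicontraacyclic f).trW.Q (semicontraComparison f)).symm

end Comparison

/-! ### Orthogonality of totalizations and complexes of injectives or projectives -/

section Orthogonality

open CochainComplex CochainComplex.HomComplex CochainComplex.mappingCone

variable {C : Type u} [Category.{v} C]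

section

variable [Preadditive C]

lemma ofHom_comp_δ {K L J : CochainComplex C ℤ} (f : K ⟶ L) {n m : ℤ} (z : Cochain L J n)
    (h : n + 1 = m) : δ n m ((Cochain.ofHom f).comp z (zero_add n)) =
      (Cochain.ofHom f).comp (δ n m z) (zero_add m) := by
  simp [δ_comp (Cochain.ofHom f) z (zero_add n) 1 m m h (zero_add 1) h]

lemma δ_comp_ofHom {K L J : CochainComplex C ℤ} (f : L ⟶ J) {n m : ℤ} (z : Cochain K L n)
    (h : n + 1 = m) : δ n m (z.comp (Cochain.ofHom f) (add_zero n)) =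
      (δ n m z).comp (Cochain.ofHom f) (add_zero m) := by
  simp [δ_comp_zero_cochain z (Cochain.ofHom f) m h]

lemma nonempty_homotopy_zero_of_δ_eq {K L : CochainComplex C ℤ} {u : K ⟶ L}
    (z : Cochain K L (-1)) (hz : δ (-1) 0 z = Cochain.ofHom u) : Nonempty (Homotopy u 0) :=
  ⟨(Cochain.equivHomotopy u 0).symm ⟨z, by simp [hz]⟩⟩

end

variable [Abelian C]

lemma shortExact_eval {S : ShortComplex (CochainComplex C ℤ)} (hS : S.ShortExact) (k : ℤ) :
    (S.map (HomologicalComplex.eval C (ComplexShape.up ℤ) k)).ShortExact :=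
  hS.map_of_exact _

/-- Cochains need not commute with differentials, so injectivity of each single term is enough. The
next three lemmas rest on the same freedom. -/
lemma exists_cochain_extension {K L J : CochainComplex C ℤ} (f : K ⟶ L) [∀ k, Mono (f.f k)]
    [∀ k, Injective (J.X k)] {n : ℤ} (z : Cochain K J n) :
    ∃ z' : Cochain L J n, (Cochain.ofHom f).comp z' (zero_add n) = z :=
  ⟨Cochain.mk fun p q h ↦ Injective.factorThru (z.v p q h) (f.f p), by ext; simp⟩

lemma exists_cochain_lift {P L M : CochainComplex C ℤ} (g : L ⟶ M) [∀ k, Epi (g.f k)]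
    [∀ k, Projective (P.X k)] {n : ℤ} (z : Cochain P M n) :
    ∃ z' : Cochain P L n, z'.comp (Cochain.ofHom g) (add_zero n) = z :=
  ⟨Cochain.mk fun p q h ↦ Projective.factorThru (z.v p q h) (g.f q), by ext; simp⟩

lemma exists_cochain_desc {S : ShortComplex (CochainComplex C ℤ)} (hS : S.ShortExact)
    {J : CochainComplex C ℤ} {n : ℤ} (z : Cochain S.X₂ J n)
    (hz : (Cochain.ofHom S.f).comp z (zero_add n) = 0) :
    ∃ z' : Cochain S.X₃ J n, (Cochain.ofHom S.g).comp z' (zero_add n) = z := by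
  have h (p q : ℤ) (hpq : p + n = q) : ∃ φ : S.X₃.X p ⟶ J.X q, S.g.f p ≫ φ = z.v p q hpq := by
    have hp := shortExact_eval hS p
    have := hp.epi_g
    have h0 := Cochain.congr_v hz p q hpq
    simp only [Cochain.zero_cochain_comp_v, Cochain.ofHom_v, Cochain.zero_v] at h0
    exact ⟨hp.exact.desc (z.v p q hpq) h0, hp.exact.g_desc _ _⟩
  choose φ hφ using h
  exact ⟨Cochain.mk φ, by ext p q hpq; simp [hφ]⟩

lemma exists_cochain_lift_kernel {S : ShortComplex (CochainComplex C ℤ)} (hS : S.ShortExact)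
    {P : CochainComplex C ℤ} {n : ℤ} (z : Cochain P S.X₂ n)
    (hz : z.comp (Cochain.ofHom S.g) (add_zero n) = 0) :
    ∃ z' : Cochain P S.X₁ n, z'.comp (Cochain.ofHom S.f) (add_zero n) = z := by
  have h (p q : ℤ) (hpq : p + n = q) : ∃ φ : P.X p ⟶ S.X₁.X q, φ ≫ S.f.f q = z.v p q hpq := by
    have hq := shortExact_eval hS q
    have := hq.mono_f
    have h0 := Cochain.congr_v hz p q hpq
    simp only [Cochain.comp_zero_cochain_v, Cochain.ofHom_v, Cochain.zero_v] at h0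
    exact ⟨hq.exact.lift (z.v p q hpq) h0, hq.exact.lift_f _ _⟩
  choose φ hφ using h
  exact ⟨Cochain.mk φ, by ext p q hpq; simp [hφ]⟩

lemma cochain_eq_of_comp_mono {P K L : CochainComplex C ℤ} (f : K ⟶ L) [∀ k, Mono (f.f k)]
    {n : ℤ} {z z' : Cochain P K n} (h : z.comp (Cochain.ofHom f) (add_zero n) =
      z'.comp (Cochain.ofHom f) (add_zero n)) : z = z' := by
  ext p q hpq
  have := Cochain.congr_v h p q hpq
  simpa [cancel_mono] using this

lemma cochain_eq_of_epi_comp {L M J : CochainComplex C ℤ} (g : L ⟶ M) [∀ k, Epi (g.f k)]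
    {n : ℤ} {z z' : Cochain M J n} (h : (Cochain.ofHom g).comp z (zero_add n) =
      (Cochain.ofHom g).comp z' (zero_add n)) : z = z' := by
  ext p q hpq
  have := Cochain.congr_v h p q hpq
  simpa [cancel_epi] using this

/-- A morphism from the totalization of a short exact sequence of complexes to a complex of
injectives is homotopic to zero. -/
lemma homotopy_zero_of_injective {S : ShortComplex (CochainComplex C ℤ)} (hS : S.ShortExact)
    (J : CochainComplex C ℤ) [∀ k, Injective (J.X k)]
    (u : mappingCone (descShortComplex S) ⟶ J) : Nonempty (Homotopy u 0) := by
  have (k : ℤ) : Mono (S.f.f k) := (shortExact_eval hS k).mono_f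
  have (k : ℤ) : Epi (S.g.f k) := (shortExact_eval hS k).epi_g
  let φ := descShortComplex S
  -- The morphism `u` amounts to cochains `a`, `b`, `c` of degrees -2, -1, 0 on the three complexes,
  -- with `c` closed, `δ b` equal to `c` after `S.g`, and `δ a` equal to minus `b` after `S.f`.
  let b₀ : Cochain _ J (-1) := (inl φ).comp (Cochain.ofHom u) (add_zero (-1))
  let c : S.X₃ ⟶ J := inr φ ≫ u
  let a : Cochain S.X₁ J (-2) := (inl S.f).comp b₀ (by lia)
  let b : Cochain S.X₂ J (-1) := (Cochain.ofHom (inr S.f)).comp b₀ (by lia)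
  have hb₀ : δ (-1) 0 b₀ = Cochain.ofHom (φ ≫ c) := by
    simp only [b₀, c]
    rw [δ_comp_ofHom _ _ (by lia), δ_inl]
    simp
  have hb : δ (-1) 0 b = Cochain.ofHom (S.g ≫ c) := by
    simp only [b]
    rw [ofHom_comp_δ _ _ (by lia), hb₀, ← Cochain.ofHom_comp, inr_descShortComplex_assoc]
  have hφ : (inl S.f).comp (Cochain.ofHom (φ ≫ c)) (add_zero (-1)) = 0 := by
    ext p q hpq
    simp [φ]
  have ha : δ (-2) (-1) a = -(Cochain.ofHom S.f).comp b (zero_add (-1)) := by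
    simp only [a, b]
    rw [δ_comp (inl S.f) b₀ (by lia) 0 0 (-1) (by lia) (by lia) (by lia), hb₀, hφ, δ_inl]
    simp [Int.negOnePow_neg]
  -- Correcting `b` by `δ s` kills its restriction to `S.X₁`, so the difference descends to `β` on
  -- `S.X₃`. The null-homotopy of `u` has components `0`, `s`, `β`.
  obtain ⟨s, hs⟩ := exists_cochain_extension S.f (-a)
  have h1 : (Cochain.ofHom S.f).comp (b - δ (-2) (-1) s) (zero_add (-1)) = 0 := by
    rw [Cochain.comp_sub, ← ofHom_comp_δ _ _ (by lia), hs, δ_neg, ha]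
    simp
  obtain ⟨β, hβ⟩ := exists_cochain_desc hS _ h1
  have hβc : δ (-1) 0 β = Cochain.ofHom c := by
    apply cochain_eq_of_epi_comp S.g
    rw [← ofHom_comp_δ _ _ (by lia), hβ, δ_sub, hb, δ_δ]
    simp
  let α : Cochain (mappingCone S.f) J (-2) := descCochain S.f (0 : Cochain _ _ (-3)) s (by lia)
  have hα : δ (-2) (-1) α + (Cochain.ofHom φ).comp β (zero_add (-1)) = b₀ := by
    rw [ext_cochain_from_iff S.f (-2) (-1) (by lia)]
    have hφβ : (inl S.f).comp ((Cochain.ofHom φ).comp β (zero_add (-1))) (by lia) =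
        (0 : Cochain _ _ (-2)) := by
      ext p q hpq
      simp [Cochain.comp_v _ _ (show (-1 : ℤ) + -1 = -2 by lia) p (p - 1) q (by lia) (by lia), φ]
    constructor
    · rw [Cochain.comp_add, hφβ, δ_descCochain _ _ _ _ _ (by lia), Cochain.comp_add,
        inl_fst_assoc, inl_snd_assoc, hs]
      simp [a, Int.negOnePow_neg]
    · rw [Cochain.comp_add, δ_descCochain _ _ _ _ _ (by lia), Cochain.comp_add, inr_fst_assoc,
        inr_snd_assoc, ← Cochain.comp_assoc_of_first_is_zero_cochain, ← Cochain.ofHom_comp,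
        inr_descShortComplex, hβ]
      simp [b]
  refine nonempty_homotopy_zero_of_δ_eq (descCochain φ α β (by lia)) ?_
  rw [δ_descCochain _ _ _ _ _ (by lia), hβc, ext_cochain_from_iff φ (-1) 0 (by lia)]
  constructor
  · rw [Cochain.comp_add, inl_fst_assoc, inl_snd_assoc, Int.negOnePow_zero, one_smul, hα]
    simp [b₀]
  · rw [Cochain.comp_add, inr_fst_assoc, inr_snd_assoc]
    simp [c]

/-- A morphism from a complex of projectives to the totalization of a short exact sequence of
complexes is homotopic to zero. -/
lemma homotopy_zero_of_projective {S : ShortComplex (CochainComplex C ℤ)} (hS : S.ShortExact)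
    (P : CochainComplex C ℤ) [∀ k, Projective (P.X k)]
    (u : P ⟶ mappingCone (descShortComplex S)) : Nonempty (Homotopy u 0) := by
  have (k : ℤ) : Mono (S.f.f k) := (shortExact_eval hS k).mono_f
  have (k : ℤ) : Epi (S.g.f k) := (shortExact_eval hS k).epi_g
  let φ := descShortComplex S
  -- Dually, `u` has components `a`, `b`, `c` of degrees 2, 1, 0 in the three complexes.
  let c₁ : Cochain P (mappingCone S.f) 1 := (Cochain.ofHom u).comp (fst φ).1 (zero_add 1)
  let c : Cochain P S.X₃ 0 := (Cochain.ofHom u).comp (snd φ) (zero_add 0)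
  let a : Cochain P S.X₁ 2 := c₁.comp (fst S.f).1 (by lia)
  let b : Cochain P S.X₂ 1 := c₁.comp (snd S.f) (by lia)
  have hc₁ : δ 1 2 c₁ = 0 := by
    simp only [c₁]
    rw [ofHom_comp_δ _ _ (by lia), Cocycle.δ_eq_zero, Cochain.comp_zero]
  have hc : δ 0 1 c = -c₁.comp (Cochain.ofHom φ) (add_zero 1) := by
    simp only [c, c₁]
    rw [ofHom_comp_δ _ _ (by lia), δ_snd, Cochain.comp_neg,
      Cochain.comp_assoc_of_first_is_zero_cochain]
  have ha : δ 1 2 b = -a.comp (Cochain.ofHom S.f) (add_zero 2) := by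
    simp only [a, b]
    rw [δ_comp_zero_cochain _ _ _ (by lia), hc₁, δ_snd, Cochain.zero_comp, add_zero,
      Cochain.comp_neg, Cochain.comp_assoc_of_third_is_zero_cochain]
  have hφ : Cochain.ofHom φ = (snd S.f).comp (Cochain.ofHom S.g) (zero_add 0) := by
    rw [ext_cochain_from_iff S.f (-1) 0 (by lia)]
    constructor
    · rw [inl_snd_assoc]
      ext p q hpq
      simp [φ]
    · rw [inr_snd_assoc, ← Cochain.ofHom_comp, inr_descShortComplex]
  have hb : b.comp (Cochain.ofHom S.g) (add_zero 1) = c₁.comp (Cochain.ofHom φ) (add_zero 1) := by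
    simp only [b]
    rw [hφ, Cochain.comp_assoc_of_second_is_zero_cochain]
  -- Once `c` is lifted to `S.X₂`, the cochain `-b - δ α₂` has values in the kernel of `S.g` and
  -- lifts to `α₁`. The null-homotopy has components `α₁`, `α₂`, `0`.
  obtain ⟨α₂, hα₂⟩ := exists_cochain_lift S.g c
  have h1 : (-b - δ 0 1 α₂).comp (Cochain.ofHom S.g) (add_zero 1) = 0 := by
    rw [Cochain.sub_comp, ← δ_comp_ofHom _ _ (by lia), hα₂, hc, Cochain.neg_comp, hb]
    simp
  obtain ⟨α₁, hα₁⟩ := exists_cochain_lift_kernel hS _ h1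
  have hα₁a : δ 1 2 α₁ = a := by
    apply cochain_eq_of_comp_mono S.f
    rw [← δ_comp_ofHom _ _ (by lia), hα₁, δ_sub, δ_neg, ha, δ_δ]
    simp
  let α : Cochain P (mappingCone S.f) 0 := liftCochain S.f α₁ α₂ (by lia)
  have hα : -δ 0 1 α = c₁ := by
    rw [ext_cochain_to_iff S.f 1 2 (by lia), δ_liftCochain _ _ _ _ 2 (by lia), hα₁a, hα₁]
    constructor
    · simp [a]
    · simp [b]
  have hαc : α.comp (Cochain.ofHom φ) (add_zero 0) = c := by
    simp only [α]
    rw [hφ, ← Cochain.comp_assoc_of_second_is_zero_cochain, liftCochain_snd, hα₂]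
  refine nonempty_homotopy_zero_of_δ_eq
    (liftCochain φ α (0 : Cochain P S.X₃ (-1)) (by lia)) ?_
  rw [δ_liftCochain _ _ _ _ 1 (by lia), ext_cochain_to_iff φ 0 1 (by lia), ← Cochain.neg_comp, hα,
    δ_zero, zero_add, hαc]
  constructor
  · simp [c₁]
  · simp [c]

end Orthogonality

/-! ### Coproducts and products in the homotopy category -/

section Products

open CochainComplex CochainComplex.HomComplex

variable {C : Type u} [Category.{v} C] [Preadditive C] {ι : Type*}

/-- A cofan of complexes that is a coproduct in each degree is a coproduct in the homotopy
category. -/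
lemma isColimit_quotient_cofan {X : ι → CochainComplex C ℤ} {Y : CochainComplex C ℤ}
    (i : ∀ j, X j ⟶ Y) (h : ∀ k, Nonempty (IsColimit (Cofan.mk (Y.X k) fun j ↦ (i j).f k))) :
    Nonempty (IsColimit (Cofan.mk ((HomotopyCategory.quotient C (ComplexShape.up ℤ)).obj Y)
      fun j ↦ (HomotopyCategory.quotient C (ComplexShape.up ℤ)).map (i j))) := by
  replace h k := (h k).some
  have ext {k : ℤ} {Z : C} {a b : Y.X k ⟶ Z} (hab : ∀ j, (i j).f k ≫ a = (i j).f k ≫ b) : a = b :=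
    Cofan.IsColimit.hom_ext (h k) _ _ hab
  -- A null-homotopy is a family of maps out of the terms of `Y`, so those of the restrictions to
  -- the summands assemble degreewise. This gives uniqueness of descended maps up to homotopy.
  have zero {T : CochainComplex C ℤ} (g : Y ⟶ T)
      (hg : ∀ j, Nonempty (Homotopy (i j ≫ g) 0)) : Nonempty (Homotopy g 0) := by
    replace hg j := Cochain.equivHomotopy _ _ (hg j).some
    let z : Cochain Y T (-1) := Cochain.mk fun p q hpq ↦
      Cofan.IsColimit.desc (h p) fun j ↦ (hg j).1.v p q hpq
    have hz j : (Cochain.ofHom (i j)).comp z (zero_add (-1)) = (hg j).1 := by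
      ext p q hpq
      simpa [z] using! Cofan.IsColimit.fac (h p) (fun j ↦ (hg j).1.v p q hpq) j
    refine nonempty_homotopy_zero_of_δ_eq z ?_
    ext p
    apply ext
    intro j
    have := Cochain.congr_v (ofHom_comp_δ (i j) z (neg_add_cancel 1)) p p (add_zero p)
    rw [hz, ← add_zero (δ (-1) 0 _), ← Cochain.ofHom_zero, ← (hg j).2] at this
    simpa using this.symm
  have rep (t : Cofan fun j ↦ (HomotopyCategory.quotient C (ComplexShape.up ℤ)).obj (X j)) :
      ∃ d : (HomotopyCategory.quotient C (ComplexShape.up ℤ)).obj Y ⟶ t.pt,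
        ∀ j, (HomotopyCategory.quotient C (ComplexShape.up ℤ)).map (i j) ≫ d = t.inj j := by
    obtain ⟨T, hT⟩ := HomotopyCategory.quotient_obj_surjective t.pt
    have (j : ι) : ∃ φ : X j ⟶ T, (HomotopyCategory.quotient _ _).map φ =
        t.inj j ≫ eqToHom hT.symm :=
      (HomotopyCategory.quotient _ _).map_surjective _
    choose φ hφ using this
    let d : Y ⟶ T :=
      { f k := Cofan.IsColimit.desc (h k) fun j ↦ (φ j).f k
        comm' k l _ := ext fun j ↦ by
          have h1 := Cofan.IsColimit.fac (h k) (fun j ↦ (φ j).f k) j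
          have h2 := Cofan.IsColimit.fac (h l) (fun j ↦ (φ j).f l) j
          simp only [cofan_mk_inj] at h1 h2
          rw [reassoc_of% h1, (i j).comm_assoc, h2, (φ j).comm] }
    refine ⟨(HomotopyCategory.quotient _ _).map d ≫ eqToHom hT, fun j ↦ ?_⟩
    have : i j ≫ d = φ j := by
      ext k
      exact Cofan.IsColimit.fac (h k) (fun j ↦ (φ j).f k) j
    rw [← Functor.map_comp_assoc, this, hφ]
    simp
  choose d hd using rep
  refine ⟨Cofan.IsColimit.mk _ d hd fun t (m : (HomotopyCategory.quotient C _).obj Y ⟶ t.pt) hm ↦ ?_⟩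
  obtain ⟨T, hT⟩ := HomotopyCategory.quotient_obj_surjective t.pt
  obtain ⟨g, hg⟩ := (HomotopyCategory.quotient _ _).map_surjective ((m - d t) ≫ eqToHom hT.symm)
  have : (HomotopyCategory.quotient _ _).map g = 0 := by
    rw [HomotopyCategory.quotient_map_eq_zero_iff]
    refine zero g fun j ↦ ?_
    rw [← HomotopyCategory.quotient_map_eq_zero_iff, Functor.map_comp, hg,
      Preadditive.sub_comp, Preadditive.comp_sub, ← Category.assoc, ← Category.assoc, hd,
      sub_eq_zero]
    congr 1
    exact hm j
  rw [← sub_eq_zero, ← cancel_mono (eqToHom hT.symm), ← hg, this, zero_comp]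

/-- A fan of complexes that is a product in each degree is a product in the homotopy category. -/
lemma isLimit_quotient_fan {X : ι → CochainComplex C ℤ} {Y : CochainComplex C ℤ}
    (i : ∀ j, Y ⟶ X j) (h : ∀ k, Nonempty (IsLimit (Fan.mk (Y.X k) fun j ↦ (i j).f k))) :
    Nonempty (IsLimit (Fan.mk ((HomotopyCategory.quotient C (ComplexShape.up ℤ)).obj Y)
      fun j ↦ (HomotopyCategory.quotient C (ComplexShape.up ℤ)).map (i j))) := by
  replace h k := (h k).some
  have ext {k : ℤ} {Z : C} {a b : Z ⟶ Y.X k} (hab : ∀ j, a ≫ (i j).f k = b ≫ (i j).f k) : a = b :=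
    Fan.IsLimit.hom_ext (h k) _ _ hab
  -- Null-homotopies of the projections assemble degreewise into one of `g`, which gives uniqueness
  -- of lifts up to homotopy.
  have zero {T : CochainComplex C ℤ} (g : T ⟶ Y)
      (hg : ∀ j, Nonempty (Homotopy (g ≫ i j) 0)) : Nonempty (Homotopy g 0) := by
    replace hg j := Cochain.equivHomotopy _ _ (hg j).some
    let z : Cochain T Y (-1) := Cochain.mk fun p q hpq ↦
      Fan.IsLimit.lift (h q) fun j ↦ (hg j).1.v p q hpq
    have hz j : z.comp (Cochain.ofHom (i j)) (add_zero (-1)) = (hg j).1 := by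
      ext p q hpq
      simpa [z] using! Fan.IsLimit.fac (h q) (fun j ↦ (hg j).1.v p q hpq) j
    refine nonempty_homotopy_zero_of_δ_eq z ?_
    ext p
    apply ext
    intro j
    have := Cochain.congr_v (δ_comp_ofHom (i j) z (neg_add_cancel 1)) p p (add_zero p)
    rw [hz, ← add_zero (δ (-1) 0 _), ← Cochain.ofHom_zero, ← (hg j).2] at this
    simpa using this.symm
  have rep (t : Fan fun j ↦ (HomotopyCategory.quotient C (ComplexShape.up ℤ)).obj (X j)) :
      ∃ d : t.pt ⟶ (HomotopyCategory.quotient C (ComplexShape.up ℤ)).obj Y,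
        ∀ j, d ≫ (HomotopyCategory.quotient C (ComplexShape.up ℤ)).map (i j) = t.proj j := by
    obtain ⟨T, hT⟩ := HomotopyCategory.quotient_obj_surjective t.pt
    have (j : ι) : ∃ φ : T ⟶ X j, (HomotopyCategory.quotient _ _).map φ =
        eqToHom hT ≫ t.proj j :=
      (HomotopyCategory.quotient _ _).map_surjective _
    choose φ hφ using this
    let d : T ⟶ Y :=
      { f k := Fan.IsLimit.lift (h k) fun j ↦ (φ j).f k
        comm' k l _ := ext fun j ↦ by
          have h1 := Fan.IsLimit.fac (h k) (fun j ↦ (φ j).f k) j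
          have h2 := Fan.IsLimit.fac (h l) (fun j ↦ (φ j).f l) j
          simp only [fan_mk_proj] at h1 h2
          rw [Category.assoc, Category.assoc, h2, ← (i j).comm, reassoc_of% h1, (φ j).comm] }
    refine ⟨eqToHom hT.symm ≫ (HomotopyCategory.quotient _ _).map d, fun j ↦ ?_⟩
    have : d ≫ i j = φ j := by
      ext k
      exact Fan.IsLimit.fac (h k) (fun j ↦ (φ j).f k) j
    rw [Category.assoc, ← Functor.map_comp, this, hφ]
    simp
  choose d hd using rep
  refine ⟨Fan.IsLimit.mk _ d hd fun t (m : t.pt ⟶ (HomotopyCategory.quotient C _).obj Y) hm ↦ ?_⟩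
  obtain ⟨T, hT⟩ := HomotopyCategory.quotient_obj_surjective t.pt
  obtain ⟨g, hg⟩ := (HomotopyCategory.quotient _ _).map_surjective (eqToHom hT ≫ (m - d t))
  have : (HomotopyCategory.quotient _ _).map g = 0 := by
    rw [HomotopyCategory.quotient_map_eq_zero_iff]
    refine zero g fun j ↦ ?_
    rw [← HomotopyCategory.quotient_map_eq_zero_iff, Functor.map_comp, hg,
      Category.assoc, Preadditive.sub_comp, hd, Preadditive.comp_sub, sub_eq_zero]
    congr 1
    exact hm j
  rw [← sub_eq_zero, ← cancel_epi (eqToHom hT), ← hg, this, comp_zero]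

end Products

/-! ### Triangulated subcategories containing the totalizations -/

section Totals

open CochainComplex CochainComplex.mappingCone

variable {C : Type u} [Category.{v} C] [Abelian C]

/-- A morphism in the homotopy category belongs to `trW` if and only if its cone belongs to the
subcategory. -/
lemma trW_quotient_map_iff (P : ObjectProperty (Hot C)) [P.IsTriangulated]
    [P.IsClosedUnderIsomorphisms] {K L : CochainComplex C ℤ} (φ : K ⟶ L) :
    P.trW ((HomotopyCategory.quotient C (ComplexShape.up ℤ)).map φ) ↔
      P ((HomotopyCategory.quotient C (ComplexShape.up ℤ)).obj (mappingCone φ)) :=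
  P.trW_iff_of_distinguished _ (HomotopyCategory.mappingCone_triangleh_distinguished φ)

namespace ContainsTotals

variable {P : ObjectProperty (Hot C)} (hP : ContainsTotals P)
  {S : ShortComplex (CochainComplex C ℤ)} (hS : S.ShortExact)

include hP hS

/-- The total complex is defined as the cone of this map; the lemmas below all use totals in this
form. -/
lemma trW_descShortComplex :
    P.trW ((HomotopyCategory.quotient C (ComplexShape.up ℤ)).map (descShortComplex S)) := by
  have := hP.isTriangulated
  have := hP.isClosedUnderIsomorphisms
  rw [trW_quotient_map_iff]
  exact hP.total S hS

/-- Modulo `P`, the cone of `S.f` is identified with `S.X₃`. -/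
lemma trW_f (h : P ((HomotopyCategory.quotient C (ComplexShape.up ℤ)).obj S.X₃)) :
    P.trW ((HomotopyCategory.quotient C (ComplexShape.up ℤ)).map S.f) := by
  have := hP.isTriangulated
  have := hP.isClosedUnderIsomorphisms
  rw [trW_quotient_map_iff]
  obtain ⟨_, _, _, hT, hZ⟩ := hP.trW_descShortComplex hS
  exact P.ext_of_isTriangulatedClosed₁ _ hT h hZ

lemma prop_X₃ (h₁ : P ((HomotopyCategory.quotient C (ComplexShape.up ℤ)).obj S.X₁))
    (h₂ : P ((HomotopyCategory.quotient C (ComplexShape.up ℤ)).obj S.X₂)) :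
    P ((HomotopyCategory.quotient C (ComplexShape.up ℤ)).obj S.X₃) := by
  have := hP.isTriangulated
  have := hP.isClosedUnderIsomorphisms
  obtain ⟨_, _, _, hT, hZ⟩ := hP.trW_descShortComplex hS
  exact P.ext_of_isTriangulatedClosed₂ _ hT (P.ext_of_isTriangulatedClosed₃ _
    (HomotopyCategory.mappingCone_triangleh_distinguished S.f) h₁ h₂) hZ

/-- `S.g` factors through the cone of `S.f`: the first factor has the shift of `S.X₁` as its cone,
and the second has a total complex. -/
lemma trW_g (h : P ((HomotopyCategory.quotient C (ComplexShape.up ℤ)).obj S.X₁)) :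
    P.trW ((HomotopyCategory.quotient C (ComplexShape.up ℤ)).map S.g) := by
  have := hP.isTriangulated
  have := hP.isClosedUnderIsomorphisms
  rw [← inr_descShortComplex, Functor.map_comp]
  refine P.trW.comp_mem _ _ ?_ (hP.trW_descShortComplex hS)
  exact (P.trW_iff_of_distinguished' _
    (HomotopyCategory.mappingCone_triangleh_distinguished S.f)).2 h

lemma prop_X₁ (h₂ : P ((HomotopyCategory.quotient C (ComplexShape.up ℤ)).obj S.X₂))
    (h₃ : P ((HomotopyCategory.quotient C (ComplexShape.up ℤ)).obj S.X₃)) :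
    P ((HomotopyCategory.quotient C (ComplexShape.up ℤ)).obj S.X₁) := by
  have := hP.isTriangulated
  have := hP.isClosedUnderIsomorphisms
  obtain ⟨_, _, _, hT, hZ⟩ := hP.trW_f hS h₃
  exact P.ext_of_isTriangulatedClosed₁ _ hT h₂ hZ

end ContainsTotals

/-- An exact functor preserves short exact sequences and commutes with cones. Comparing the maps
`descShortComplex` instead of the total complexes requires only one cone isomorphism. -/
lemma ContainsTotals.inverseImage {D : Type*} [Category.{v} D] [Abelian D]
    {P : ObjectProperty (Hot D)} (hP : ContainsTotals P) (F : C ⥤ D) [F.Additive]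
    [PreservesFiniteLimits F] [PreservesFiniteColimits F] :
    ContainsTotals (P.inverseImage (hotMap F)) := by
  have := hP.isTriangulated
  have := hP.isClosedUnderIsomorphisms
  refine ⟨inferInstance, inferInstance, fun S hS ↦ ?_⟩
  have hS' : (S.map (F.mapHomologicalComplex (ComplexShape.up ℤ))).ShortExact :=
    HomologicalComplex.shortExact_of_degreewise_shortExact _ fun k ↦
      (shortExact_eval hS k).map_of_exact F
  have h := hP.trW_descShortComplex hS'
  have : (P.inverseImage (hotMap F)).trW
      ((HomotopyCategory.quotient C (ComplexShape.up ℤ)).map (descShortComplex S)) := by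
    rw [ObjectProperty.inverseImage_trW_iff]
    have key := P.trW.comp_mem _ _ (P.trW_of_isIso ((HomotopyCategory.quotient D _).map
      (mapHomologicalComplexIso S.f F).hom)) h
    have e := ((HomotopyCategory.quotient D _).map_comp _ _).symm.trans
      (congrArg (HomotopyCategory.quotient D _).map
        (mapHomologicalComplexIso_hom_descShortComplex F S))
    exact Eq.mp (congrArg (fun x ↦ P.trW x) e) key
  exact (trW_quotient_map_iff _ _).1 this

lemma containsTotals_coacyclic : ContainsTotals (coacyclic C) where
  isTriangulated := inferInstance
  isClosedUnderIsomorphisms := inferInstance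
  total S hS _ hP _ := hP.total S hS

lemma containsTotals_contraacyclic : ContainsTotals (contraacyclic C) where
  isTriangulated := inferInstance
  isClosedUnderIsomorphisms := inferInstance
  total S hS _ hP _ := hP.total S hS

instance (J : Type v) : (coacyclic C).IsClosedUnderColimitsOfShape (Discrete J) where
  colimitsOfShape_le := fun _ ⟨p⟩ P hP hP' ↦
    (hP' J).colimitsOfShape_le _ ⟨{ p with prop_diag_obj j := p.prop_diag_obj j P hP hP' }⟩

instance (J : Type v) : (contraacyclic C).IsClosedUnderLimitsOfShape (Discrete J) where
  limitsOfShape_le := fun _ ⟨p⟩ P hP hP' ↦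
    (hP' J).limitsOfShape_le _ ⟨{ p with prop_diag_obj j := p.prop_diag_obj j P hP hP' }⟩

/-- Closure is given for index types in `Type v`; `ULift` moves `ℕ` there. -/
instance : (coacyclic C).IsClosedUnderColimitsOfShape (Discrete ℕ) :=
  .of_equivalence (Discrete.equivalence Equiv.ulift.{v})

instance : (contraacyclic C).IsClosedUnderLimitsOfShape (Discrete ℕ) :=
  .of_equivalence (Discrete.equivalence Equiv.ulift.{v})

/-! ### Co(ntra)acyclic complexes of injectives or projectives are contractible -/

variable (C) in
/-- The complexes isomorphic in the homotopy category to complexes of injectives. -/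
def hotInjectives : ObjectProperty (Hot C) := fun X ↦
  ∃ J : CochainComplex C ℤ, (∀ k, Injective (J.X k)) ∧
    Nonempty (X ≅ (HomotopyCategory.quotient C (ComplexShape.up ℤ)).obj J)

variable (C) in
/-- The complexes isomorphic in the homotopy category to complexes of projectives. -/
def hotProjectives : ObjectProperty (Hot C) := fun X ↦
  ∃ J : CochainComplex C ℤ, (∀ k, Projective (J.X k)) ∧
    Nonempty (X ≅ (HomotopyCategory.quotient C (ComplexShape.up ℤ)).obj J)

/-- Shift stability is what makes the left orthogonal a triangulated subcategory. -/
instance : (hotInjectives C).IsStableUnderShift ℤ where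
  isStableUnderShiftBy n := ⟨fun _ ⟨J, hJ, ⟨e⟩⟩ ↦ ⟨J⟦n⟧, fun k ↦ hJ (k + n),
    ⟨(CategoryTheory.shiftFunctor _ n).mapIso e ≪≫
      (((HomotopyCategory.quotient C (.up ℤ)).commShiftIso n).symm.app J)⟩⟩⟩

instance : (hotProjectives C).IsStableUnderShift ℤ where
  isStableUnderShiftBy n := ⟨fun _ ⟨J, hJ, ⟨e⟩⟩ ↦ ⟨J⟦n⟧, fun k ↦ hJ (k + n),
    ⟨(CategoryTheory.shiftFunctor _ n).mapIso e ≪≫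
      (((HomotopyCategory.quotient C (.up ℤ)).commShiftIso n).symm.app J)⟩⟩⟩

/-- By minimality of the coacyclic class: the orthogonal is triangulated, contains totals by
`homotopy_zero_of_injective`, and is closed under coproducts because a map out of a coproduct is
determined on the summands. -/
lemma coacyclic_le_leftOrthogonal : coacyclic C ≤ (hotInjectives C).leftOrthogonal := by
  intro X hX
  refine hX _ ⟨inferInstance, inferInstance, fun S hS Y φ ⟨J, hJ, ⟨e⟩⟩ ↦ ?_⟩
    fun ι ↦ ⟨fun Y ⟨p⟩ Z φ hZ ↦ p.isColimit.hom_ext fun j ↦ ?_⟩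
  · obtain ⟨u, hu⟩ := (HomotopyCategory.quotient C (ComplexShape.up ℤ)).map_surjective (φ ≫ e.hom)
    have h : φ ≫ e.hom = 0 :=
      hu.symm.trans ((HomotopyCategory.quotient_map_eq_zero_iff u).2 (homotopy_zero_of_injective hS J u))
    exact (cancel_mono e.hom).1 (h.trans zero_comp.symm)
  · rw [comp_zero]
    exact p.prop_diag_obj j _ hZ

lemma contraacyclic_le_rightOrthogonal :
    contraacyclic C ≤ (hotProjectives C).rightOrthogonal := by
  intro X hX
  refine hX _ ⟨inferInstance, inferInstance, fun S hS Y φ ⟨J, hJ, ⟨e⟩⟩ ↦ ?_⟩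
    fun ι ↦ ⟨fun Y ⟨p⟩ Z φ hZ ↦ p.isLimit.hom_ext fun j ↦ ?_⟩
  · obtain ⟨u, hu⟩ := (HomotopyCategory.quotient C (ComplexShape.up ℤ)).map_surjective (e.inv ≫ φ)
    have h : e.inv ≫ φ = 0 :=
      hu.symm.trans ((HomotopyCategory.quotient_map_eq_zero_iff u).2 (homotopy_zero_of_projective hS J u))
    exact (cancel_epi e.inv).1 (h.trans comp_zero.symm)
  · rw [zero_comp]
    exact p.prop_diag_obj j _ hZ

/-- Such a complex is orthogonal to itself, so its identity vanishes. -/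
lemma contractible_of_coacyclic {J : CochainComplex C ℤ} (hJ : ∀ k, Injective (J.X k))
    (h : coacyclic C ((HomotopyCategory.quotient C (ComplexShape.up ℤ)).obj J)) :
    contractible ((HomotopyCategory.quotient C (ComplexShape.up ℤ)).obj J) :=
  (IsZero.iff_id_eq_zero _).2 (coacyclic_le_leftOrthogonal _ h _ ⟨J, hJ, ⟨Iso.refl _⟩⟩)

lemma contractible_of_contraacyclic {J : CochainComplex C ℤ} (hJ : ∀ k, Projective (J.X k))
    (h : contraacyclic C ((HomotopyCategory.quotient C (ComplexShape.up ℤ)).obj J)) :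
    contractible ((HomotopyCategory.quotient C (ComplexShape.up ℤ)).obj J) :=
  (IsZero.iff_id_eq_zero _).2 (contraacyclic_le_rightOrthogonal _ h _ ⟨J, hJ, ⟨Iso.refl _⟩⟩)

end Totals

/-! ### Telescopes -/

section Telescope

open DirectSum

variable {R : Type u} [Ring R] {M : ℕ → Type u} [∀ n, AddCommGroup (M n)] [∀ n, Module R (M n)]

/-- The map `x ↦ x - j x` on the direct sum of a sequence of modules with transition maps `j`. -/
noncomputable def telescope (j : ∀ n, M n →ₗ[R] M (n + 1)) : (⨁ n, M n) →ₗ[R] (⨁ n, M n) :=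
  toModule R ℕ _ fun n ↦ lof R ℕ M n - lof R ℕ M (n + 1) ∘ₗ j n

lemma telescope_lof (j : ∀ n, M n →ₗ[R] M (n + 1)) (n : ℕ) (x : M n) :
    telescope j (lof R ℕ M n x) = lof R ℕ M n x - lof R ℕ M (n + 1) (j n x) := by
  simp [telescope]

lemma telescope_apply_zero (j : ∀ n, M n →ₗ[R] M (n + 1)) (y : ⨁ n, M n) :
    telescope j y 0 = y 0 := by
  have : component R ℕ M 0 ∘ₗ telescope j = component R ℕ M 0 := by
    refine DirectSum.linearMap_ext _ fun m ↦ LinearMap.ext fun x ↦ ?_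
    simp only [LinearMap.comp_apply, telescope_lof, map_sub]
    rw [component.of R 0 (m + 1), dif_neg (by lia), sub_zero]
  exact LinearMap.congr_fun this y

lemma telescope_apply_succ (j : ∀ n, M n →ₗ[R] M (n + 1)) (y : ⨁ n, M n) (n : ℕ) :
    telescope j y (n + 1) = y (n + 1) - j n (y n) := by
  have : component R ℕ M (n + 1) ∘ₗ telescope j =
      component R ℕ M (n + 1) - j n ∘ₗ component R ℕ M n := by
    refine DirectSum.linearMap_ext _ fun m ↦ LinearMap.ext fun x ↦ ?_
    simp only [LinearMap.comp_apply, telescope_lof, map_sub, LinearMap.sub_apply]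
    congr 1
    by_cases h : m = n
    · subst h
      rw [component.lof_self, component.lof_self]
    · rw [component.of R (n + 1) (m + 1), dif_neg (by lia), component.of R n m, dif_neg h, map_zero]
  exact LinearMap.congr_fun this y

/-- The components of an element of the kernel vanish one after another, since each is the image of
the previous one. -/
lemma telescope_injective (j : ∀ n, M n →ₗ[R] M (n + 1)) :
    Function.Injective (telescope j) := by
  rw [injective_iff_map_eq_zero]
  intro y hy
  have (n : ℕ) : y n = 0 := by
    induction n with
    | zero => rw [← telescope_apply_zero j y, hy]; rfl
    | succ n ih =>
      have := telescope_apply_succ j y n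
      rw [hy, ih, map_zero, sub_zero] at this
      exact this.symm
  exact DFinsupp.ext this

/-- Modulo the image of the telescope, an element can be pushed along the transition maps to any
later summand. -/
lemma exists_telescope_add_lof_of_le (j : ∀ n, M n →ₗ[R] M (n + 1)) (n : ℕ) (x : M n) (m : ℕ)
    (h : n ≤ m) : ∃ w x', lof R ℕ M n x = telescope j w + lof R ℕ M m x' := by
  induction m, h using Nat.le_induction with
  | base => exact ⟨0, x, by simp⟩
  | succ m h ih =>
    obtain ⟨w, x', hw⟩ := ih
    exact ⟨w + lof R ℕ M m x', j m x', by rw [hw, map_add, telescope_lof]; abel⟩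

lemma exists_telescope_add_lof (j : ∀ n, M n →ₗ[R] M (n + 1)) (y : ⨁ n, M n) :
    ∃ w n x, y = telescope j w + lof R ℕ M n x := by
  induction y using DirectSum.induction_on with
  | zero => exact ⟨0, 0, 0, by simp⟩
  | of i x => exact ⟨0, i, x, by simp [lof_eq_of]⟩
  | add y y' h h' =>
    obtain ⟨w, n, x, rfl⟩ := h
    obtain ⟨w', n', x', rfl⟩ := h'
    obtain ⟨v, z, hz⟩ := exists_telescope_add_lof_of_le j n x (max n n') (by lia)
    obtain ⟨v', z', hz'⟩ := exists_telescope_add_lof_of_le j n' x' (max n n') (by lia)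
    exact ⟨w + v + (w' + v'), max n n', z + z', by rw [hz, hz']; simp only [map_add]; abel⟩

/-- Modulo the image of the telescope, every element sits in a single summand, where the map to `N`
is injective. -/
lemma telescope_exact {N : Type u} [AddCommGroup N] [Module R N] (j : ∀ n, M n →ₗ[R] M (n + 1))
    (k : ∀ n, M n →ₗ[R] N) (hjk : ∀ n, k (n + 1) ∘ₗ j n = k n)
    (hk : ∀ n, Function.Injective (k n)) :
    Function.Exact (telescope j) (toModule R ℕ N k) := by
  have h0 (w) : toModule R ℕ N k (telescope j w) = 0 := by
    have : toModule R ℕ N k ∘ₗ telescope j = 0 := by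
      refine DirectSum.linearMap_ext _ fun m ↦ LinearMap.ext fun x ↦ ?_
      simp [telescope_lof, ← hjk m]
    exact LinearMap.congr_fun this w
  intro y
  refine ⟨fun hy ↦ ?_, ?_⟩
  · obtain ⟨w, n, x, rfl⟩ := exists_telescope_add_lof j y
    rw [map_add, h0, zero_add, toModule_lof, ← map_zero (k n)] at hy
    exact ⟨w, by rw [hk n hy, map_zero, add_zero]⟩
  · rintro ⟨w, rfl⟩
    exact h0 w

lemma lmap_comp_telescope {M' : ℕ → Type u} [∀ n, AddCommGroup (M' n)] [∀ n, Module R (M' n)]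
    (j : ∀ n, M n →ₗ[R] M (n + 1)) (j' : ∀ n, M' n →ₗ[R] M' (n + 1)) (d : ∀ n, M n →ₗ[R] M' n)
    (h : ∀ n x, d (n + 1) (j n x) = j' n (d n x)) :
    DirectSum.lmap d ∘ₗ telescope j = telescope j' ∘ₗ DirectSum.lmap d := by
  refine DirectSum.linearMap_ext _ fun m ↦ LinearMap.ext fun x ↦ ?_
  simp only [LinearMap.comp_apply, telescope_lof, map_sub, DirectSum.lmap_lof, h]

lemma comp_toModule {M' : ℕ → Type u} [∀ n, AddCommGroup (M' n)] [∀ n, Module R (M' n)]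
    {N N' : Type u} [AddCommGroup N] [Module R N] [AddCommGroup N'] [Module R N']
    (k : ∀ n, M n →ₗ[R] N) (k' : ∀ n, M' n →ₗ[R] N') (d : ∀ n, M n →ₗ[R] M' n) (e : N →ₗ[R] N')
    (h : ∀ n x, e (k n x) = k' n (d n x)) :
    e ∘ₗ toModule R ℕ N k = toModule R ℕ N' k' ∘ₗ DirectSum.lmap d := by
  refine DirectSum.linearMap_ext _ fun m ↦ LinearMap.ext fun x ↦ ?_
  simp only [LinearMap.comp_apply, toModule_lof, DirectSum.lmap_lof, h]

/-- The map `y ↦ y - q y` on the product of a sequence of modules with transition maps `q`. -/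
def cotelescope (q : ∀ n, M (n + 1) →ₗ[R] M n) : (∀ n, M n) →ₗ[R] (∀ n, M n) :=
  LinearMap.pi fun n ↦ LinearMap.proj n - q n ∘ₗ LinearMap.proj (n + 1)

@[simp]
lemma cotelescope_apply (q : ∀ n, M (n + 1) →ₗ[R] M n) (y : ∀ n, M n) (n : ℕ) :
    cotelescope q y n = y n - q n (y (n + 1)) := rfl

lemma cotelescope_surjective (q : ∀ n, M (n + 1) →ₗ[R] M n)
    (hq : ∀ n, Function.Surjective (q n)) : Function.Surjective (cotelescope q) := by
  intro z
  choose s hs using hq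
  -- The recursion solves `q n (y (n + 1)) = y n - z n`; the initial value `0` is arbitrary.
  let y : ∀ n, M n := fun n ↦ Nat.rec 0 (fun n x ↦ s n (x - z n)) n
  exact ⟨y, funext fun n ↦ by simp [y, hs]⟩

end Telescope

/-! ### Sequential unions and limits of complexes of modules -/

section Sequential

open CochainComplex CochainComplex.mappingCone DirectSum

variable {R : Type u} [Ring R]

lemma d_d_apply (K : CochainComplex (ModuleCat.{u} R) ℤ) {a b c : ℤ} (x : K.X a) :
    (K.d b c).hom ((K.d a b).hom x) = 0 :=
  LinearMap.congr_fun (congrArg ModuleCat.Hom.hom (K.d_comp_d a b c)) x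

lemma d_f_apply {K L : CochainComplex (ModuleCat.{u} R) ℤ} (φ : K ⟶ L) {a b : ℤ} (x : K.X a) :
    (L.d a b).hom ((φ.f a).hom x) = (φ.f b).hom ((K.d a b).hom x) :=
  LinearMap.congr_fun (congrArg ModuleCat.Hom.hom (φ.comm a b)) x

lemma f_f_apply_of_comp_eq {K L M : CochainComplex (ModuleCat.{u} R) ℤ} {φ : K ⟶ L} {ψ : L ⟶ M}
    {χ : K ⟶ M} (h : φ ≫ ψ = χ) {a : ℤ} (x : K.X a) :
    (ψ.f a).hom ((φ.f a).hom x) = (χ.f a).hom x := by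
  subst h
  rfl

/-- The direct sum of a sequence of complexes of modules. -/
noncomputable def directSumComplex (X : ℕ → CochainComplex (ModuleCat.{u} R) ℤ) :
    CochainComplex (ModuleCat.{u} R) ℤ where
  X k := ModuleCat.of R (⨁ n, (X n).X k)
  d k l := ModuleCat.ofHom (DirectSum.lmap fun n ↦ ((X n).d k l).hom)
  shape k l h := by
    ext1
    refine DirectSum.linearMap_ext _ fun m ↦ LinearMap.ext fun x ↦ ?_
    simp [(X m).shape k l h]
  d_comp_d' k l m _ _ := by
    ext1
    refine DirectSum.linearMap_ext _ fun m ↦ LinearMap.ext fun x ↦ ?_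
    simp only [ModuleCat.hom_comp, ModuleCat.hom_ofHom, LinearMap.comp_apply, DirectSum.lmap_lof,
      d_d_apply, map_zero, ModuleCat.hom_zero, LinearMap.zero_apply]

/-- The inclusion of a summand in the direct sum of a sequence of complexes. -/
noncomputable def directSumComplexι (X : ℕ → CochainComplex (ModuleCat.{u} R) ℤ) (n : ℕ) :
    X n ⟶ directSumComplex X where
  f k := ModuleCat.ofHom (lof R ℕ (fun n ↦ (X n).X k) n)
  comm' k l _ := by
    ext x
    exact DirectSum.lmap_lof _ _ _

/-- The telescope map of a sequence of complexes. -/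
noncomputable def telescopeHom {X : ℕ → CochainComplex (ModuleCat.{u} R) ℤ}
    (j : ∀ n, X n ⟶ X (n + 1)) : directSumComplex X ⟶ directSumComplex X where
  f d := ModuleCat.ofHom (telescope fun n ↦ ((j n).f d).hom)
  comm' _ _ _ := congrArg ModuleCat.ofHom
    (lmap_comp_telescope _ _ _ fun n x ↦ d_f_apply (j n) x)

/-- The map from the direct sum of a sequence of complexes defined by maps from its summands. -/
noncomputable def directSumComplexDesc {X : ℕ → CochainComplex (ModuleCat.{u} R) ℤ}
    {K : CochainComplex (ModuleCat.{u} R) ℤ} (k : ∀ n, X n ⟶ K) : directSumComplex X ⟶ K where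
  f d := ModuleCat.ofHom (toModule R ℕ _ fun n ↦ ((k n).f d).hom)
  comm' _ _ _ := ModuleCat.hom_ext (comp_toModule _ _ _ _ fun n x ↦ d_f_apply (k n) x)

/-- The product of a sequence of complexes of modules. -/
def piComplex (X : ℕ → CochainComplex (ModuleCat.{u} R) ℤ) :
    CochainComplex (ModuleCat.{u} R) ℤ where
  X k := ModuleCat.of R (∀ n, (X n).X k)
  d k l := ModuleCat.ofHom (LinearMap.pi fun n ↦ ((X n).d k l).hom ∘ₗ LinearMap.proj n)
  shape k l h := by
    ext x n
    exact LinearMap.congr_fun (congrArg ModuleCat.Hom.hom ((X n).shape k l h)) (x n)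
  d_comp_d' k l m _ _ := by
    ext x n
    exact d_d_apply (X n) (x n)

/-- The projection from the product of a sequence of complexes. -/
def piComplexπ (X : ℕ → CochainComplex (ModuleCat.{u} R) ℤ) (n : ℕ) :
    piComplex X ⟶ X n where
  f _ := ModuleCat.ofHom (LinearMap.proj n)
  comm' _ _ _ := rfl

/-- The cotelescope map of a sequence of complexes. -/
def cotelescopeHom {X : ℕ → CochainComplex (ModuleCat.{u} R) ℤ}
    (q : ∀ n, X (n + 1) ⟶ X n) : piComplex X ⟶ piComplex X where
  f d := ModuleCat.ofHom (cotelescope fun n ↦ ((q n).f d).hom)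
  comm' d e _ := ModuleCat.hom_ext <| LinearMap.ext fun x ↦ funext fun n ↦
    (map_sub ((X n).d d e).hom _ _).trans
      (congrArg (((X n).d d e).hom (x n) - ·) (d_f_apply (q n) (x (n + 1))))

/-- The map to the product of a sequence of complexes defined by maps to its factors. -/
def piComplexLift {X : ℕ → CochainComplex (ModuleCat.{u} R) ℤ}
    {K : CochainComplex (ModuleCat.{u} R) ℤ} (k : ∀ n, K ⟶ X n) : K ⟶ piComplex X where
  f d := ModuleCat.ofHom (LinearMap.pi fun n ↦ ((k n).f d).hom)
  comm' _ _ _ := ModuleCat.hom_ext <| LinearMap.ext fun x ↦ funext fun n ↦ d_f_apply (k n) x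

/-- A property of complexes of modules that is stable under degreewise countable coproducts. -/
def StableUnderCoproducts (P : ObjectProperty (Hot (ModuleCat.{u} R))) : Prop :=
  ∀ (X : ℕ → CochainComplex (ModuleCat.{u} R) ℤ) (Y : CochainComplex (ModuleCat.{u} R) ℤ)
    (i : ∀ n, X n ⟶ Y),
    (∀ k, Nonempty (IsColimit (Cofan.mk (Y.X k) fun n ↦ (i n).f k))) →
    (∀ n, P ((HomotopyCategory.quotient _ _).obj (X n))) →
    P ((HomotopyCategory.quotient _ _).obj Y)

/-- A property of complexes of modules that is stable under degreewise countable products. -/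
def StableUnderProducts (P : ObjectProperty (Hot (ModuleCat.{u} R))) : Prop :=
  ∀ (X : ℕ → CochainComplex (ModuleCat.{u} R) ℤ) (Y : CochainComplex (ModuleCat.{u} R) ℤ)
    (i : ∀ n, Y ⟶ X n),
    (∀ k, Nonempty (IsLimit (Fan.mk (Y.X k) fun n ↦ (i n).f k))) →
    (∀ n, P ((HomotopyCategory.quotient _ _).obj (X n))) →
    P ((HomotopyCategory.quotient _ _).obj Y)

lemma shortExact_of_degreewise {S : ShortComplex (CochainComplex (ModuleCat.{u} R) ℤ)}
    (h₁ : ∀ k, Function.Injective (S.f.f k).hom)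
    (h₂ : ∀ k, Function.Exact (S.f.f k).hom (S.g.f k).hom)
    (h₃ : ∀ k, Function.Surjective (S.g.f k).hom) : S.ShortExact :=
  HomologicalComplex.shortExact_of_degreewise_shortExact _ fun k ↦
    { exact := (ShortComplex.ShortExact.moduleCat_exact_iff_function_exact _).2 (h₂ k)
      mono_f := (ModuleCat.mono_iff_injective _).2 (h₁ k)
      epi_g := (ModuleCat.epi_iff_surjective _).2 (h₃ k) }

variable {P : ObjectProperty (Hot (ModuleCat.{u} R))} (hP : ContainsTotals P)
  {K : CochainComplex (ModuleCat.{u} R) ℤ} {X : ℕ → CochainComplex (ModuleCat.{u} R) ℤ}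

include hP

/-- The telescope is a short exact sequence of complexes whose first two terms are the direct sum of
the `X n`, so its third term `K` lies in `P`. -/
lemma prop_of_sequential_union (hPc : StableUnderCoproducts P)
    (j : ∀ n, X n ⟶ X (n + 1)) (k : ∀ n, X n ⟶ K)
    (hjk : ∀ n, j n ≫ k (n + 1) = k n) (hk : ∀ n d, Function.Injective ((k n).f d).hom)
    (hk' : ∀ d x, ∃ n y, ((k n).f d).hom y = x)
    (hX : ∀ n, P ((HomotopyCategory.quotient _ _).obj (X n))) :
    P ((HomotopyCategory.quotient _ _).obj K) := by
  let S : ShortComplex (CochainComplex (ModuleCat.{u} R) ℤ) :=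
    { X₁ := directSumComplex X
      X₂ := directSumComplex X
      X₃ := K
      f := telescopeHom j
      g := directSumComplexDesc k
      zero := by
        ext1 d
        exact ModuleCat.hom_ext (telescope_exact _ _
          (fun n ↦ LinearMap.ext fun x ↦ f_f_apply_of_comp_eq (hjk n) x)
            fun n ↦ hk n d).linearMap_comp_eq_zero }
  have hS : S.ShortExact := by
    refine shortExact_of_degreewise (fun d ↦ telescope_injective _) (fun d ↦ ?_) fun d x ↦ ?_
    · refine telescope_exact _ _ 
        (fun n ↦ LinearMap.ext fun x ↦ f_f_apply_of_comp_eq (hjk n) x) fun n ↦ hk n d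
    · obtain ⟨n, y, rfl⟩ := hk' d x
      exact ⟨lof R ℕ (fun n ↦ (X n).X d) n y, toModule_lof _ _ _⟩
  have h := hPc X (directSumComplex X) (directSumComplexι X)
    (fun d ↦ ⟨ModuleCat.coproductCoconeIsColimit fun n ↦ (X n).X d⟩) hX
  exact hP.prop_X₃ hS h h

/-- Surjective transition maps make the cotelescope surjective. Its kernel is the inverse limit `K`,
and its other two terms are products of the `X n`. -/
lemma prop_of_sequential_limit (hPp : StableUnderProducts P)
    (q : ∀ n, X (n + 1) ⟶ X n) (k : ∀ n, K ⟶ X n)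
    (hqk : ∀ n, k (n + 1) ≫ q n = k n) (hq : ∀ n d, Function.Surjective ((q n).f d).hom)
    (hk : ∀ d x, (∀ n, ((k n).f d).hom x = 0) → x = 0)
    (hk' : ∀ d (y : ∀ n, (X n).X d), (∀ n, ((q n).f d).hom (y (n + 1)) = y n) →
      ∃ x, ∀ n, ((k n).f d).hom x = y n)
    (hX : ∀ n, P ((HomotopyCategory.quotient _ _).obj (X n))) :
    P ((HomotopyCategory.quotient _ _).obj K) := by
  let S : ShortComplex (CochainComplex (ModuleCat.{u} R) ℤ) :=
    { X₁ := K
      X₂ := piComplex X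
      X₃ := piComplex X
      f := piComplexLift k
      g := cotelescopeHom q
      zero := by
        ext1 d
        exact ModuleCat.hom_ext <| LinearMap.ext fun x ↦ funext fun n ↦
          sub_eq_zero.2 (f_f_apply_of_comp_eq (hqk n) x).symm }
  have hS : S.ShortExact := by
    refine shortExact_of_degreewise (fun d ↦ ?_) (fun d y ↦ ⟨fun hy ↦ ?_, ?_⟩)
      fun d ↦ cotelescope_surjective _ fun n ↦ hq n d
    · rw [injective_iff_map_eq_zero]
      exact fun x hx ↦ hk d x fun n ↦ congrFun hx n
    · obtain ⟨x, hx⟩ := hk' d y fun n ↦ (sub_eq_zero.1 (congrFun hy n)).symm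
      exact ⟨x, funext hx⟩
    · rintro ⟨x, rfl⟩
      have := congr($(S.zero).f d)
      exact LinearMap.congr_fun (congrArg ModuleCat.Hom.hom this) x
  have h := hPp X (piComplex X) (piComplexπ X)
    (fun d ↦ ⟨ModuleCat.productConeIsLimit fun n ↦ (X n).X d⟩) hX
  exact hP.prop_X₁ hS h h

end Sequential

/-! ### Elements of mapping cones of complexes of modules -/

section ConeElements

open CochainComplex CochainComplex.mappingCone CochainComplex.HomComplex

variable {R : Type u} [Ring R] {K L : CochainComplex (ModuleCat.{u} R) ℤ} (φ : K ⟶ L)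

/-- The element of a mapping cone with given components. -/
noncomputable def coneMk (d : ℤ) (u : K.X (d + 1)) (v : L.X d) : (mappingCone φ).X d :=
  ((inl φ).v (d + 1) d (by lia)).hom u + ((inr φ).f d).hom v

/-- The first component of an element of a mapping cone. -/
noncomputable def coneFst {d : ℤ} (x : (mappingCone φ).X d) : K.X (d + 1) :=
  ((fst φ).1.v d (d + 1) rfl).hom x

/-- The second component of an element of a mapping cone. -/
noncomputable def coneSnd {d : ℤ} (x : (mappingCone φ).X d) : L.X d :=
  ((snd φ).v d d (add_zero d)).hom x

lemma hom_apply_of_comp_eq {A B C : ModuleCat.{u} R} {a : A ⟶ B} {b : B ⟶ C} {c : A ⟶ C}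
    (h : a ≫ b = c) (x : A) : b.hom (a.hom x) = c.hom x := by
  subst h
  rfl

@[simp]
lemma coneFst_coneMk (d : ℤ) (u : K.X (d + 1)) (v : L.X d) : coneFst φ (coneMk φ d u v) = u := by
  simp only [coneFst, coneMk, map_add, hom_apply_of_comp_eq (inl_v_fst_v φ _ _ _),
    hom_apply_of_comp_eq (inr_f_fst_v φ _ _ _)]
  simp

@[simp]
lemma coneSnd_coneMk (d : ℤ) (u : K.X (d + 1)) (v : L.X d) : coneSnd φ (coneMk φ d u v) = v := by
  simp only [coneSnd, coneMk, map_add, hom_apply_of_comp_eq (inl_v_snd_v φ _ _ _),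
    hom_apply_of_comp_eq (inr_f_snd_v φ _)]
  simp

lemma coneMk_coneFst_coneSnd {d : ℤ} (x : (mappingCone φ).X d) :
    coneMk φ d (coneFst φ x) (coneSnd φ x) = x := by
  have := LinearMap.congr_fun (congrArg ModuleCat.Hom.hom
    (id_X φ d (d + 1) rfl)) x
  exact this

lemma cone_ext {d : ℤ} {x y : (mappingCone φ).X d} (h : coneFst φ x = coneFst φ y)
    (h' : coneSnd φ x = coneSnd φ y) : x = y := by
  rw [← coneMk_coneFst_coneSnd φ x, ← coneMk_coneFst_coneSnd φ y, h, h']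

lemma d_coneMk (d : ℤ) (u : K.X (d + 1)) (v : L.X d) :
    ((mappingCone φ).d d (d + 1)).hom (coneMk φ d u v) =
      coneMk φ (d + 1) (-(K.d _ _).hom u) ((φ.f (d + 1)).hom u + (L.d _ _).hom v) := by
  simp only [coneMk, map_add, hom_apply_of_comp_eq (inl_v_d φ (d + 1) d (d + 1 + 1) (by lia) (by lia)),
    d_f_apply, map_neg]
  simp
  abel

variable {φ} {K' L' : CochainComplex (ModuleCat.{u} R) ℤ} {φ' : K' ⟶ L'} (a : K ⟶ K')
  (b : L ⟶ L') (comm : φ ≫ b = a ≫ φ')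

lemma coneMap_coneMk (d : ℤ) (u : K.X (d + 1)) (v : L.X d) :
    ((mappingCone.map φ φ' a b comm).f d).hom (coneMk φ d u v) =
      coneMk φ' d ((a.f _).hom u) ((b.f _).hom v) := by
  have h1 : (inl φ).v (d + 1) d (by lia) ≫ (mappingCone.map φ φ' a b comm).f d =
      a.f (d + 1) ≫ (inl φ').v (d + 1) d (by lia) := by
    simp [mappingCone.map]
  have h2 : (inr φ).f d ≫ (mappingCone.map φ φ' a b comm).f d =
      b.f d ≫ (inr φ').f d := by
    simp [mappingCone.map]
  simp only [coneMk, map_add, hom_apply_of_comp_eq h1, hom_apply_of_comp_eq h2]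
  rfl

lemma coneFst_coneMap {d : ℤ} (x : (mappingCone φ).X d) :
    coneFst φ' (((mappingCone.map φ φ' a b comm).f d).hom x) = (a.f _).hom (coneFst φ x) := by
  rw [← coneMk_coneFst_coneSnd φ x, coneMap_coneMk, coneFst_coneMk, coneFst_coneMk]

lemma coneSnd_coneMap {d : ℤ} (x : (mappingCone φ).X d) :
    coneSnd φ' (((mappingCone.map φ φ' a b comm).f d).hom x) = (b.f _).hom (coneSnd φ x) := by
  rw [← coneMk_coneFst_coneSnd φ x, coneMap_coneMk, coneSnd_coneMk, coneSnd_coneMk]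

end ConeElements

/-! ### Sequential unions and limits of weak equivalences -/

section SequentialTrW

open CochainComplex CochainComplex.mappingCone

variable {R : Type u} [Ring R] {P : ObjectProperty (Hot (ModuleCat.{u} R))}
  (hP : ContainsTotals P)
  {K : CochainComplex (ModuleCat.{u} R) ℤ} {X : ℕ → CochainComplex (ModuleCat.{u} R) ℤ}

include hP

/-- The cone of `k 0` is the increasing union of the cones of the composites `X 0 ⟶ X n`, and each
of these lies in `P`. -/
lemma trW_of_sequential_union (hPc : StableUnderCoproducts P)
    (j : ∀ n, X n ⟶ X (n + 1)) (k : ∀ n, X n ⟶ K)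
    (hjk : ∀ n, j n ≫ k (n + 1) = k n) (hk : ∀ n d, Function.Injective ((k n).f d).hom)
    (hk' : ∀ d x, ∃ n y, ((k n).f d).hom y = x)
    (hj : ∀ n, P.trW ((HomotopyCategory.quotient _ _).map (j n))) :
    P.trW ((HomotopyCategory.quotient _ _).map (k 0)) := by
  have := hP.isTriangulated
  have := hP.isClosedUnderIsomorphisms
  let a (n : ℕ) : X 0 ⟶ X n := Nat.rec (motive := fun n ↦ X 0 ⟶ X n) (𝟙 _) (fun n f ↦ f ≫ j n) n
  have ha (n : ℕ) : a n ≫ k n = k 0 := by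
    induction n with
    | zero => exact Category.id_comp _
    | succ n ih => exact (Category.assoc _ _ _).trans (by rw [hjk, ih])
  let C (n : ℕ) : CochainComplex (ModuleCat.{u} R) ℤ := mappingCone (a n)
  rw [trW_quotient_map_iff]
  refine prop_of_sequential_union hP hPc (X := C)
    (fun n ↦ mappingCone.map _ _ (𝟙 _) (j n) (Category.id_comp _).symm)
    (fun n ↦ mappingCone.map _ _ (𝟙 _) (k n) ((ha n).trans (Category.id_comp _).symm))
    (fun n ↦ ?_) (fun n d x y hxy ↦ ?_) (fun d x ↦ ?_) fun n ↦ ?_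
  · refine (mappingCone.map_comp _ _ _ _ _ _ _ _ _).symm.trans ?_
    congr 1
    exact hjk n
  · refine cone_ext _ ?_ (hk n d ?_)
    · exact (coneFst_coneMap _ _ _ x).symm.trans
        ((congrArg (coneFst _) hxy).trans (coneFst_coneMap _ _ _ y))
    · exact (coneSnd_coneMap _ _ _ x).symm.trans
        ((congrArg (coneSnd _) hxy).trans (coneSnd_coneMap _ _ _ y))
  · obtain ⟨n, y, hy⟩ := hk' d (coneSnd _ x)
    refine ⟨n, coneMk _ d (coneFst _ x) y, ?_⟩
    rw [coneMap_coneMk, hy]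
    exact coneMk_coneFst_coneSnd _ x
  · refine (trW_quotient_map_iff P (a n)).1 ?_
    induction n with
    | zero => exact P.trW_of_isIso ((HomotopyCategory.quotient _ _).map (𝟙 _))
    | succ n ih =>
      have := P.trW.comp_mem _ _ ih (hj n)
      rwa [← Functor.map_comp] at this

/-- The cone of `k 0` is the inverse limit of the cones of the composites `X n ⟶ X 0`, along
surjective transition maps. -/
lemma trW_of_sequential_limit (hPp : StableUnderProducts P)
    (q : ∀ n, X (n + 1) ⟶ X n) (k : ∀ n, K ⟶ X n)
    (hqk : ∀ n, k (n + 1) ≫ q n = k n) (hq : ∀ n d, Function.Surjective ((q n).f d).hom)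
    (hk : ∀ d x, (∀ n, ((k n).f d).hom x = 0) → x = 0)
    (hk' : ∀ d (y : ∀ n, (X n).X d), (∀ n, ((q n).f d).hom (y (n + 1)) = y n) →
      ∃ x, ∀ n, ((k n).f d).hom x = y n)
    (hq' : ∀ n, P.trW ((HomotopyCategory.quotient _ _).map (q n))) :
    P.trW ((HomotopyCategory.quotient _ _).map (k 0)) := by
  have := hP.isTriangulated
  have := hP.isClosedUnderIsomorphisms
  let a (n : ℕ) : X n ⟶ X 0 := Nat.rec (motive := fun n ↦ X n ⟶ X 0) (𝟙 _) (fun n f ↦ q n ≫ f) n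
  have ha (n : ℕ) : k n ≫ a n = k 0 := by
    induction n with
    | zero => exact Category.comp_id _
    | succ n ih => exact (Category.assoc _ _ _).symm.trans (by rw [hqk, ih])
  let C (n : ℕ) : CochainComplex (ModuleCat.{u} R) ℤ := mappingCone (a n)
  rw [trW_quotient_map_iff]
  refine prop_of_sequential_limit hP hPp (X := C)
    (fun n ↦ mappingCone.map _ _ (q n) (𝟙 _) (Category.comp_id _))
    (fun n ↦ mappingCone.map _ _ (k n) (𝟙 _) ((Category.comp_id _).trans (ha n).symm))
    (fun n ↦ ?_) (fun n d x ↦ ?_) (fun d x hx ↦ ?_) (fun d y hy ↦ ?_) fun n ↦ ?_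
  · refine (mappingCone.map_comp _ _ _ _ _ _ _ _ _).symm.trans ?_
    congr 1
    exact hqk n
  · obtain ⟨y, hy⟩ := hq n _ (coneFst _ x)
    refine ⟨coneMk _ d y (coneSnd _ x), ?_⟩
    rw [coneMap_coneMk, hy]
    exact coneMk_coneFst_coneSnd _ x
  · refine cone_ext _ ((hk _ _ fun n ↦ ?_).trans (map_zero _).symm) (Eq.trans ?_ (map_zero _).symm)
    · have := congrArg (coneFst _) (hx n)
      rw [coneFst_coneMap] at this
      exact this.trans (map_zero _)
    · have := congrArg (coneSnd _) (hx 0)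
      rw [coneSnd_coneMap] at this
      exact this.trans (map_zero _)
  · obtain ⟨x, hx⟩ := hk' _ (fun n ↦ coneFst _ (y n)) fun n ↦
      (coneFst_coneMap _ _ _ _).symm.trans (congrArg (coneFst _) (hy n))
    refine ⟨coneMk _ d x (coneSnd _ (y 0)), fun n ↦ ?_⟩
    rw [coneMap_coneMk, hx]
    -- All these cones share the second term `X 0`, so compatible families are constant in that
    -- component.
    have (n : ℕ) : coneSnd _ (y n) = coneSnd _ (y 0) := by
      induction n with
      | zero => rfl
      | succ n ih =>
        exact (coneSnd_coneMap _ _ _ _).symm.trans ((congrArg (coneSnd _) (hy n)).trans ih)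
    conv_rhs => rw [← coneMk_coneFst_coneSnd _ (y n), this n]
    rfl
  · refine (trW_quotient_map_iff P (a n)).1 ?_
    induction n with
    | zero => exact P.trW_of_isIso ((HomotopyCategory.quotient _ _).map (𝟙 _))
    | succ n ih =>
      have := P.trW.comp_mem _ _ (hq' n) ih
      rwa [← Functor.map_comp] at this

end SequentialTrW

/-! ### Relatively coacyclic and contraacyclic complexes -/

section Relative

variable {A R : Type u} [Ring A] [Ring R] (f : A →+* R)

lemma restrictScalars_map_exact (S : ShortComplex (ModuleCat.{u} R)) (h : S.Exact) :
    (S.map (ModuleCat.restrictScalars f)).Exact := by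
  rw [ShortComplex.ShortExact.moduleCat_exact_iff_function_exact] at h ⊢
  exact h

instance : PreservesFiniteLimits (ModuleCat.restrictScalars.{u} f) := by
  have := ((Functor.exact_tfae (ModuleCat.restrictScalars.{u} f)).out 1 3).mp
    (restrictScalars_map_exact f)
  exact this.1

instance : PreservesFiniteColimits (ModuleCat.restrictScalars.{u} f) := by
  have := ((Functor.exact_tfae (ModuleCat.restrictScalars.{u} f)).out 1 3).mp
    (restrictScalars_map_exact f)
  exact this.2

lemma containsTotals_semicoacyclic : ContainsTotals (semicoacyclic f) :=
  containsTotals_coacyclic.inverseImage _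

lemma containsTotals_semicontraacyclic : ContainsTotals (semicontraacyclic f) :=
  containsTotals_contraacyclic.inverseImage _

/-- Restriction of scalars preserves coproducts in each degree, and degreewise coproducts remain
coproducts up to homotopy. -/
lemma stableUnderCoproducts_semicoacyclic : StableUnderCoproducts (semicoacyclic f) := by
  intro X Y i hi hX
  let F := (ModuleCat.restrictScalars f).mapHomologicalComplex (ComplexShape.up ℤ)
  obtain ⟨h⟩ := isColimit_quotient_cofan (fun n ↦ F.map (i n)) fun k ↦
    ⟨isColimitCofanMkObjOfIsColimit (ModuleCat.restrictScalars f) _ _ (hi k).some⟩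
  exact (coacyclic _).prop_of_isColimit h fun j ↦ hX j.as

lemma stableUnderProducts_semicontraacyclic : StableUnderProducts (semicontraacyclic f) := by
  intro X Y i hi hX
  let F := (ModuleCat.restrictScalars f).mapHomologicalComplex (ComplexShape.up ℤ)
  obtain ⟨h⟩ := isLimit_quotient_fan (fun n ↦ F.map (i n)) fun k ↦
    ⟨isLimitFanMkObjOfIsLimit (ModuleCat.restrictScalars f) _ _ (hi k).some⟩
  exact (contraacyclic _).prop_of_isLimit h fun j ↦ hX j.as

end Relative

/-! ### Subcomplexes and quotient complexes -/

section Subcomplex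

variable {R : Type u} [Ring R] (T : CochainComplex (ModuleCat.{u} R) ℤ)

/-- A family of submodules of the terms of a complex that is preserved by the differential. -/
structure Subcomplex where
  /-- the submodules -/
  carrier (k : ℤ) : Submodule R (T.X k)
  d_mem' (k : ℤ) (x : T.X k) : x ∈ carrier k → (T.d k (k + 1)).hom x ∈ carrier (k + 1)

variable {T}

namespace Subcomplex

lemma d_mem (N : Subcomplex T) {k l : ℤ} {x : T.X k} (hx : x ∈ N.carrier k) :
    (T.d k l).hom x ∈ N.carrier l := by
  by_cases h : k + 1 = l
  · subst h
    exact N.d_mem' k x hx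
  · rw [T.shape k l h]
    exact zero_mem _

/-- A subcomplex as a complex. -/
def toComplex (N : Subcomplex T) : CochainComplex (ModuleCat.{u} R) ℤ where
  X k := ModuleCat.of R (N.carrier k)
  d k l := ModuleCat.ofHom ((T.d k l).hom.restrict fun _ ↦ N.d_mem)
  shape k l h := ModuleCat.hom_ext <| LinearMap.ext fun x ↦ Subtype.ext <|
    LinearMap.congr_fun (congrArg ModuleCat.Hom.hom (T.shape k l h)) x.1
  d_comp_d' _ _ _ _ _ := ModuleCat.hom_ext <| LinearMap.ext fun x ↦ Subtype.ext <|
    d_d_apply T x.1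

/-- The inclusion of a subcomplex. -/
def incl (N : Subcomplex T) : N.toComplex ⟶ T where
  f k := ModuleCat.ofHom (N.carrier k).subtype

/-- The inclusion of a subcomplex in a larger one. -/
def inclOfLE {N N' : Subcomplex T} (h : ∀ k, N.carrier k ≤ N'.carrier k) :
    N.toComplex ⟶ N'.toComplex where
  f k := ModuleCat.ofHom (Submodule.inclusion (h k))

/-- The quotient by a subcomplex. -/
def quotient (N : Subcomplex T) : CochainComplex (ModuleCat.{u} R) ℤ where
  X k := ModuleCat.of R (T.X k ⧸ N.carrier k)
  d k l := ModuleCat.ofHom (Submodule.mapQ _ _ (T.d k l).hom fun _ ↦ N.d_mem)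
  shape k l h := ModuleCat.hom_ext <| Submodule.linearMap_qext _ <| LinearMap.ext fun x ↦
    congrArg (Submodule.mkQ _) (LinearMap.congr_fun (congrArg ModuleCat.Hom.hom (T.shape k l h)) x)
  d_comp_d' _ _ _ _ _ := ModuleCat.hom_ext <| Submodule.linearMap_qext _ <| LinearMap.ext fun x ↦
    congrArg (Submodule.mkQ _) (d_d_apply T x)

/-- The projection to the quotient by a subcomplex. -/
def proj (N : Subcomplex T) : T ⟶ N.quotient where
  f k := ModuleCat.ofHom (N.carrier k).mkQ

/-- The projection between quotients by two subcomplexes. -/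
def projOfLE {N N' : Subcomplex T} (h : ∀ k, N.carrier k ≤ N'.carrier k) :
    N.quotient ⟶ N'.quotient where
  f k := ModuleCat.ofHom (Submodule.factor (h k))
  comm' _ _ _ := ModuleCat.hom_ext <| Submodule.linearMap_qext _ rfl

/-- The kernel of a morphism as a subcomplex. -/
def ker {K : CochainComplex (ModuleCat.{u} R) ℤ} (φ : T ⟶ K) : Subcomplex T where
  carrier k := LinearMap.ker (φ.f k).hom
  d_mem' k x hx := by
    rw [LinearMap.mem_ker, ← d_f_apply, LinearMap.mem_ker.1 hx, map_zero]

end Subcomplex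

variable {P : ObjectProperty (Hot (ModuleCat.{u} R))} (hP : ContainsTotals P)
  {N N' : Subcomplex T} (h : ∀ k, N.carrier k ≤ N'.carrier k)

include hP

/-- The quotient of `N'` by `N` enters through any surjection `φ` with kernel `N`, so that it can be
given explicitly as a cone. -/
lemma trW_inclOfLE {C : CochainComplex (ModuleCat.{u} R) ℤ}
    (hC : P ((HomotopyCategory.quotient _ _).obj C)) (φ : N'.toComplex ⟶ C)
    (hφ : ∀ k, Function.Surjective (φ.f k).hom)
    (hφ' : ∀ k (x : N'.carrier k), (φ.f k).hom x = 0 ↔ x.1 ∈ N.carrier k) :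
    P.trW ((HomotopyCategory.quotient _ _).map (Subcomplex.inclOfLE h)) := by
  let S : ShortComplex (CochainComplex (ModuleCat.{u} R) ℤ) :=
    { X₁ := N.toComplex
      X₂ := N'.toComplex
      X₃ := C
      f := Subcomplex.inclOfLE h
      g := φ
      zero := by
        ext1 k
        exact ModuleCat.hom_ext <| LinearMap.ext fun x ↦ (hφ' k _).2 x.2 }
  have hS : S.ShortExact := by
    refine shortExact_of_degreewise (fun k ↦ Submodule.inclusion_injective (h k))
      (fun k x ↦ ⟨fun hx ↦ ?_, ?_⟩) hφ
    · exact ⟨⟨x.1, (hφ' k x).1 hx⟩, rfl⟩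
    · rintro ⟨x, rfl⟩
      exact (hφ' k _).2 x.2
  exact hP.trW_f hS hC

/-- The kernel of the projection is `N'` modulo `N`, which agrees modulo `P` with the cone of the
inclusion. -/
lemma trW_projOfLE (h' : P.trW ((HomotopyCategory.quotient _ _).map (Subcomplex.inclOfLE h))) :
    P.trW ((HomotopyCategory.quotient _ _).map (Subcomplex.projOfLE h)) := by
  have := hP.isTriangulated
  have := hP.isClosedUnderIsomorphisms
  let K := Subcomplex.ker (Subcomplex.projOfLE h)
  have hNK (k : ℤ) (x : T.X k) : (N.carrier k).mkQ x ∈ K.carrier k ↔ x ∈ N'.carrier k :=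
    Submodule.Quotient.mk_eq_zero _
  let S : ShortComplex (CochainComplex (ModuleCat.{u} R) ℤ) :=
    { X₁ := N.toComplex
      X₂ := N'.toComplex
      X₃ := K.toComplex
      f := Subcomplex.inclOfLE h
      g :=
        { f k := ModuleCat.ofHom (((N.carrier k).mkQ ∘ₗ (N'.carrier k).subtype).codRestrict _
            fun x ↦ (hNK k x.1).2 x.2) }
      zero := by
        ext1 k
        exact ModuleCat.hom_ext <| LinearMap.ext fun x ↦ Subtype.ext <|
          (Submodule.Quotient.mk_eq_zero _).2 x.2 }
  have hS : S.ShortExact := by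
    refine shortExact_of_degreewise (fun k ↦ Submodule.inclusion_injective (h k))
      (fun k x ↦ ⟨fun hx ↦ ?_, ?_⟩) fun k ↦ ?_
    · exact ⟨⟨x.1, (Submodule.Quotient.mk_eq_zero _).1 (congrArg Subtype.val hx)⟩, rfl⟩
    · rintro ⟨x, rfl⟩
      exact Subtype.ext <| (Submodule.Quotient.mk_eq_zero _).2 x.2
    · rintro ⟨x, hx⟩
      obtain ⟨x, rfl⟩ := Submodule.mkQ_surjective _ x
      exact ⟨⟨x, (hNK k x).1 hx⟩, rfl⟩
  let S' : ShortComplex (CochainComplex (ModuleCat.{u} R) ℤ) :=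
    { X₁ := K.toComplex
      X₂ := N.quotient
      X₃ := N'.quotient
      f := K.incl
      g := Subcomplex.projOfLE h
      zero := by
        ext1 k
        exact ModuleCat.hom_ext <| LinearMap.ext fun x ↦ x.2 }
  have hS' : S'.ShortExact := by
    refine shortExact_of_degreewise (fun k ↦ Subtype.val_injective)
      (fun k x ↦ ⟨fun hx ↦ ⟨⟨x, hx⟩, rfl⟩, ?_⟩) fun k ↦ Submodule.factor_surjective (h k)
    rintro ⟨x, rfl⟩
    exact x.2
  refine hP.trW_g hS' ?_
  rw [trW_quotient_map_iff] at h'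
  obtain ⟨_, _, _, hT, hZ⟩ := hP.trW_descShortComplex hS
  exact P.ext_of_isTriangulatedClosed₂ _ hT h' hZ

end Subcomplex

lemma contractible_mappingCone_id {C : Type*} [Category* C] [Preadditive C]
    [HasBinaryBiproducts C] [HasZeroObject C] (K : CochainComplex C ℤ) :
    contractible ((HomotopyCategory.quotient C (ComplexShape.up ℤ)).obj
      (CochainComplex.mappingCone (𝟙 K))) :=
  Pretriangulated.Triangle.isZero₃_of_isIso₁ _
    (HomotopyCategory.mappingCone_triangleh_distinguished (𝟙 K))
    (inferInstanceAs (IsIso ((HomotopyCategory.quotient C (ComplexShape.up ℤ)).map (𝟙 K))))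

/-! ### Maps into cones of identity maps -/

section ConeMap

variable {R : Type u} [Ring R] {K Z : CochainComplex (ModuleCat.{u} R) ℤ}

/-- The map to the cone of the identity map with given components. -/
noncomputable def toConeId (u : ∀ k, K.X k →ₗ[R] Z.X (k + 1)) (v : ∀ k, K.X k →ₗ[R] Z.X k)
    (hu : ∀ k x, u (k + 1) ((K.d k (k + 1)).hom x) = - (Z.d _ _).hom (u k x))
    (hv : ∀ k x, v (k + 1) ((K.d k (k + 1)).hom x) = u k x + (Z.d _ _).hom (v k x)) :
    K ⟶ CochainComplex.mappingCone (𝟙 Z) where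
  f k := ModuleCat.ofHom
    { toFun x := coneMk (𝟙 Z) k (u k x) (v k x)
      map_add' x y := by simp only [coneMk, map_add]; abel
      map_smul' c x := by
        simp only [coneMk, map_smul, RingHom.id_apply]
        exact (smul_add c _ _).symm }
  comm' k l h := by
    obtain rfl : k + 1 = l := h
    refine ModuleCat.hom_ext <| LinearMap.ext fun x ↦ ?_
    change ((CochainComplex.mappingCone (𝟙 Z)).d k (k + 1)).hom (coneMk (𝟙 Z) k (u k x) (v k x)) =
      coneMk (𝟙 Z) (k + 1) (u (k + 1) ((K.d k (k + 1)).hom x)) (v (k + 1) ((K.d k (k + 1)).hom x))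
    rw [d_coneMk, hu, hv]
    rfl

variable {u : ∀ k, K.X k →ₗ[R] Z.X (k + 1)} {v : ∀ k, K.X k →ₗ[R] Z.X k}
  {hu : ∀ k x, u (k + 1) ((K.d k (k + 1)).hom x) = - (Z.d _ _).hom (u k x)}
  {hv : ∀ k x, v (k + 1) ((K.d k (k + 1)).hom x) = u k x + (Z.d _ _).hom (v k x)}

lemma toConeId_apply (k : ℤ) (x : K.X k) :
    ((toConeId u v hu hv).f k).hom x = coneMk (𝟙 Z) k (u k x) (v k x) := rfl

lemma toConeId_apply_eq_zero_iff (k : ℤ) (x : K.X k) :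
    ((toConeId u v hu hv).f k).hom x = 0 ↔ u k x = 0 ∧ v k x = 0 := by
  rw [toConeId_apply]
  refine ⟨fun h ↦ ⟨?_, ?_⟩, fun ⟨h, h'⟩ ↦ by simp [coneMk, h, h']⟩
  · rw [← coneFst_coneMk (𝟙 Z) k (u k x) (v k x), h]
    exact map_zero _
  · rw [← coneSnd_coneMk (𝟙 Z) k (u k x) (v k x), h]
    exact map_zero _

lemma toConeId_surjective (h : ∀ k a b, ∃ x, u k x = a ∧ v k x = b) (k : ℤ) :
    Function.Surjective ((toConeId u v hu hv).f k).hom := by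
  intro y
  obtain ⟨x, hx, hx'⟩ := h k (coneFst _ y) (coneSnd _ y)
  exact ⟨x, by rw [toConeId_apply, hx, hx', coneMk_coneFst_coneSnd]⟩

end ConeMap

/-! ### The direct sum totalization of a sequence of complexes -/

section SumTotal

open DirectSum

variable (R : Type u) [Ring R]

/-- A sequence of complexes of modules connected by anticommuting maps of degree one. -/
structure SkewSequence where
  /-- the complexes -/
  E : ℕ → CochainComplex (ModuleCat.{u} R) ℤ
  /-- the maps -/
  r (i : ℕ) (k : ℤ) : (E i).X k →ₗ[R] (E (i + 1)).X (k + 1)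
  r_d (i : ℕ) (k : ℤ) (x : (E i).X k) :
    r i (k + 1) (((E i).d _ _).hom x) = - ((E (i + 1)).d _ _).hom (r i k x)
  r_r (i : ℕ) (k : ℤ) (x : (E i).X k) : r (i + 1) (k + 1) (r i k x) = 0

namespace SkewSequence

variable {R} (Q : SkewSequence R)

/-- The terms of the direct sum totalization. -/
abbrev sumTerm (k : ℤ) : Type u := ⨁ i, (Q.E i).X k

/-- The differential of the direct sum totalization. -/
noncomputable def sumD (k : ℤ) : Q.sumTerm k →ₗ[R] Q.sumTerm (k + 1) :=
  DirectSum.lmap (fun i ↦ ((Q.E i).d k (k + 1)).hom) +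
    toModule R ℕ _ fun i ↦ lof R ℕ (fun i ↦ (Q.E i).X (k + 1)) (i + 1) ∘ₗ Q.r i k

lemma sumD_lof (k : ℤ) (i : ℕ) (x : (Q.E i).X k) :
    Q.sumD k (lof R ℕ (fun i ↦ (Q.E i).X k) i x) =
      lof R ℕ (fun i ↦ (Q.E i).X (k + 1)) i (((Q.E i).d _ _).hom x) +
        lof R ℕ (fun i ↦ (Q.E i).X (k + 1)) (i + 1) (Q.r i k x) := by
  simp only [sumD, LinearMap.add_apply, toModule_lof, DirectSum.lmap_lof, LinearMap.comp_apply]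

lemma sumD_apply_zero (k : ℤ) (y : Q.sumTerm k) :
    Q.sumD k y 0 = ((Q.E 0).d _ _).hom (y 0) := by
  have : component R ℕ _ 0 ∘ₗ Q.sumD k = ((Q.E 0).d k (k + 1)).hom ∘ₗ component R ℕ _ 0 := by
    refine DirectSum.linearMap_ext _ fun m ↦ LinearMap.ext fun x ↦ ?_
    simp only [LinearMap.comp_apply, sumD_lof, map_add]
    rw [component.of R 0 (m + 1), dif_neg (by lia), add_zero]
    by_cases h : m = 0
    · subst h
      rw [component.lof_self, component.lof_self]
    · rw [component.of R 0 m, dif_neg h, component.of R 0 m, dif_neg h, map_zero]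
  exact LinearMap.congr_fun this y

lemma sumD_apply_succ (k : ℤ) (y : Q.sumTerm k) (i : ℕ) :
    Q.sumD k y (i + 1) = ((Q.E (i + 1)).d _ _).hom (y (i + 1)) + Q.r i k (y i) := by
  have : component R ℕ _ (i + 1) ∘ₗ Q.sumD k =
      ((Q.E (i + 1)).d k (k + 1)).hom ∘ₗ component R ℕ _ (i + 1) +
        Q.r i k ∘ₗ component R ℕ _ i := by
    refine DirectSum.linearMap_ext _ fun m ↦ LinearMap.ext fun x ↦ ?_
    simp only [LinearMap.comp_apply, sumD_lof, map_add, LinearMap.add_apply]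
    congr 1
    · by_cases h : m = i + 1
      · subst h
        rw [component.lof_self, component.lof_self]
      · rw [component.of R (i + 1) m, dif_neg h, component.of R (i + 1) m, dif_neg h, map_zero]
    · by_cases h : m = i
      · subst h
        rw [component.lof_self, component.lof_self]
      · rw [component.of R (i + 1) (m + 1), dif_neg (by lia), component.of R i m, dif_neg h,
          map_zero]
  exact LinearMap.congr_fun this y

/-- The direct sum totalization. -/
noncomputable def sumTotal : CochainComplex (ModuleCat.{u} R) ℤ :=
  CochainComplex.of (fun k ↦ ModuleCat.of R (Q.sumTerm k)) (fun k ↦ ModuleCat.ofHom (Q.sumD k))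
    fun k ↦ by
      refine ModuleCat.hom_ext <| LinearMap.ext fun x ↦ DFinsupp.ext fun i ↦ ?_
      change Q.sumD _ (Q.sumD k x) i = 0
      match i with
      | 0 => rw [sumD_apply_zero, sumD_apply_zero, d_d_apply]
      | 1 =>
        rw [sumD_apply_succ, sumD_apply_succ, sumD_apply_zero, map_add, d_d_apply, Q.r_d]
        abel
      | i + 2 =>
        rw [sumD_apply_succ, sumD_apply_succ, sumD_apply_succ, map_add, d_d_apply, map_add, Q.r_d,
          Q.r_r]
        abel

lemma sumTotal_d (k : ℤ) (x : Q.sumTerm k) :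
    ((Q.sumTotal).d k (k + 1)).hom x = Q.sumD k x := by
  have : (Q.sumTotal).d k (k + 1) = ModuleCat.ofHom (Q.sumD k) :=
    CochainComplex.of_d (fun k ↦ ModuleCat.of R (Q.sumTerm k)) (fun k ↦ ModuleCat.ofHom (Q.sumD k)) k
  rw [this]
  rfl

/-- The kernel of the map starting from a complex of the sequence. -/
noncomputable def kerR (n : ℕ) : Subcomplex (Q.E n) where
  carrier k := LinearMap.ker (Q.r n k)
  d_mem' k x hx := by
    rw [LinearMap.mem_ker, Q.r_d, LinearMap.mem_ker.1 hx, map_zero, neg_zero]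

/-- The terms of the canonical filtration of the direct sum totalization. -/
def sumFiltrationTerm (n : ℕ) (k : ℤ) : Submodule R (Q.sumTerm k) where
  carrier := {y | Q.r n k (y n) = 0 ∧ ∀ i, n < i → y i = 0}
  add_mem' := fun {a b} ⟨ha, ha'⟩ ⟨hb, hb'⟩ ↦
    ⟨by rw [DirectSum.add_apply, map_add, ha, hb, add_zero], fun i hi ↦ by
      rw [DirectSum.add_apply, ha' i hi, hb' i hi, add_zero]⟩
  zero_mem' := ⟨map_zero _, fun i _ ↦ rfl⟩
  smul_mem' := fun c a ⟨ha, ha'⟩ ↦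
    ⟨by rw [DirectSum.smul_apply, map_smul, ha, smul_zero], fun i hi ↦ by
      rw [DirectSum.smul_apply, ha' i hi, smul_zero]⟩

/-- The canonical filtration of the direct sum totalization. -/
noncomputable def sumFiltration (n : ℕ) : Subcomplex Q.sumTotal where
  carrier k := Q.sumFiltrationTerm n k
  d_mem' k := fun (y : Q.sumTerm k) ⟨hy, hy'⟩ ↦ by
    rw [sumTotal_d]
    refine ⟨?_, fun i hi ↦ ?_⟩
    · cases n with
      | zero => rw [sumD_apply_zero, Q.r_d, hy, map_zero, neg_zero]
      | succ n => rw [sumD_apply_succ, map_add, Q.r_d, hy, map_zero, neg_zero, zero_add, Q.r_r]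
    · obtain ⟨i, rfl⟩ : ∃ j, i = j + 1 := ⟨i - 1, by lia⟩
      rw [sumD_apply_succ, hy' _ hi, map_zero, zero_add]
      obtain h | rfl := (Nat.lt_succ_iff.1 hi).lt_or_eq
      · rw [hy' i h, map_zero]
      · exact hy

lemma sumFiltration_le (n : ℕ) (k : ℤ) :
    (Q.sumFiltration n).carrier k ≤ (Q.sumFiltration (n + 1)).carrier k :=
  fun (y : Q.sumTerm k) ⟨_, hy'⟩ ↦
    ⟨by rw [hy' (n + 1) (by lia), map_zero], fun i hi ↦ hy' i (by lia)⟩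

/-- The first component of the map from a term of the filtration to a cone. -/
noncomputable def sumFiltrationFst (n : ℕ) (k : ℤ) :
    Q.sumFiltrationTerm (n + 1) k →ₗ[R] (Q.kerR (n + 1)).carrier (k + 1) :=
  (Q.r n k ∘ₗ component R ℕ _ n ∘ₗ Submodule.subtype _).codRestrict _ fun _ ↦ Q.r_r n k _

/-- The second component of the map from a term of the filtration to a cone. -/
noncomputable def sumFiltrationSnd (n : ℕ) (k : ℤ) :
    Q.sumFiltrationTerm (n + 1) k →ₗ[R] (Q.kerR (n + 1)).carrier k :=
  (component R ℕ _ (n + 1) ∘ₗ Submodule.subtype _).codRestrict _ fun x ↦ x.2.1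

/-- The map from a term of the filtration of the totalization to a cone. -/
noncomputable def sumFiltrationToCone (n : ℕ) :
    (Q.sumFiltration (n + 1)).toComplex ⟶
      CochainComplex.mappingCone (𝟙 (Q.kerR (n + 1)).toComplex) :=
  toConeId (K := (Q.sumFiltration (n + 1)).toComplex) (Z := (Q.kerR (n + 1)).toComplex)
    (Q.sumFiltrationFst n) (Q.sumFiltrationSnd n)
    (fun k (x : Q.sumFiltrationTerm (n + 1) k) ↦ Subtype.ext <| by
      have h : Q.r n (k + 1) (Q.sumD k x.1 n) =
          - ((Q.E (n + 1)).d _ _).hom (Q.r n k (x.1 n)) := by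
        rw [← Q.r_d]
        cases n with
        | zero => rw [sumD_apply_zero]
        | succ n => rw [sumD_apply_succ, map_add, Q.r_r, add_zero]
      rw [← sumTotal_d] at h
      exact h)
    (fun k (x : Q.sumFiltrationTerm (n + 1) k) ↦ Subtype.ext <| by
      have h : Q.sumD k x.1 (n + 1) =
          Q.r n k (x.1 n) + ((Q.E (n + 1)).d _ _).hom (x.1 (n + 1)) := by
        rw [sumD_apply_succ]
        exact add_comm _ _
      rw [← sumTotal_d] at h
      exact h)

variable (hQ : ∀ i k x, Q.r (i + 1) (k + 1) x = 0 → ∃ y, Q.r i k y = x)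
  {P : ObjectProperty (Hot (ModuleCat.{u} R))} (hP : ContainsTotals P)

include hQ hP

/-- Sending `y` to the pair `r (y n)`, `y (n + 1)` identifies the subquotient with the cone of the
identity of the kernel of `r` on `E (n + 1)`, which is contractible. -/
lemma trW_sumFiltration_le (n : ℕ) :
    P.trW ((HomotopyCategory.quotient _ _).map
      (Subcomplex.inclOfLE (Q.sumFiltration_le n))) := by
  have := hP.isTriangulated
  have := hP.isClosedUnderIsomorphisms
  refine trW_inclOfLE hP _ (P.prop_of_isZero
    (contractible_mappingCone_id (Q.kerR (n + 1)).toComplex)) (Q.sumFiltrationToCone n)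
    (toConeId_surjective ?_) fun k x ↦ ?_
  · rintro k ⟨a, ha⟩ ⟨b, hb⟩
    -- Exactness lifts the first component to position `n`; the second is placed in position `n +
    -- 1`.
    obtain ⟨a, rfl⟩ := hQ n k a ha
    refine ⟨⟨(lof R ℕ (fun i ↦ (Q.E i).X k) n a + lof R ℕ (fun i ↦ (Q.E i).X k) (n + 1) b :
      Q.sumTerm k), ?_⟩, Subtype.ext ?_, Subtype.ext ?_⟩
    · refine ⟨?_, fun i hi ↦ ?_⟩
      · rw [DirectSum.add_apply, lof_eq_of, lof_eq_of, of_eq_of_ne _ _ _ (by lia), of_eq_same,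
          zero_add]
        exact hb
      · rw [DirectSum.add_apply, lof_eq_of, lof_eq_of, of_eq_of_ne _ _ _ (by lia),
          of_eq_of_ne _ _ _ (by lia), zero_add]
    · change Q.r n k ((lof R ℕ (fun i ↦ (Q.E i).X k) n a +
        lof R ℕ (fun i ↦ (Q.E i).X k) (n + 1) b : Q.sumTerm k) n) = _
      simp only [DirectSum.add_apply, lof_eq_of]
      rw [of_eq_same, of_eq_of_ne _ _ _ (by lia), add_zero]
    · change (lof R ℕ (fun i ↦ (Q.E i).X k) n a +
        lof R ℕ (fun i ↦ (Q.E i).X k) (n + 1) b : Q.sumTerm k) (n + 1) = _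
      simp only [DirectSum.add_apply, lof_eq_of]
      rw [of_eq_same, of_eq_of_ne _ _ _ (by lia), zero_add]
  · refine (toConeId_apply_eq_zero_iff _ _).trans ?_
    obtain ⟨(x : Q.sumTerm k), hx⟩ := x
    refine ⟨fun ⟨h, h'⟩ ↦ ⟨congrArg Subtype.val h, fun i hi ↦ ?_⟩,
      fun ⟨h, h'⟩ ↦ ⟨Subtype.ext h, Subtype.ext (h' (n + 1) (by lia))⟩⟩
    obtain hi | rfl := (Nat.succ_le_of_lt hi).lt_or_eq
    · exact hx.2 i hi
    · exact congrArg Subtype.val h'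

/-- Elements of a direct sum have finite support, so the filtration exhausts the totalization. -/
lemma trW_sumFiltration_zero_incl (hPc : StableUnderCoproducts P) :
    P.trW ((HomotopyCategory.quotient _ _).map (Q.sumFiltration 0).incl) := by
  refine trW_of_sequential_union hP hPc (X := fun n ↦ (Q.sumFiltration n).toComplex)
    (fun n ↦ Subcomplex.inclOfLE (Q.sumFiltration_le n)) (fun n ↦ (Q.sumFiltration n).incl)
    (fun n ↦ rfl) (fun n d ↦ Subtype.val_injective) (fun d (x : Q.sumTerm d) ↦ ?_)
    (Q.trW_sumFiltration_le hQ hP)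
  obtain ⟨n, hn⟩ : ∃ n, ∀ i, n ≤ i → x i = 0 := by
    classical
    obtain ⟨n, hn⟩ := (DFinsupp.support x).bddAbove
    exact ⟨n + 1, fun i hi ↦ by_contra fun h ↦ by
      have := hn (Finset.mem_coe.2 (DFinsupp.mem_support_iff.2 h))
      lia⟩
  exact ⟨n, ⟨x, ⟨by rw [hn n le_rfl, map_zero], fun i hi ↦ hn i hi.le⟩⟩, rfl⟩

end SkewSequence

end SumTotal

/-! ### The product totalization of a sequence of complexes -/

section PiTotal

variable (R : Type u) [Ring R]

/-- A left resolution by complexes of modules, connected by anticommuting maps of degree one. -/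
structure SkewResolution where
  /-- the complexes -/
  E : ℕ → CochainComplex (ModuleCat.{u} R) ℤ
  /-- the complexes of boundaries -/
  Z (i : ℕ) : Subcomplex (E i)
  /-- the maps -/
  r (i : ℕ) (k : ℤ) : (E (i + 1)).X k →ₗ[R] (E i).X (k + 1)
  r_d (i : ℕ) (k : ℤ) (x : (E (i + 1)).X k) :
    r i (k + 1) (((E (i + 1)).d _ _).hom x) = - ((E i).d _ _).hom (r i k x)
  r_mem (i : ℕ) (k : ℤ) (x : (E (i + 1)).X k) : r i k x ∈ (Z i).carrier (k + 1)
  mem_succ_iff (i : ℕ) (k : ℤ) (x : (E (i + 1)).X k) : x ∈ (Z (i + 1)).carrier k ↔ r i k x = 0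
  exact (i : ℕ) (k : ℤ) (x : (E i).X (k + 1)) : x ∈ (Z i).carrier (k + 1) → ∃ y, r i k y = x

namespace SkewResolution

variable {R} (Q : SkewResolution R)

lemma r_r (i : ℕ) (k : ℤ) (x : (Q.E (i + 2)).X k) : Q.r i (k + 1) (Q.r (i + 1) k x) = 0 :=
  (Q.mem_succ_iff i _ _).1 (Q.r_mem (i + 1) k x)

/-- The terms of the product totalization. -/
abbrev piTerm (k : ℤ) : Type u := ∀ i, (Q.E i).X k

/-- The differential of the product totalization. -/
def piD (k : ℤ) : Q.piTerm k →ₗ[R] Q.piTerm (k + 1) :=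
  LinearMap.pi fun i ↦ ((Q.E i).d k (k + 1)).hom ∘ₗ LinearMap.proj i +
    Q.r i k ∘ₗ LinearMap.proj (i + 1)

lemma piD_apply (k : ℤ) (y : Q.piTerm k) (i : ℕ) :
    Q.piD k y i = ((Q.E i).d _ _).hom (y i) + Q.r i k (y (i + 1)) := rfl

/-- The product totalization. -/
def piTotal : CochainComplex (ModuleCat.{u} R) ℤ :=
  CochainComplex.of (fun k ↦ ModuleCat.of R (Q.piTerm k)) (fun k ↦ ModuleCat.ofHom (Q.piD k))
    fun k ↦ by
      refine ModuleCat.hom_ext <| LinearMap.ext fun x ↦ funext fun i ↦ ?_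
      change Q.piD _ (Q.piD k x) i = 0
      rw [piD_apply, piD_apply, piD_apply, map_add, d_d_apply, map_add, Q.r_d, Q.r_r]
      abel

lemma piTotal_d (k : ℤ) (x : Q.piTerm k) :
    ((Q.piTotal).d k (k + 1)).hom x = Q.piD k x := by
  have : (Q.piTotal).d k (k + 1) = ModuleCat.ofHom (Q.piD k) :=
    CochainComplex.of_d (fun k ↦ ModuleCat.of R (Q.piTerm k)) (fun k ↦ ModuleCat.ofHom (Q.piD k)) k
  rw [this]
  rfl

/-- The terms of the canonical filtration of the product totalization. -/
def piFiltrationTerm (n : ℕ) (k : ℤ) : Submodule R (Q.piTerm k) where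
  carrier := {y | y n ∈ (Q.Z n).carrier k ∧ ∀ i, i < n → y i = 0}
  add_mem' := fun {a b} ⟨ha, ha'⟩ ⟨hb, hb'⟩ ↦
    ⟨add_mem ha hb, fun i hi ↦ by rw [Pi.add_apply, ha' i hi, hb' i hi, add_zero]⟩
  zero_mem' := ⟨zero_mem _, fun i _ ↦ rfl⟩
  smul_mem' := fun c a ⟨ha, ha'⟩ ↦
    ⟨Submodule.smul_mem _ c ha, fun i hi ↦ by rw [Pi.smul_apply, ha' i hi, smul_zero]⟩

/-- The canonical filtration of the product totalization. -/
def piFiltration (n : ℕ) : Subcomplex Q.piTotal where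
  carrier k := Q.piFiltrationTerm n k
  d_mem' k := fun (y : Q.piTerm k) ⟨hy, hy'⟩ ↦ by
    rw [piTotal_d]
    refine ⟨?_, fun i hi ↦ ?_⟩
    · rw [piD_apply]
      exact add_mem ((Q.Z n).d_mem hy) (Q.r_mem n k _)
    · rw [piD_apply, hy' i hi, map_zero, zero_add]
      obtain h | rfl := (Nat.succ_le_of_lt hi).lt_or_eq
      · rw [hy' (i + 1) h, map_zero]
      · exact (Q.mem_succ_iff i k _).1 hy

lemma piFiltration_le (n : ℕ) (k : ℤ) :
    (Q.piFiltration (n + 1)).carrier k ≤ (Q.piFiltration n).carrier k :=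
  fun (y : Q.piTerm k) ⟨_, hy'⟩ ↦
    ⟨by rw [hy' n (by lia)]; exact zero_mem _, fun i hi ↦ hy' i (by lia)⟩

/-- The first component of the map from a term of the filtration to a cone. -/
def piFiltrationFst (n : ℕ) (k : ℤ) :
    Q.piFiltrationTerm n k →ₗ[R] (Q.Z n).carrier (k + 1) :=
  (Q.r n k ∘ₗ LinearMap.proj (n + 1) ∘ₗ Submodule.subtype _).codRestrict _ fun _ ↦ Q.r_mem n k _

/-- The second component of the map from a term of the filtration to a cone. -/
def piFiltrationSnd (n : ℕ) (k : ℤ) :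
    Q.piFiltrationTerm n k →ₗ[R] (Q.Z n).carrier k :=
  (LinearMap.proj n ∘ₗ Submodule.subtype _).codRestrict _ fun x ↦ x.2.1

/-- The map from a term of the filtration of the totalization to a cone. -/
noncomputable def piFiltrationToCone (n : ℕ) :
    (Q.piFiltration n).toComplex ⟶ CochainComplex.mappingCone (𝟙 (Q.Z n).toComplex) :=
  toConeId (K := (Q.piFiltration n).toComplex) (Z := (Q.Z n).toComplex)
    (Q.piFiltrationFst n) (Q.piFiltrationSnd n)
    (fun k (x : Q.piFiltrationTerm n k) ↦ Subtype.ext <| by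
      have h : Q.r n (k + 1) (Q.piD k x.1 (n + 1)) =
          - ((Q.E n).d _ _).hom (Q.r n k (x.1 (n + 1))) := by
        rw [piD_apply, map_add, Q.r_d, Q.r_r, add_zero]
      rw [← piTotal_d] at h
      exact h)
    (fun k (x : Q.piFiltrationTerm n k) ↦ Subtype.ext <| by
      have h : Q.piD k x.1 n =
          Q.r n k (x.1 (n + 1)) + ((Q.E n).d _ _).hom (x.1 n) := by
        rw [piD_apply]
        exact add_comm _ _
      rw [← piTotal_d] at h
      exact h)

variable {P : ObjectProperty (Hot (ModuleCat.{u} R))} (hP : ContainsTotals P)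

include hP

/-- Sending `y` to the pair `r (y (n + 1))`, `y n` identifies the subquotient with the cone of the
identity of `Z n`. -/
lemma trW_piFiltration_le (n : ℕ) :
    P.trW ((HomotopyCategory.quotient _ _).map
      (Subcomplex.inclOfLE (Q.piFiltration_le n))) := by
  have := hP.isTriangulated
  have := hP.isClosedUnderIsomorphisms
  refine trW_inclOfLE hP _ (P.prop_of_isZero
    (contractible_mappingCone_id (Q.Z n).toComplex)) (Q.piFiltrationToCone n)
    (toConeId_surjective ?_) fun k x ↦ ?_
  · rintro k ⟨a, ha⟩ ⟨b, hb⟩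
    obtain ⟨a, rfl⟩ := Q.exact n k a ha
    refine ⟨⟨(Pi.single (n + 1) a + Pi.single n b : Q.piTerm k), ?_⟩, Subtype.ext ?_,
      Subtype.ext ?_⟩
    · refine ⟨?_, fun i hi ↦ ?_⟩
      · rw [Pi.add_apply, Pi.single_eq_same, Pi.single_eq_of_ne (by lia), zero_add]
        exact hb
      · rw [Pi.add_apply, Pi.single_eq_of_ne (by lia), Pi.single_eq_of_ne (by lia), zero_add]
    · change Q.r n k ((Pi.single (n + 1) a + Pi.single n b : Q.piTerm k) (n + 1)) = _
      rw [Pi.add_apply, Pi.single_eq_same, Pi.single_eq_of_ne (by lia), add_zero]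
    · change (Pi.single (n + 1) a + Pi.single n b : Q.piTerm k) n = _
      rw [Pi.add_apply, Pi.single_eq_same, Pi.single_eq_of_ne (by lia), zero_add]
  · refine (toConeId_apply_eq_zero_iff _ _).trans ?_
    obtain ⟨(x : Q.piTerm k), hx⟩ := x
    refine ⟨fun ⟨h, h'⟩ ↦ ⟨(Q.mem_succ_iff n k _).2 (congrArg Subtype.val h), fun i hi ↦ ?_⟩,
      fun ⟨h, h'⟩ ↦ ⟨Subtype.ext ((Q.mem_succ_iff n k _).1 h), Subtype.ext (h' n (by lia))⟩⟩
    obtain hi | rfl := (Nat.lt_succ_iff.1 hi).lt_or_eq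
    · exact hx.2 i hi
    · exact congrArg Subtype.val h'

/-- The product totalization is complete and separated for its decreasing filtration, hence is the
inverse limit of its quotients. -/
lemma trW_piFiltration_zero_proj (hPp : StableUnderProducts P) :
    P.trW ((HomotopyCategory.quotient _ _).map (Q.piFiltration 0).proj) := by
  refine trW_of_sequential_limit hP hPp (X := fun n ↦ (Q.piFiltration n).quotient)
    (fun n ↦ Subcomplex.projOfLE (Q.piFiltration_le n)) (fun n ↦ (Q.piFiltration n).proj)
    (fun n ↦ rfl) (fun n d ↦ Submodule.factor_surjective (Q.piFiltration_le n d))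
    (fun d (x : Q.piTerm d) hx ↦ ?_) (fun d y hy ↦ ?_)
    fun n ↦ trW_projOfLE hP _ (Q.trW_piFiltration_le hP n)
  · refine funext fun i ↦ ?_
    have : x ∈ Q.piFiltrationTerm (i + 1) d := (Submodule.Quotient.mk_eq_zero _).1 (hx (i + 1))
    exact this.2 i (by lia)
  · have (n : ℕ) : ∃ t : Q.piTerm d, (Q.piFiltrationTerm n d).mkQ t = y n :=
      Submodule.mkQ_surjective _ (y n)
    choose t ht using this
    have key (n : ℕ) : t (n + 1) - t n ∈ Q.piFiltrationTerm n d := by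
      refine (Submodule.Quotient.eq _).1 ?_
      change (Q.piFiltrationTerm n d).mkQ (t (n + 1)) = (Q.piFiltrationTerm n d).mkQ (t n)
      rw [ht n, ← hy n, ← ht (n + 1)]
      rfl
    have key' (i n : ℕ) (h : i + 1 ≤ n) : t (i + 1) i = t n i := by
      induction n, h using Nat.le_induction with
      | base => rfl
      | succ n h ih => rw [ih, ← sub_eq_zero, ← neg_eq_zero, neg_sub]; exact (key n).2 i (by lia)
    -- Coordinate `i` vanishes only from filtration step `i + 1` on, so `t (i + 1)` is the first
    -- representative with the final value there.
    refine ⟨fun i ↦ t (i + 1) i, fun n ↦ Eq.trans ?_ (ht n)⟩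
    refine (Submodule.Quotient.eq _).2 ⟨?_, fun i hi ↦ ?_⟩
    · exact (key n).1
    · exact sub_eq_zero.2 (key' i n hi)

end SkewResolution

end PiTotal

/-! ### Replacing subcomplexes and quotients by isomorphic complexes -/

section Iso

variable {R : Type u} [Ring R] {P : ObjectProperty (Hot (ModuleCat.{u} R))} [P.IsTriangulated]
  {K T : CochainComplex (ModuleCat.{u} R) ℤ} {N : Subcomplex T}

lemma isIso_of_bijective (φ : K ⟶ T) (h : ∀ k, Function.Bijective (φ.f k).hom) : IsIso φ := by
  have (k : ℤ) : IsIso (φ.f k) := (ConcreteCategory.isIso_iff_bijective _).2 (h k)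
  exact HomologicalComplex.Hom.isIso_of_components φ

lemma trW_of_injective_of_range_eq (φ : K ⟶ T) (hφ : ∀ k, Function.Injective (φ.f k).hom)
    (hφ' : ∀ k, LinearMap.range (φ.f k).hom = N.carrier k)
    (h : P.trW ((HomotopyCategory.quotient _ _).map N.incl)) :
    P.trW ((HomotopyCategory.quotient _ _).map φ) := by
  let ψ : K ⟶ N.toComplex :=
    { f k := ModuleCat.ofHom ((φ.f k).hom.codRestrict _ fun x ↦ by
        rw [← hφ' k]
        exact LinearMap.mem_range_self _ x)
      comm' k l _ := ModuleCat.hom_ext <| LinearMap.ext fun x ↦ Subtype.ext <| d_f_apply φ x }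
  have : IsIso ψ := isIso_of_bijective ψ fun k ↦
    ⟨fun x y hxy ↦ hφ k (congrArg Subtype.val hxy), fun ⟨x, hx⟩ ↦ by
      rw [← hφ' k] at hx
      obtain ⟨y, rfl⟩ := hx
      exact ⟨y, rfl⟩⟩
  have e : ψ ≫ N.incl = φ := rfl
  rw [← e, Functor.map_comp]
  exact P.trW.comp_mem _ _ (P.trW_of_isIso _) h

lemma trW_of_surjective_of_ker_eq (φ : T ⟶ K) (hφ : ∀ k, Function.Surjective (φ.f k).hom)
    (hφ' : ∀ k, LinearMap.ker (φ.f k).hom = N.carrier k)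
    (h : P.trW ((HomotopyCategory.quotient _ _).map N.proj)) :
    P.trW ((HomotopyCategory.quotient _ _).map φ) := by
  let ψ : N.quotient ⟶ K :=
    { f k := ModuleCat.ofHom (Submodule.liftQ _ (φ.f k).hom (hφ' k).ge)
      comm' k l _ := ModuleCat.hom_ext <| Submodule.linearMap_qext _ <| LinearMap.ext fun x ↦
        d_f_apply φ x }
  have : IsIso ψ := isIso_of_bijective ψ fun k ↦
    ⟨LinearMap.ker_eq_bot.1 (Submodule.ker_liftQ_eq_bot _ _ _ (hφ' k).le), fun x ↦ by
      obtain ⟨y, rfl⟩ := hφ k x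
      exact ⟨Submodule.Quotient.mk y, rfl⟩⟩
  have e : N.proj ≫ ψ = φ := rfl
  rw [← e, Functor.map_comp]
  exact P.trW.comp_mem _ _ h (P.trW_of_isIso _)

end Iso

/-! ### Embedding complexes into complexes of injectives -/

section InjectiveEmbedding

open DirectSum

variable {R : Type u} [Ring R] (Z : CochainComplex (ModuleCat.{u} R) ℤ)

instance (X Y : ModuleCat.{u} R) [Injective X] [Injective Y] :
    Injective (ModuleCat.of R (X × Y)) :=
  Injective.of_iso (ModuleCat.biprodIsoProd X Y) inferInstance

instance (X Y : ModuleCat.{u} R) [Projective X] [Projective Y] :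
    Projective (ModuleCat.of R (X × Y)) :=
  Projective.of_iso (ModuleCat.biprodIsoProd X Y) inferInstance

/-- The terms of a contractible complex of injective modules in which a given complex embeds. -/
abbrev injectiveHullTerm (k : ℤ) : Type u :=
  (Injective.under (Z.X k) : ModuleCat.{u} R) × (Injective.under (Z.X (k + 1)) : ModuleCat.{u} R)

/-- The differential of the complex of injective modules. -/
noncomputable def injectiveHullD (k : ℤ) : injectiveHullTerm Z k →ₗ[R] injectiveHullTerm Z (k + 1) :=
  LinearMap.inl R _ _ ∘ₗ LinearMap.snd R _ _

/-- A contractible complex of injective modules in which a given complex embeds. -/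
noncomputable def injectiveHull : CochainComplex (ModuleCat.{u} R) ℤ :=
  CochainComplex.of
    (fun k ↦ ModuleCat.of R (injectiveHullTerm Z k)) (fun k ↦ ModuleCat.ofHom (injectiveHullD Z k))
    fun _ ↦ rfl

instance (k : ℤ) : Injective ((injectiveHull Z).X k) :=
  inferInstanceAs (Injective (ModuleCat.of R (injectiveHullTerm Z k)))

lemma injectiveHull_d (k : ℤ) :
    (injectiveHull Z).d k (k + 1) = ModuleCat.ofHom (injectiveHullD Z k) :=
  CochainComplex.of_d
    (fun k ↦ ModuleCat.of R (injectiveHullTerm Z k)) (fun k ↦ ModuleCat.ofHom (injectiveHullD Z k)) k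

/-- The embedding of a complex in a complex of injective modules. -/
noncomputable def toInjectiveHull : Z ⟶ injectiveHull Z where
  f k := ModuleCat.ofHom ((Injective.ι (Z.X k)).hom.prod
    ((Injective.ι (Z.X (k + 1))).hom ∘ₗ (Z.d k (k + 1)).hom))
  comm' k l h := by
    obtain rfl : k + 1 = l := h
    rw [injectiveHull_d]
    refine ModuleCat.hom_ext <| LinearMap.ext fun x ↦ Prod.ext rfl ?_
    change 0 = (Injective.ι (Z.X (k + 1 + 1))).hom ((Z.d _ _).hom ((Z.d _ _).hom x))
    rw [d_d_apply, map_zero]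

lemma toInjectiveHull_injective (k : ℤ) :
    Function.Injective ((toInjectiveHull Z).f k).hom := fun _ _ h ↦
  (ModuleCat.mono_iff_injective (Injective.ι (Z.X k))).1 inferInstance (congrArg Prod.fst h)

/-- The range of a morphism as a subcomplex. -/
def Subcomplex.range {K L : CochainComplex (ModuleCat.{u} R) ℤ} (φ : K ⟶ L) : Subcomplex L where
  carrier k := LinearMap.range (φ.f k).hom
  d_mem' k x := by
    rintro ⟨y, rfl⟩
    exact ⟨_, (d_f_apply φ y).symm⟩

/-- The cokernel of the embedding in a complex of injective modules, shifted by one. -/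
noncomputable def cosyzygy : CochainComplex (ModuleCat.{u} R) ℤ :=
  (Subcomplex.range (toInjectiveHull Z)).quotient⟦(-1 : ℤ)⟧

/-- The projection to the shifted cokernel. -/
noncomputable def toCosyzygy (k : ℤ) : (injectiveHull Z).X k →ₗ[R] (cosyzygy Z).X (k + 1) :=
  (((Subcomplex.range (toInjectiveHull Z)).quotient.XIsoOfEq
    (show k = k + 1 + -1 by lia)).hom).hom ∘ₗ
      ((Subcomplex.range (toInjectiveHull Z)).proj.f k).hom

lemma toCosyzygy_surjective (k : ℤ) : Function.Surjective (toCosyzygy Z k) :=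
  ((ModuleCat.epi_iff_surjective ((Subcomplex.range (toInjectiveHull Z)).quotient.XIsoOfEq
    (show k = k + 1 + -1 by lia)).hom).1 inferInstance).comp (Submodule.mkQ_surjective _)

lemma toCosyzygy_eq_zero_iff (k : ℤ) (x : (injectiveHull Z).X k) :
    toCosyzygy Z k x = 0 ↔ ∃ z, ((toInjectiveHull Z).f k).hom z = x := by
  refine Iff.trans ?_ (Submodule.Quotient.mk_eq_zero (LinearMap.range _))
  exact map_eq_zero_iff _ ((ModuleCat.mono_iff_injective
    ((Subcomplex.range (toInjectiveHull Z)).quotient.XIsoOfEq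
      (show k = k + 1 + -1 by lia)).hom).1 inferInstance)

/-- The shift by -1 in `cosyzygy` negates the differential, which yields the anticommutation
required of a `SkewSequence`. -/
lemma toCosyzygy_d (k : ℤ) (x : (injectiveHull Z).X k) :
    toCosyzygy Z (k + 1) (((injectiveHull Z).d _ _).hom x) =
      - ((cosyzygy Z).d _ _).hom (toCosyzygy Z k x) := by
  have hd : (cosyzygy Z).d (k + 1) (k + 1 + 1) =
      - (Subcomplex.range (toInjectiveHull Z)).quotient.d _ _ := by
    simp [cosyzygy]
  have h : (Subcomplex.range (toInjectiveHull Z)).quotient.d k (k + 1) ≫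
      ((Subcomplex.range (toInjectiveHull Z)).quotient.XIsoOfEq
        (show k + 1 = k + 1 + 1 + -1 by lia)).hom =
      ((Subcomplex.range (toInjectiveHull Z)).quotient.XIsoOfEq
        (show k = k + 1 + -1 by lia)).hom ≫
        (Subcomplex.range (toInjectiveHull Z)).quotient.d _ _ := by
    rw [HomologicalComplex.d_comp_XIsoOfEq_hom, HomologicalComplex.XIsoOfEq_hom_comp_d]
  rw [hd]
  refine Eq.trans ?_ (neg_neg _).symm
  refine Eq.trans ?_ (LinearMap.congr_fun (congrArg ModuleCat.Hom.hom h)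
    (((Subcomplex.range (toInjectiveHull Z)).proj.f k).hom x))
  rfl

/-- The maps in the resolution of a complex by complexes of injective modules. -/
noncomputable def injectiveStep (k : ℤ) :
    (injectiveHull Z).X k →ₗ[R] (injectiveHull (cosyzygy Z)).X (k + 1) :=
  ((toInjectiveHull (cosyzygy Z)).f (k + 1)).hom ∘ₗ toCosyzygy Z k

lemma injectiveStep_eq_zero_iff (k : ℤ) (x : (injectiveHull Z).X k) :
    injectiveStep Z k x = 0 ↔ ∃ z, ((toInjectiveHull Z).f k).hom z = x :=
  (map_eq_zero_iff _ (toInjectiveHull_injective _ _)).trans (toCosyzygy_eq_zero_iff _ _ _)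

lemma injectiveStep_d (k : ℤ) (x : (injectiveHull Z).X k) :
    injectiveStep Z (k + 1) (((injectiveHull Z).d _ _).hom x) =
      - ((injectiveHull (cosyzygy Z)).d _ _).hom (injectiveStep Z k x) := by
  simp only [injectiveStep, LinearMap.comp_apply]
  rw [toCosyzygy_d, d_f_apply, map_neg]

lemma injectiveStep_injectiveStep (k : ℤ) (x : (injectiveHull Z).X k) :
    injectiveStep (cosyzygy Z) (k + 1) (injectiveStep Z k x) = 0 :=
  (injectiveStep_eq_zero_iff _ _ _).2 ⟨_, rfl⟩

lemma exists_of_injectiveStep_eq_zero (k : ℤ) (x : (injectiveHull (cosyzygy Z)).X (k + 1))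
    (hx : injectiveStep (cosyzygy Z) (k + 1) x = 0) : ∃ y, injectiveStep Z k y = x := by
  obtain ⟨z, rfl⟩ := (injectiveStep_eq_zero_iff _ _ _).1 hx
  obtain ⟨y, rfl⟩ := toCosyzygy_surjective _ _ z
  exact ⟨y, rfl⟩

/-- The iterated cosyzygies of a complex. -/
noncomputable def iteratedCosyzygy : ℕ → CochainComplex (ModuleCat.{u} R) ℤ
  | 0 => Z
  | n + 1 => cosyzygy (iteratedCosyzygy n)

/-- The resolution of a complex by contractible complexes of injective modules. -/
noncomputable def injectiveSkewSequence : SkewSequence R where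
  E n := injectiveHull (iteratedCosyzygy Z n)
  r n k := injectiveStep (iteratedCosyzygy Z n) k
  r_d _ _ _ := injectiveStep_d _ _ _
  r_r _ _ _ := injectiveStep_injectiveStep _ _ _

/-- The embedding of a complex in the totalization of its resolution. -/
noncomputable def toSumTotal : Z ⟶ (injectiveSkewSequence Z).sumTotal where
  f k := ModuleCat.ofHom (lof R ℕ (fun i ↦ ((injectiveSkewSequence Z).E i).X k) 0 ∘ₗ
    ((toInjectiveHull Z).f k).hom)
  comm' k l h := by
    obtain rfl : k + 1 = l := h
    refine ModuleCat.hom_ext <| LinearMap.ext fun x ↦ ?_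
    refine ((injectiveSkewSequence Z).sumTotal_d k _).trans ?_
    refine ((injectiveSkewSequence Z).sumD_lof k 0 _).trans ?_
    refine (congrArg₂ (fun a b ↦ lof R ℕ (fun i ↦ ((injectiveSkewSequence Z).E i).X (k + 1)) 0 a +
      lof R ℕ (fun i ↦ ((injectiveSkewSequence Z).E i).X (k + 1)) 1 b)
      (d_f_apply (toInjectiveHull Z) x)
      ((injectiveStep_eq_zero_iff Z k _).2 ⟨x, rfl⟩)).trans ?_
    exact (congrArg (lof R ℕ (fun i ↦ ((injectiveSkewSequence Z).E i).X (k + 1)) 0 _ + ·)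
      (map_zero (lof R ℕ (fun i ↦ ((injectiveSkewSequence Z).E i).X (k + 1)) 1))).trans (add_zero _)

/-- Step 0 of the filtration consists of the elements of the first hull killed by the next map, and
these are exactly the image of `Z`. -/
lemma trW_toSumTotal {P : ObjectProperty (Hot (ModuleCat.{u} R))} (hP : ContainsTotals P)
    (hPc : StableUnderCoproducts P) :
    P.trW ((HomotopyCategory.quotient _ _).map (toSumTotal Z)) := by
  have := hP.isTriangulated
  refine trW_of_injective_of_range_eq (N := (injectiveSkewSequence Z).sumFiltration 0) _
    (fun k x y hxy ↦ ?_) (fun k ↦ ?_)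
    ((injectiveSkewSequence Z).trW_sumFiltration_zero_incl
      (fun n k x ↦ exists_of_injectiveStep_eq_zero _ k x) hP hPc)
  · exact toInjectiveHull_injective Z k (DirectSum.of_injective (β := fun i ↦ ((injectiveSkewSequence Z).E i).X k) 0 hxy)
  · refine le_antisymm ?_ fun x hx ↦ ?_
    · rintro _ ⟨x, rfl⟩
      refine ⟨(injectiveStep_eq_zero_iff Z k _).2 ⟨x, ?_⟩, fun i hi ↦ ?_⟩
      · exact (DirectSum.of_eq_same (β := fun i ↦ ((injectiveSkewSequence Z).E i).X k) 0 _).symm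
      · exact DirectSum.of_eq_of_ne (β := fun i ↦ ((injectiveSkewSequence Z).E i).X k) _ _ _ (by lia)
    · obtain ⟨h, h'⟩ := hx
      obtain ⟨z, hz⟩ := (injectiveStep_eq_zero_iff Z k _).1 h
      refine ⟨z, DFinsupp.ext fun i ↦ ?_⟩
      by_cases hi : i = 0
      · subst hi
        exact (DirectSum.of_eq_same (β := fun i ↦ ((injectiveSkewSequence Z).E i).X k) 0 _).trans hz
      · exact (DirectSum.of_eq_of_ne (β := fun i ↦ ((injectiveSkewSequence Z).E i).X k) _ _ _ hi).trans (h' i (by lia)).symm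

end InjectiveEmbedding

/-! ### Covering complexes by complexes of projectives -/

section ProjectiveCover

variable {R : Type u} [Ring R] (Z : CochainComplex (ModuleCat.{u} R) ℤ)

/-- The terms of a contractible complex of projective modules that covers a given complex. -/
abbrev projectiveHullTerm (k : ℤ) : Type u :=
  (Projective.over (Z.X (k - 1)) : ModuleCat.{u} R) ×
    (Projective.over (Z.X (k + 1 - 1)) : ModuleCat.{u} R)

/-- The differential of the complex of projective modules. -/
noncomputable def projectiveHullD (k : ℤ) :
    projectiveHullTerm Z k →ₗ[R] projectiveHullTerm Z (k + 1) :=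
  -- The index `k + 1 - 1` of the second factor is literally that of the first factor one degree up,
  -- so no transport is needed.
  LinearMap.inl R _ _ ∘ₗ LinearMap.snd R _ _

/-- A contractible complex of projective modules that covers a given complex. -/
noncomputable def projectiveHull : CochainComplex (ModuleCat.{u} R) ℤ :=
  CochainComplex.of
    (fun k ↦ ModuleCat.of R (projectiveHullTerm Z k)) (fun k ↦ ModuleCat.ofHom (projectiveHullD Z k))
    fun _ ↦ rfl

instance (k : ℤ) : Projective ((projectiveHull Z).X k) :=
  inferInstanceAs (Projective (ModuleCat.of R (projectiveHullTerm Z k)))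

lemma projectiveHull_d (k : ℤ) :
    (projectiveHull Z).d k (k + 1) = ModuleCat.ofHom (projectiveHullD Z k) :=
  CochainComplex.of_d
    (fun k ↦ ModuleCat.of R (projectiveHullTerm Z k)) (fun k ↦ ModuleCat.ofHom (projectiveHullD Z k)) k

/-- The projection from the complex of projective modules. -/
noncomputable def fromProjectiveHull : projectiveHull Z ⟶ Z where
  f k := ModuleCat.ofHom (((Projective.π (Z.X (k - 1)) ≫ Z.d (k - 1) k).hom).coprod
    (Projective.π (Z.X (k + 1 - 1)) ≫ (Z.XIsoOfEq (show k + 1 - 1 = k by lia)).hom).hom)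
  comm' k l h := by
    obtain rfl : k + 1 = l := h
    rw [projectiveHull_d]
    refine ModuleCat.hom_ext <| LinearMap.ext fun (x : _ × _) ↦ ?_
    have h₁ : (Projective.π (Z.X (k - 1)) ≫ Z.d (k - 1) k) ≫ Z.d k (k + 1) = 0 := by simp
    have h₂ : (Projective.π (Z.X (k + 1 - 1)) ≫ (Z.XIsoOfEq (show k + 1 - 1 = k by lia)).hom) ≫
        Z.d k (k + 1) = Projective.π (Z.X (k + 1 - 1)) ≫ Z.d (k + 1 - 1) (k + 1) := by
      rw [Category.assoc, HomologicalComplex.XIsoOfEq_hom_comp_d]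
    change (Z.d k (k + 1)).hom (LinearMap.coprod _ _ x) = LinearMap.coprod _ _ (x.2, 0)
    rw [LinearMap.coprod_apply, LinearMap.coprod_apply, map_add, map_zero, add_zero,
      hom_apply_of_comp_eq h₁, hom_apply_of_comp_eq h₂]
    exact zero_add _

lemma fromProjectiveHull_surjective (k : ℤ) :
    Function.Surjective ((fromProjectiveHull Z).f k).hom := fun x ↦ by
  obtain ⟨y, rfl⟩ := (ModuleCat.epi_iff_surjective (Projective.π (Z.X (k + 1 - 1)) ≫
    (Z.XIsoOfEq (show k + 1 - 1 = k by lia)).hom)).1 inferInstance x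
  refine ⟨(0, y), (LinearMap.coprod_apply _ _ _).trans ?_⟩
  rw [map_zero, zero_add]

/-- The kernel of the projection from the complex of projective modules, shifted by one. -/
noncomputable def syzygy : CochainComplex (ModuleCat.{u} R) ℤ :=
  (Subcomplex.ker (fromProjectiveHull Z)).toComplex⟦(1 : ℤ)⟧

/-- The inclusion of the shifted kernel. -/
noncomputable def fromSyzygy (k : ℤ) : (syzygy Z).X k →ₗ[R] (projectiveHull Z).X (k + 1) :=
  ((Subcomplex.ker (fromProjectiveHull Z)).incl.f (k + 1)).hom

lemma fromSyzygy_injective (k : ℤ) : Function.Injective (fromSyzygy Z k) :=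
  Subtype.val_injective

lemma fromSyzygy_d (k : ℤ) (x : (syzygy Z).X k) :
    fromSyzygy Z (k + 1) (((syzygy Z).d _ _).hom x) =
      - ((projectiveHull Z).d _ _).hom (fromSyzygy Z k x) := by
  have hd : (syzygy Z).d k (k + 1) =
      - (Subcomplex.ker (fromProjectiveHull Z)).toComplex.d (k + 1) (k + 1 + 1) := by
    simp [syzygy]
  rw [hd]
  rfl

/-- The maps in the resolution of a complex by complexes of projective modules. -/
noncomputable def projectiveStep (k : ℤ) :
    (projectiveHull (syzygy Z)).X k →ₗ[R] (projectiveHull Z).X (k + 1) :=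
  fromSyzygy Z k ∘ₗ ((fromProjectiveHull (syzygy Z)).f k).hom

lemma projectiveStep_d (k : ℤ) (x : (projectiveHull (syzygy Z)).X k) :
    projectiveStep Z (k + 1) (((projectiveHull (syzygy Z)).d _ _).hom x) =
      - ((projectiveHull Z).d _ _).hom (projectiveStep Z k x) := by
  simp only [projectiveStep, LinearMap.comp_apply]
  rw [← d_f_apply, fromSyzygy_d]

lemma exists_projectiveStep_eq (k : ℤ) (x : (projectiveHull Z).X (k + 1))
    (hx : x ∈ (Subcomplex.ker (fromProjectiveHull Z)).carrier (k + 1)) :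
    ∃ y, projectiveStep Z k y = x := by
  obtain ⟨y, hy⟩ := fromProjectiveHull_surjective (syzygy Z) k ⟨x, hx⟩
  exact ⟨y, congrArg (fromSyzygy Z k) hy⟩

/-- The iterated syzygies of a complex. -/
noncomputable def iteratedSyzygy : ℕ → CochainComplex (ModuleCat.{u} R) ℤ
  | 0 => Z
  | n + 1 => syzygy (iteratedSyzygy n)

/-- The resolution of a complex by contractible complexes of projective modules. -/
noncomputable def projectiveSkewResolution : SkewResolution R where
  E n := projectiveHull (iteratedSyzygy Z n)
  Z n := Subcomplex.ker (fromProjectiveHull (iteratedSyzygy Z n))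
  r n k := projectiveStep (iteratedSyzygy Z n) k
  r_d _ _ _ := projectiveStep_d _ _ _
  r_mem _ _ _ := Subtype.prop _
  mem_succ_iff _ _ _ := (map_eq_zero_iff _ (fromSyzygy_injective _ _)).symm
  exact _ k x hx := exists_projectiveStep_eq _ k x hx

/-- The projection from the totalization of the resolution of a complex. -/
noncomputable def fromPiTotal : (projectiveSkewResolution Z).piTotal ⟶ Z where
  f k := ModuleCat.ofHom (((fromProjectiveHull Z).f k).hom ∘ₗ
    LinearMap.proj (φ := fun i ↦ ((projectiveSkewResolution Z).E i).X k) 0)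
  comm' k l h := by
    obtain rfl : k + 1 = l := h
    refine ModuleCat.hom_ext <| LinearMap.ext fun x ↦ ?_
    refine (d_f_apply (fromProjectiveHull Z) (a := k) (b := k + 1) _).trans ?_
    refine Eq.trans ?_ (congrArg (((fromProjectiveHull Z).f (k + 1)).hom ∘ₗ
      LinearMap.proj (φ := fun i ↦ ((projectiveSkewResolution Z).E i).X (k + 1)) 0)
        ((projectiveSkewResolution Z).piTotal_d k x).symm)
    refine Eq.trans ?_ (map_add ((fromProjectiveHull Z).f (k + 1)).hom _ _).symm
    refine ((congrArg (((fromProjectiveHull Z).f (k + 1)).hom _ + ·) ?_).trans (add_zero _)).symm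
    exact (projectiveSkewResolution Z).r_mem 0 k _

/-- The kernel of the map to `Z` constrains only coordinate 0, and so is step 0 of the filtration.
-/
lemma trW_fromPiTotal {P : ObjectProperty (Hot (ModuleCat.{u} R))} (hP : ContainsTotals P)
    (hPp : StableUnderProducts P) :
    P.trW ((HomotopyCategory.quotient _ _).map (fromPiTotal Z)) := by
  have := hP.isTriangulated
  refine trW_of_surjective_of_ker_eq (N := (projectiveSkewResolution Z).piFiltration 0) _
    (fun k x ↦ ?_) (fun k ↦ ?_) ((projectiveSkewResolution Z).trW_piFiltration_zero_proj hP hPp)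
  · obtain ⟨y, rfl⟩ := fromProjectiveHull_surjective Z k x
    exact ⟨(Pi.single 0 y : (projectiveSkewResolution Z).piTerm k), rfl⟩
  · exact Submodule.ext fun x ↦ ⟨fun hx ↦ ⟨hx, fun i hi ↦ by lia⟩, fun hx ↦ hx.1⟩

end ProjectiveCover

/-! ### Resolutions of complexes of modules of finite dimension -/

section Resolutions

open CochainComplex Pretriangulated

variable {R : Type u} [Ring R] (P : ObjectProperty (Hot (ModuleCat.{u} R)))
  (Q : ObjectProperty (ModuleCat.{u} R))

/-- The objects of the homotopy category that admit a weak equivalence to a complex of modules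
with a given property. -/
def HasRightResolution (X : Hot (ModuleCat.{u} R)) : Prop :=
  ∃ (J : CochainComplex (ModuleCat.{u} R) ℤ) (φ : X ⟶ (HomotopyCategory.quotient _ _).obj J),
    (∀ k, Q (J.X k)) ∧ P.trW φ

/-- The objects of the homotopy category that admit a weak equivalence from a complex of modules
with a given property. -/
def HasLeftResolution (X : Hot (ModuleCat.{u} R)) : Prop :=
  ∃ (J : CochainComplex (ModuleCat.{u} R) ℤ) (φ : (HomotopyCategory.quotient _ _).obj J ⟶ X),
    (∀ k, Q (J.X k)) ∧ P.trW φ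

variable {P Q} [P.IsTriangulated] {X Y : Hot (ModuleCat.{u} R)}

lemma HasRightResolution.of_trW (φ : X ⟶ Y) (hφ : P.trW φ) (h : HasRightResolution P Q Y) :
    HasRightResolution P Q X := by
  obtain ⟨J, ψ, hJ, hψ⟩ := h
  exact ⟨J, φ ≫ ψ, hJ, P.trW.comp_mem _ _ hφ hψ⟩

lemma HasLeftResolution.of_trW (φ : X ⟶ Y) (hφ : P.trW φ) (h : HasLeftResolution P Q X) :
    HasLeftResolution P Q Y := by
  obtain ⟨J, ψ, hJ, hψ⟩ := h
  exact ⟨J, ψ ≫ φ, hJ, P.trW.comp_mem _ _ hψ hφ⟩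

lemma HasRightResolution.shift (h : HasRightResolution P Q X) (n : ℤ) :
    HasRightResolution P Q (X⟦n⟧) := by
  obtain ⟨J, φ, hJ, hφ⟩ := h
  refine ⟨J⟦n⟧, φ⟦n⟧' ≫ (((HomotopyCategory.quotient _ _).commShiftIso n).inv.app J),
    fun k ↦ hJ (k + n), P.trW.comp_mem _ _ ?_ (P.trW_of_isIso _)⟩
  exact MorphismProperty.IsCompatibleWithShift.iff P.trW φ n |>.2 hφ

lemma HasRightResolution.of_shift {n : ℤ} (h : HasRightResolution P Q (X⟦n⟧)) :
    HasRightResolution P Q X :=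
  (h.shift (-n)).of_trW ((shiftEquiv (Hot (ModuleCat.{u} R)) n).unitIso.hom.app X)
    (P.trW_of_isIso _)

variable (hQ : ∀ X Y, Q X → Q Y → Q (X ⊞ Y)) [Q.IsClosedUnderIsomorphisms]

include hQ

lemma prop_mappingCone {K L : CochainComplex (ModuleCat.{u} R) ℤ} (φ : K ⟶ L)
    (hK : ∀ k, Q (K.X k)) (hL : ∀ k, Q (L.X k)) (k : ℤ) : Q ((mappingCone φ).X k) :=
  Q.prop_of_iso (HomologicalComplex.homotopyCofiber.XIsoBiprod φ k (k + 1) rfl).symm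
    (hQ _ _ (hK _) (hL _))

variable {S : ShortComplex (CochainComplex (ModuleCat.{u} R) ℤ)} (hS : S.ShortExact)
  (hP : ContainsTotals P) (h₂ : ∀ k, Q (S.X₂.X k))

include hS hP h₂

/-- Modulo `P`, the shift of `S.X₁` is the cone of `S.X₂ ⟶ S.X₃`. Replacing `S.X₃` by its resolution
`J` gives the cone of `S.X₂ ⟶ J`, whose terms satisfy `Q`. -/
lemma hasRightResolution_of_shortExact
    (h : HasRightResolution P Q ((HomotopyCategory.quotient _ _).obj S.X₃)) :
    HasRightResolution P Q ((HomotopyCategory.quotient _ _).obj S.X₁) := by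
  obtain ⟨J, ψ, hJ, hψ⟩ := h
  obtain ⟨ψ, rfl⟩ := (HomotopyCategory.quotient _ _).map_surjective ψ
  have h₁ : P.trW (𝟙 ((HomotopyCategory.quotient _ _).obj S.X₂)) := P.trW_of_isIso _
  have h₃ : P.trW ((HomotopyCategory.quotient _ _).map (mappingCone.descShortComplex S ≫ ψ)) := by
    rw [Functor.map_comp]
    exact P.trW.comp_mem _ _ (hP.trW_descShortComplex hS) hψ
  have comm : (HomotopyCategory.quotient _ (ComplexShape.up ℤ)).map (mappingCone.inr S.f) ≫
      (HomotopyCategory.quotient _ _).map (mappingCone.descShortComplex S ≫ ψ) =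
        𝟙 _ ≫ (HomotopyCategory.quotient _ _).map (S.g ≫ ψ) := by
    rw [← Functor.map_comp, mappingCone.inr_descShortComplex_assoc, Category.id_comp]
  obtain ⟨c, hc, -⟩ := MorphismProperty.compatible_with_triangulation (W := P.trW) _ _
    (rot_of_distTriang _ (HomotopyCategory.mappingCone_triangleh_distinguished S.f))
    (HomotopyCategory.mappingCone_triangleh_distinguished (S.g ≫ ψ)) _ _ h₁ h₃ comm
  exact .of_shift (n := 1) ⟨_, c, prop_mappingCone hQ _ h₂ hJ, hc⟩

/-- Modulo `P`, `S.X₃` is the cone of `S.f`, and `S.X₁` may be replaced by its resolution `J`. -/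
lemma hasLeftResolution_of_shortExact
    (h : HasLeftResolution P Q ((HomotopyCategory.quotient _ _).obj S.X₁)) :
    HasLeftResolution P Q ((HomotopyCategory.quotient _ _).obj S.X₃) := by
  obtain ⟨J, ψ, hJ, hψ⟩ := h
  obtain ⟨ψ, rfl⟩ := (HomotopyCategory.quotient _ _).map_surjective ψ
  have h₁ : P.trW (𝟙 ((HomotopyCategory.quotient _ _).obj S.X₂)) := P.trW_of_isIso _
  have comm : (HomotopyCategory.quotient _ (ComplexShape.up ℤ)).map (ψ ≫ S.f) ≫ 𝟙 _ =
      (HomotopyCategory.quotient _ _).map ψ ≫ (HomotopyCategory.quotient _ _).map S.f := by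
    rw [← Functor.map_comp, Category.comp_id]
  obtain ⟨c, hc, -⟩ := MorphismProperty.compatible_with_triangulation (W := P.trW) _ _
    (HomotopyCategory.mappingCone_triangleh_distinguished (ψ ≫ S.f))
    (HomotopyCategory.mappingCone_triangleh_distinguished S.f) _ _ hψ h₁ comm
  exact ⟨_, c ≫ (HomotopyCategory.quotient _ _).map (mappingCone.descShortComplex S),
    prop_mappingCone hQ _ hJ h₂, P.trW.comp_mem _ _ hc (hP.trW_descShortComplex hS)⟩

end Resolutions

/-! ### Relative resolutions of complexes of bounded dimension -/

section RelativeResolutions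

variable {A R : Type u} [Ring A] [Ring R] (f : A →+* R)

lemma relInjective_biprod (X Y : ModuleCat.{u} R) (hX : relInjective f X)
    (hY : relInjective f Y) : relInjective f (X ⊞ Y) :=
  have : Injective ((ModuleCat.restrictScalars f).obj X) := hX
  have : Injective ((ModuleCat.restrictScalars f).obj Y) := hY
  have := preservesBinaryBiproducts_of_preservesBiproducts (ModuleCat.restrictScalars f)
  Injective.of_iso ((ModuleCat.restrictScalars f).mapBiprod X Y).symm inferInstance

lemma relProjective_biprod (X Y : ModuleCat.{u} R) (hX : relProjective f X)
    (hY : relProjective f Y) : relProjective f (X ⊞ Y) :=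
  have : Projective ((ModuleCat.restrictScalars f).obj X) := hX
  have : Projective ((ModuleCat.restrictScalars f).obj Y) := hY
  have := preservesBinaryBiproducts_of_preservesBiproducts (ModuleCat.restrictScalars f)
  Projective.of_iso ((ModuleCat.restrictScalars f).mapBiprod X Y).symm inferInstance

/-- Dimension shifting: the hull has relatively injective terms, so the cokernel of the embedding
has dimension one less over `A`, and its resolution is folded back by
`hasRightResolution_of_shortExact`. -/
lemma hasRightResolution_of_injectiveDimension {P : ObjectProperty (Hot (ModuleCat.{u} R))}
    (hP : ContainsTotals P) (hR : ∀ J : ModuleCat.{u} R, Injective J → relInjective f J) (n : ℕ)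
    (X : CochainComplex (ModuleCat.{u} R) ℤ)
    (hX : ∀ k, HasInjectiveDimensionLE ((ModuleCat.restrictScalars f).obj (X.X k)) n) :
    HasRightResolution P (relInjective f) ((HomotopyCategory.quotient _ _).obj X) := by
  have := hP.isTriangulated
  induction n generalizing X with
  | zero => exact ⟨X, 𝟙 _, fun k ↦ injective_iff_hasInjectiveDimensionLT_one.2 (hX k),
      P.trW_of_isIso _⟩
  | succ n ih =>
    let S : ShortComplex (CochainComplex (ModuleCat.{u} R) ℤ) :=
      { X₁ := X
        X₂ := injectiveHull X
        X₃ := (Subcomplex.range (toInjectiveHull X)).quotient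
        f := toInjectiveHull X
        g := (Subcomplex.range (toInjectiveHull X)).proj
        zero := by
          ext1 k
          exact ModuleCat.hom_ext <| LinearMap.ext fun x ↦
            (Submodule.Quotient.mk_eq_zero _).2 ⟨x, rfl⟩ }
    have hS : S.ShortExact := shortExact_of_degreewise (toInjectiveHull_injective X)
      (fun k x ↦ Submodule.Quotient.mk_eq_zero _) fun k ↦ Submodule.mkQ_surjective _
    refine hasRightResolution_of_shortExact (relInjective_biprod f) hS hP
      (fun k ↦ hR _ inferInstance) (ih _ fun k ↦ ?_)
    have := hR ((injectiveHull X).X k) inferInstance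
    have : Injective ((ModuleCat.restrictScalars f).obj ((injectiveHull X).X k)) := this
    exact ((shortExact_eval hS k).map_of_exact
      (ModuleCat.restrictScalars f)).hasInjectiveDimensionLT_X₃ (n + 1)
        (inferInstanceAs (HasInjectiveDimensionLT
          ((ModuleCat.restrictScalars f).obj ((injectiveHull X).X k)) (n + 1))) (hX k)

/-- Dimension shifting along the kernel of the projective cover, folded back by
`hasLeftResolution_of_shortExact`. -/
lemma hasLeftResolution_of_projectiveDimension {P : ObjectProperty (Hot (ModuleCat.{u} R))}
    (hP : ContainsTotals P) (hR : ∀ J : ModuleCat.{u} R, Projective J → relProjective f J) (n : ℕ)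
    (X : CochainComplex (ModuleCat.{u} R) ℤ)
    (hX : ∀ k, HasProjectiveDimensionLE ((ModuleCat.restrictScalars f).obj (X.X k)) n) :
    HasLeftResolution P (relProjective f) ((HomotopyCategory.quotient _ _).obj X) := by
  have := hP.isTriangulated
  induction n generalizing X with
  | zero => exact ⟨X, 𝟙 _, fun k ↦ projective_iff_hasProjectiveDimensionLT_one.2 (hX k),
      P.trW_of_isIso _⟩
  | succ n ih =>
    let S : ShortComplex (CochainComplex (ModuleCat.{u} R) ℤ) :=
      { X₁ := (Subcomplex.ker (fromProjectiveHull X)).toComplex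
        X₂ := projectiveHull X
        X₃ := X
        f := (Subcomplex.ker (fromProjectiveHull X)).incl
        g := fromProjectiveHull X
        zero := by
          ext1 k
          exact ModuleCat.hom_ext <| LinearMap.ext fun x ↦ x.2 }
    have hS : S.ShortExact := shortExact_of_degreewise (fun k ↦ Subtype.val_injective)
      (fun k x ↦ ⟨fun hx ↦ ⟨⟨x, hx⟩, rfl⟩, by rintro ⟨x, rfl⟩; exact x.2⟩)
      (fromProjectiveHull_surjective X)
    refine hasLeftResolution_of_shortExact (relProjective_biprod f) hS hP
      (fun k ↦ hR _ inferInstance) (ih _ fun k ↦ ?_)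
    have := hR ((projectiveHull X).X k) inferInstance
    have : Projective ((ModuleCat.restrictScalars f).obj ((projectiveHull X).X k)) := this
    exact ((shortExact_eval hS k).map_of_exact
      (ModuleCat.restrictScalars f)).hasProjectiveDimensionLT_X₁ (n + 1)
        (inferInstanceAs (HasProjectiveDimensionLT
          ((ModuleCat.restrictScalars f).obj ((projectiveHull X).X k)) (n + 1))) (hX k)

end RelativeResolutions

/-! ### fp-injective modules -/

section FpInjective

variable {A : Type u} [Ring A]

lemma IsFpInjective.of_injective (J : ModuleCat.{u} A) [Injective J] : IsFpInjective J :=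
  fun S hS _ _ _ φ ↦
    have := hS.mono_f
    ⟨Injective.factorThru φ S.f, Injective.comp_factorThru φ S.f⟩

/-- A module which is a locally finite sum of retracts that are fp-injective is fp-injective. -/
lemma IsFpInjective.of_locally_finite {ι : Type*} {N : ι → ModuleCat.{u} A} {Y : ModuleCat.{u} A}
    (hN : ∀ i, IsFpInjective (N i)) (a : ∀ i, N i →ₗ[A] Y) (b : ∀ i, Y →ₗ[A] N i)
    (hab : ∀ y, ∃ s : Finset ι, ∀ t, s ⊆ t → ∑ i ∈ t, a i (b i y) = y) : IsFpInjective Y := by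
  classical
  intro S hS h₁ h₂ h₃ φ
  choose ψ hψ using fun i ↦ hN i S hS h₁ h₂ h₃ (φ ≫ ModuleCat.ofHom (b i))
  choose s hs using hab
  obtain ⟨G, hG⟩ := (inferInstance : Module.Finite A S.X₁).fg_top
  -- On the finitely many generators of `S.X₁` only finitely many summands matter, so a finite sum
  -- of the individual extensions suffices.
  let t := G.biUnion fun x ↦ s (φ.hom x)
  refine ⟨ModuleCat.ofHom (∑ i ∈ t, a i ∘ₗ (ψ i).hom), ModuleCat.hom_ext ?_⟩
  refine LinearMap.ext_on hG fun x hx ↦ ?_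
  have h (i : ι) : (ψ i).hom (S.f.hom x) = b i (φ.hom x) := hom_apply_of_comp_eq (hψ i) x
  simp only [ModuleCat.hom_comp, ModuleCat.hom_ofHom, LinearMap.comp_apply, LinearMap.sum_apply, h]
  exact hs _ _ (Finset.subset_biUnion_of_mem (fun x ↦ s (φ.hom x)) hx)

lemma exists_sum_of_component {R : Type u} [Ring R] {ι : Type*} [DecidableEq ι] {M : ι → Type u}
    [∀ i, AddCommGroup (M i)] [∀ i, Module R (M i)] (y : DirectSum ι M) :
    ∃ s : Finset ι, ∀ t, s ⊆ t →
      ∑ i ∈ t, DirectSum.lof R ι M i (DirectSum.component R ι M i y) = y := by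
  classical
  refine ⟨DFinsupp.support y, fun t ht ↦ ?_⟩
  conv_rhs => rw [← DirectSum.sum_support_of y]
  refine (Finset.sum_subset ht fun i _ hi ↦ ?_).symm
  exact (congrArg (DirectSum.lof R ι M i) (DFinsupp.notMem_support_iff.1 hi)).trans (map_zero _)

/-- The direct sum of the whole family is fp-injective; its injective dimension bounds that of every
retract `N i`. -/
lemma exists_uniform_injectiveDimension {ι : Type} {N : ι → ModuleCat.{u} A}
    (hN : ∀ i, IsFpInjective (N i))
    (hA : ∀ J : ModuleCat.{u} A, IsFpInjective J → ∃ n : ℕ, HasInjectiveDimensionLE J n) :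
    ∃ n : ℕ, ∀ i, HasInjectiveDimensionLE (N i) n := by
  classical
  let H : ModuleCat.{u} A := ModuleCat.of A (DirectSum ι fun i ↦ N i)
  obtain ⟨n, hn⟩ := hA H (IsFpInjective.of_locally_finite hN
    (DirectSum.lof A ι fun i ↦ N i) (DirectSum.component A ι fun i ↦ N i) exists_sum_of_component)
  refine ⟨n, fun i ↦ ?_⟩
  let r : Retract (N i) H :=
    { i := ModuleCat.ofHom (DirectSum.lof A ι (fun i ↦ N i) i)
      r := ModuleCat.ofHom (DirectSum.component A ι (fun i ↦ N i) i)
      retract := ModuleCat.hom_ext <| LinearMap.ext fun x ↦ DirectSum.component.lof_self A (M := fun i ↦ N i) i x }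
  exact r.hasInjectiveDimensionLT (n + 1)

lemma isFpInjective_restrictScalars_directSum {R : Type u} [Ring R] (f : A →+* R)
    {N : ℕ → ModuleCat.{u} R} (hN : ∀ i, relInjective f (N i)) :
    IsFpInjective ((ModuleCat.restrictScalars f).obj (ModuleCat.of R (DirectSum ℕ fun i ↦ N i))) :=
  IsFpInjective.of_locally_finite (N := fun i ↦ (ModuleCat.restrictScalars f).obj (N i))
    (fun i ↦ have : Injective ((ModuleCat.restrictScalars f).obj (N i)) := hN i
      .of_injective _)
    (fun i ↦ ((ModuleCat.restrictScalars f).map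
      (ModuleCat.ofHom (DirectSum.lof R ℕ (fun i ↦ N i) i))).hom)
    (fun i ↦ ((ModuleCat.restrictScalars f).map
      (ModuleCat.ofHom (DirectSum.component R ℕ (fun i ↦ N i) i))).hom)
    (exists_sum_of_component (R := R) (M := fun i ↦ N i))

end FpInjective

/-! ### Injective modules over a flat extension -/

section BalancedTensor

variable {A : Type u} [Ring A] {N : Type u} [AddCommGroup N] [Module Aᵐᵒᵖ N]
  {M : Type u} [AddCommGroup M] [Module A M]

/-- The elementary tensors in a balanced tensor product. -/
def BalancedTensor.tmul (n : N) (m : M) : BalancedTensor A N M :=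
  QuotientAddGroup.mk (n ⊗ₜ[ℤ] m)

lemma BalancedTensor.smul_tmul (n : N) (a : A) (m : M) :
    (tmul (MulOpposite.op a • n) m : BalancedTensor A N M) = tmul n (a • m) := by
  rw [tmul, tmul, ← sub_eq_zero, ← QuotientAddGroup.mk_sub, QuotientAddGroup.eq_zero_iff]
  exact AddSubgroup.subset_closure ⟨n, a, m, rfl⟩

lemma BalancedTensor.add_tmul (n n' : N) (m : M) :
    (tmul (n + n') m : BalancedTensor A N M) = tmul n m + tmul n' m := by
  rw [tmul, TensorProduct.add_tmul]
  rfl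

lemma BalancedTensor.tmul_add (n : N) (m m' : M) :
    (tmul n (m + m') : BalancedTensor A N M) = tmul n m + tmul n m' := by
  rw [tmul, TensorProduct.tmul_add]
  rfl

lemma BalancedTensor.hom_ext {G : Type*} [AddCommGroup G] {φ ψ : BalancedTensor A N M →+ G}
    (h : ∀ n m, φ (tmul n m) = ψ (tmul n m)) : φ = ψ := by
  refine AddMonoidHom.ext fun x ↦ ?_
  obtain ⟨x, rfl⟩ := QuotientAddGroup.mk'_surjective _ x
  induction x with
  | zero => exact (map_zero φ).trans (map_zero ψ).symm
  | tmul n m => exact h n m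
  | add x y hx hy =>
    rw [map_add, map_add, map_add, hx, hy]

/-- The map from a balanced tensor product defined by a balanced biadditive map. -/
def BalancedTensor.lift {G : Type*} [AddCommGroup G] (φ : N →+ M →+ G)
    (h : ∀ n (a : A) m, φ (MulOpposite.op a • n) m = φ n (a • m)) : BalancedTensor A N M →+ G :=
  QuotientAddGroup.lift _ (TensorProduct.liftAddHom φ fun z n m ↦ by simp) (by
    rw [balancingSubgroup, AddSubgroup.closure_le]
    rintro _ ⟨n, a, m, rfl⟩
    simp [h])

variable {R : Type u} [Ring R] (f : A →+* R)

/-- Elements of a ring as elements of the associated right module. -/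
noncomputable def toRight (r : R) : rightModule f := r

/-- Elements of a right module associated with a ring as elements of the ring. -/
noncomputable def ofRight (r : rightModule f) : R := r

/-- Left multiplication as an endomorphism of a ring viewed as a right module. -/
noncomputable def leftMul (r : R) : rightModule f →ₗ[Aᵐᵒᵖ] rightModule f where
  toFun x := toRight f (r * ofRight f x)
  map_add' x y := mul_add r (ofRight f x) (ofRight f y)
  map_smul' a x := (mul_assoc r (ofRight f x) (f a.unop)).symm

variable (M)

/-- The extension of scalars of a module. -/
abbrev Extension : Type u := BalancedTensor A (rightModule f) M

/-- The elementary tensors in an extension of scalars. -/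
noncomputable def extensionTmul (r : R) (m : M) : Extension M f := BalancedTensor.tmul (toRight f r) m

/-- The action of a ring on an extension of scalars. -/
noncomputable def extensionAction : R →+* AddMonoid.End (Extension M f) where
  toFun r := BalancedTensor.map (leftMul f r) LinearMap.id
  map_one' := BalancedTensor.hom_ext fun n m ↦
    congrArg (extensionTmul M f · m) (one_mul (ofRight f n))
  map_mul' r s := BalancedTensor.hom_ext fun n m ↦
    congrArg (extensionTmul M f · m) (mul_assoc r s (ofRight f n))
  map_zero' := BalancedTensor.hom_ext fun n m ↦
    (congrArg (extensionTmul M f · m) (zero_mul (ofRight f n))).trans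
      (congrArg QuotientAddGroup.mk (TensorProduct.zero_tmul _ m))
  map_add' r s := BalancedTensor.hom_ext fun n m ↦
    (congrArg (extensionTmul M f · m) (add_mul r s (ofRight f n))).trans
      (BalancedTensor.add_tmul (N := rightModule f) _ _ _)

noncomputable instance : Module R (Extension M f) :=
  Module.compHom _ (extensionAction M f)

variable {M}

lemma smul_extensionTmul (r x : R) (m : M) :
    r • extensionTmul M f x m = extensionTmul M f (r * x) m := rfl

lemma extensionTmul_smul (r : R) (a : A) (m : M) :
    extensionTmul M f r (a • m) = extensionTmul M f (r * f a) m :=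
  (BalancedTensor.smul_tmul (toRight f r) a m).symm

lemma extension_induction {p : Extension M f → Prop} (x : Extension M f) (h0 : p 0)
    (h : ∀ (r : R) m, p (extensionTmul M f r m))
    (hadd : ∀ x y, p x → p y → p (x + y)) : p x := by
  obtain ⟨x, rfl⟩ := QuotientAddGroup.mk'_surjective _ x
  induction x with
  | zero => exact h0
  | tmul n m => exact h n m
  | add x y hx hy => exact hadd _ _ hx hy

/-- An additive map from an extension of scalars that is linear on elementary tensors. -/
def extensionLinearMap {G : Type*} [AddCommGroup G] [Module R G] (φ : Extension M f →+ G)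
    (h : ∀ (r s : R) m, φ (extensionTmul M f (r * s) m) = r • φ (extensionTmul M f s m)) :
    Extension M f →ₗ[R] G where
  __ := φ
  map_smul' r x := extension_induction f (p := fun x ↦ φ (r • x) = r • φ x) x
    ((congrArg φ (smul_zero r)).trans ((map_zero φ).trans
      ((congrArg (r • ·) (map_zero φ)).trans (smul_zero r)).symm)) (h r) fun x y hx hy ↦
        (congrArg φ (smul_add r x y)).trans ((map_add φ _ _).trans ((congrArg₂ (· + ·) hx hy).trans
          ((congrArg (r • ·) (map_add φ x y)).trans (smul_add r _ _)).symm))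

/-- The functoriality of the extension of scalars. -/
noncomputable def extensionMap {M' : Type u} [AddCommGroup M'] [Module A M'] (h : M →ₗ[A] M') :
    Extension M f →ₗ[R] Extension M' f :=
  extensionLinearMap f (BalancedTensor.map LinearMap.id h) fun _ _ _ ↦ rfl

/-- A linear map to a restriction of scalars as a map to the original module. -/
noncomputable def toUnrestricted {J : ModuleCat.{u} R} (g : M →ₗ[A] (ModuleCat.restrictScalars f).obj J) :
    M →+ J where
  toFun m := g m
  map_zero' := g.map_zero
  map_add' := g.map_add

/-- The linear map from an extension of scalars that corresponds to a linear map to a restriction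
of scalars. -/
noncomputable def extensionLift {J : ModuleCat.{u} R}
    (g : M →ₗ[A] (ModuleCat.restrictScalars f).obj J) : Extension M f →ₗ[R] J :=
  extensionLinearMap f (BalancedTensor.lift (N := rightModule f)
    { toFun r := (DistribSMul.toAddMonoidHom J (ofRight f r)).comp (toUnrestricted f g)
      map_zero' := AddMonoidHom.ext fun m ↦ zero_smul R (toUnrestricted f g m)
      map_add' r s := AddMonoidHom.ext fun m ↦
        add_smul (ofRight f r) (ofRight f s) (toUnrestricted f g m) }
    fun r a m ↦ (mul_smul (ofRight f r) (f a) (toUnrestricted f g m)).trans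
      (congrArg (ofRight f r • ·) (g.map_smul a m).symm))
    fun r s m ↦ mul_smul r s (toUnrestricted f g m)

/-- The map to a restriction of scalars that corresponds to a map from an extension of scalars. -/
noncomputable def ofExtension {J : ModuleCat.{u} R} (φ : Extension M f →ₗ[R] J) :
    M →ₗ[A] (ModuleCat.restrictScalars f).obj J where
  toFun m := φ (extensionTmul M f 1 m)
  map_add' m m' := (congrArg φ (BalancedTensor.tmul_add (toRight f 1) m m')).trans (φ.map_add _ _)
  map_smul' a m := by
    have : extensionTmul M f 1 (a • m) = f a • extensionTmul M f 1 m := by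
      rw [extensionTmul_smul, smul_extensionTmul, one_mul, mul_one]
    exact (congrArg φ this).trans (φ.map_smul (f a) _)

/-- By adjunction, maps of `A`-modules into `J` are `R`-linear maps out of the extension of scalars,
and flatness keeps that extension functor injective on monomorphisms. -/
lemma relInjective_of_injective (hf : IsFlatRight (rightModule f)) (J : ModuleCat.{u} R)
    (hJ : Injective J) : relInjective f J := by
  refine ⟨fun {M M'} g φ hφ ↦ ?_⟩
  have : Mono (ModuleCat.ofHom (extensionMap f φ.hom)) := by
    have h : Function.Injective (extensionMap f φ.hom) :=
      fun x y hxy ↦ hf φ ((ModuleCat.mono_iff_injective _).1 hφ) hxy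
    exact (ModuleCat.mono_iff_injective (ModuleCat.ofHom (extensionMap f φ.hom))).2 h
  let G := Injective.factorThru (ModuleCat.ofHom (extensionLift f g.hom))
    (ModuleCat.ofHom (extensionMap f φ.hom))
  have hG : ModuleCat.ofHom (extensionMap f φ.hom) ≫ G = ModuleCat.ofHom (extensionLift f g.hom) :=
    Injective.comp_factorThru _ _
  refine ⟨ModuleCat.ofHom (X := M') (Y := (ModuleCat.restrictScalars f).obj J)
    (ofExtension f G.hom), ModuleCat.hom_ext <| LinearMap.ext fun m ↦ ?_⟩
  exact (hom_apply_of_comp_eq hG (extensionTmul M f 1 m)).trans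
    (one_smul R (toUnrestricted f g.hom m))

end BalancedTensor

/-! ### Right resolutions up to semicoacyclic cone -/

section Right

variable {A R : Type u} [Ring A] [Ring R] (f : A →+* R)

/-- The infinite totalization brings the complex to fp-injective terms over `A`; these have
uniformly bounded dimension, so finitely many more steps suffice. -/
lemma hasRightResolution_semicoacyclic (hf : IsFlatRight (rightModule f))
    (hA : ∀ J : ModuleCat.{u} A, IsFpInjective J → ∃ n : ℕ, HasInjectiveDimensionLE J n)
    (X : CochainComplex (ModuleCat.{u} R) ℤ) :
    HasRightResolution (semicoacyclic f) (relInjective f)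
      ((HomotopyCategory.quotient _ _).obj X) := by
  have hR := relInjective_of_injective f hf
  obtain ⟨n, hn⟩ := exists_uniform_injectiveDimension
    (N := fun k ↦ (ModuleCat.restrictScalars f).obj ((injectiveSkewSequence X).sumTotal.X k))
    (fun k ↦ isFpInjective_restrictScalars_directSum f
      (N := fun i ↦ ((injectiveSkewSequence X).E i).X k)
      fun i ↦ hR _ (inferInstanceAs (Injective ((injectiveHull _).X k)))) hA
  exact (hasRightResolution_of_injectiveDimension f (containsTotals_semicoacyclic f) hR n _ hn).of_trW
    _ (trW_toSumTotal X (containsTotals_semicoacyclic f) (stableUnderCoproducts_semicoacyclic f))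

end Right

/-! ### Solutions of linear equations in modules -/

section LinearEquations

variable {B : Type u} [Ring B]

/-- The rows `c k` generate the right module of solutions `v` of the equation `∑ b j * v j = 0`. -/
structure GeneratesSolutions {n m : ℕ} (b : Fin n → B) (c : Fin m → Fin n → B) : Prop where
  sum_eq_zero (k : Fin m) : ∑ j, b j * c k j = 0
  exists_eq (v : Fin n → B) : ∑ j, b j * v j = 0 → ∃ w : Fin m → B, ∀ j, v j = ∑ k, c k j * w k

/-- The solutions of linear equations in a left module come from solutions in the ring. -/
def SolvesEquations (B : Type u) [Ring B] (M : Type u) [AddCommGroup M] [Module B M] : Prop :=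
  ∀ ⦃n m : ℕ⦄ (b : Fin n → B) (c : Fin m → Fin n → B), GeneratesSolutions b c →
    ∀ x : Fin n → M, ∑ j, b j • x j = 0 → ∃ y : Fin m → M, ∀ j, x j = ∑ k, c k j • y k

variable {M : Type u} [AddCommGroup M] [Module B M]

lemma SolvesEquations.of_retract {N : Type u} [AddCommGroup N] [Module B N]
    (h : SolvesEquations B N) (i : M →ₗ[B] N) (r : N →ₗ[B] M) (hir : ∀ x, r (i x) = x) :
    SolvesEquations B M := by
  intro n m b c hc x hx
  obtain ⟨y, hy⟩ := h b c hc (fun j ↦ i (x j)) (by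
    have := congrArg i hx
    simpa only [map_sum, map_smul, map_zero] using! this)
  refine ⟨fun k ↦ r (y k), fun j ↦ ?_⟩
  rw [← hir (x j), hy j]
  simp only [map_sum, map_smul]

/-- The generating solutions `c` depend on the equation alone, so the same finite family serves all
factors and coefficients are chosen componentwise. -/
lemma SolvesEquations.of_product {ι : Type*} {N : ι → Type u} [∀ i, AddCommGroup (N i)]
    [∀ i, Module B (N i)] (h : ∀ i, SolvesEquations B (N i)) (p : ∀ i, M →ₗ[B] N i)
    (hp : ∀ x, (∀ i, p i x = 0) → x = 0) (hp' : ∀ y : ∀ i, N i, ∃ x, ∀ i, p i x = y i) :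
    SolvesEquations B M := by
  intro n m b c hc x hx
  choose y hy using fun i ↦ h i b c hc (fun j ↦ p i (x j)) (by
    have := congrArg (p i) hx
    simpa only [map_sum, map_smul, map_zero] using! this)
  choose z hz using fun k ↦ hp' fun i ↦ y i k
  refine ⟨z, fun j ↦ sub_eq_zero.1 (hp _ fun i ↦ ?_)⟩
  rw [map_sub, sub_eq_zero, hy i j]
  simp only [map_sum, map_smul, hz]

lemma SolvesEquations.finsupp (X : Type u) : SolvesEquations B (X →₀ B) := by
  classical
  intro n m b c hc x hx
  -- Coefficients are forced to be zero wherever all the `x j` vanish, so that they are finitely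
  -- supported in `t`.
  have (t : X) : ∃ w : Fin m → B, (∀ j, x j t = ∑ k, c k j * w k) ∧
      ((∀ j, x j t = 0) → w = 0) := by
    by_cases h : ∀ j, x j t = 0
    · exact ⟨0, fun j ↦ by simp [h j], fun _ ↦ rfl⟩
    · obtain ⟨w, hw⟩ := hc.exists_eq (fun j ↦ x j t) (by
        have := DFunLike.congr_fun hx t
        simpa [Finsupp.finsetSum_apply] using this)
      exact ⟨w, hw, fun h' ↦ absurd h' h⟩
  choose w hw hw' using this
  refine ⟨fun k ↦ Finsupp.onFinset (Finset.univ.biUnion fun j ↦ (x j).support) (fun t ↦ w t k)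
    fun t ht ↦ ?_, fun j ↦ Finsupp.ext fun t ↦ ?_⟩
  · by_contra h
    refine ht (congrFun (hw' t fun j ↦ ?_) k)
    by_contra hj
    exact h (Finset.mem_biUnion.2 ⟨j, Finset.mem_univ j, Finsupp.mem_support_iff.2 hj⟩)
  · rw [hw t j]
    simp [Finsupp.finsetSum_apply]

/-- A projective module is a retract of the free module on its elements. -/
lemma SolvesEquations.of_projective (P : ModuleCat.{u} B) [Projective P] :
    SolvesEquations B P := by
  let F : ModuleCat.{u} B := ModuleCat.of B (P →₀ B)
  let π : F ⟶ P := ModuleCat.ofHom (Finsupp.linearCombination B id)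
  have : Epi π := (ModuleCat.epi_iff_surjective π).2 fun x ↦
    ⟨Finsupp.single x 1, (Finsupp.linearCombination_single B 1 x).trans (one_smul B x)⟩
  exact (SolvesEquations.finsupp (B := B) P).of_retract (Projective.factorThru (𝟙 P) π).hom π.hom
    fun x ↦ hom_apply_of_comp_eq (Projective.factorThru_comp (𝟙 P) π) x

/-- The solutions form the kernel of a surjection from a free module onto the right ideal generated
by the `b j`; finite presentation of the ideal makes this kernel finitely generated. -/
lemma exists_generatesSolutions (hB : IsRightCoherent B) {n : ℕ} (b : Fin n → B) :
    ∃ (m : ℕ) (c : Fin m → Fin n → B), GeneratesSolutions b c := by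
  let I : Ideal Bᵐᵒᵖ := Submodule.span Bᵐᵒᵖ (Set.range fun j ↦ MulOpposite.op (b j))
  have := hB I (Submodule.fg_span (Set.finite_range _))
  let l : (Fin n → Bᵐᵒᵖ) →ₗ[Bᵐᵒᵖ] I :=
    (Fintype.linearCombination Bᵐᵒᵖ fun j ↦ MulOpposite.op (b j)).codRestrict I fun v ↦ by
      rw [Fintype.linearCombination_apply]
      exact Submodule.sum_mem _ fun j _ ↦ Submodule.smul_mem _ _ (Submodule.subset_span ⟨j, rfl⟩)
  have hl : Function.Surjective l := by
    rintro ⟨x, hx⟩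
    obtain ⟨v, hv⟩ := (Submodule.mem_span_range_iff_exists_fun _).1 hx
    exact ⟨v, Subtype.ext hv⟩
  have hmem (v : Fin n → B) : (fun j ↦ MulOpposite.op (v j)) ∈ LinearMap.ker l ↔
      ∑ j, b j * v j = 0 := by
    rw [LinearMap.mem_ker, ← Subtype.val_inj, ← MulOpposite.unop_inj]
    simp [l, Fintype.linearCombination_apply]
  obtain ⟨m, c, hc⟩ := Submodule.fg_iff_exists_fin_generating_family.1
    (Module.FinitePresentation.fg_ker l hl)
  refine ⟨m, fun k j ↦ (c k j).unop, fun k ↦ ?_, fun v hv ↦ ?_⟩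
  · rw [← hmem, ← hc]
    exact Submodule.subset_span ⟨k, rfl⟩
  · rw [← hmem, ← hc] at hv
    obtain ⟨w, hw⟩ := (Submodule.mem_span_range_iff_exists_fun _).1 hv
    refine ⟨fun k ↦ (w k).unop, fun j ↦ MulOpposite.op_injective ?_⟩
    rw [← congrFun hw j]
    simp

/-! ### The character module -/

/-- The characters of a left module, as a right module. -/
def Characters (M : Type u) [AddCommGroup M] : Type u := M →+ AddCircle (1 : ℚ)

noncomputable instance : AddCommGroup (Characters M) :=
  inferInstanceAs (AddCommGroup (M →+ AddCircle (1 : ℚ)))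

/-- The right action on characters. -/
noncomputable def charactersAction : Bᵐᵒᵖ →+* AddMonoid.End (Characters M) where
  toFun b :=
    { toFun χ := AddMonoidHom.comp χ (DistribSMul.toAddMonoidHom M b.unop)
      map_zero' := rfl
      map_add' _ _ := rfl }
  map_one' := AddMonoidHom.ext fun χ ↦ AddMonoidHom.ext fun x ↦
    congrArg (show M →+ AddCircle (1 : ℚ) from χ) (one_smul B x)
  map_mul' a b := AddMonoidHom.ext fun χ ↦ AddMonoidHom.ext fun x ↦
    congrArg (show M →+ AddCircle (1 : ℚ) from χ) (mul_smul b.unop a.unop x)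
  map_zero' := AddMonoidHom.ext fun χ ↦ AddMonoidHom.ext fun x ↦
    (congrArg (show M →+ AddCircle (1 : ℚ) from χ) (zero_smul B x)).trans (map_zero _)
  map_add' a b := AddMonoidHom.ext fun χ ↦ AddMonoidHom.ext fun x ↦
    (congrArg (show M →+ AddCircle (1 : ℚ) from χ) (add_smul a.unop b.unop x)).trans (map_add _ _ _)

noncomputable instance : Module Bᵐᵒᵖ (Characters M) :=
  Module.compHom _ (charactersAction (B := B) (M := M))

/-- Evaluation of characters. -/
noncomputable def Characters.eval : Characters M →+ M →+ AddCircle (1 : ℚ) := AddMonoidHom.id _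

/-- Over a right coherent ring, the character module of a left module in which the linear equations
are solved is injective. -/
lemma SolvesEquations.baer_characters (hM : SolvesEquations B M) (hB : IsRightCoherent B) :
    Module.Baer Bᵐᵒᵖ (Characters M) := by
  classical
  intro I φ
  -- `p` models the multiplication map from the tensor product of `I` and `M` to `M`, and `q` the
  -- pairing given by `φ`. If `q` kills the kernel of `p`, it is a character of the image of `p` and
  -- extends to all of `M`.
  let p : (I →₀ M) →+ M := Finsupp.liftAddHom fun b ↦ DistribSMul.toAddMonoidHom M b.1.unop
  let q : (I →₀ M) →+ AddCircle (1 : ℚ) := Finsupp.liftAddHom fun b ↦ Characters.eval (φ b)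
  have hpq (s : I →₀ M) (hs : p s = 0) : q s = 0 := by
    let e := s.support.equivFin.symm
    have hsum {G : Type u} [AddCommMonoid G] (F : I → G) :
        ∑ b ∈ s.support, F b = ∑ j, F (e j) := by
      rw [← Finset.sum_coe_sort, ← e.sum_comp]
    have hsum' (F : I → AddCircle (1 : ℚ)) : ∑ b ∈ s.support, F b = ∑ j, F (e j) := by
      rw [← Finset.sum_coe_sort, ← e.sum_comp]
    obtain ⟨m, c, hc⟩ := exists_generatesSolutions hB fun j ↦ (e j).1.1.unop
    obtain ⟨y, hy⟩ := hM _ c hc (fun j ↦ s (e j)) (by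
      rw [← hs]
      exact (hsum fun b ↦ b.1.unop • s b).symm)
    -- Linearity of `φ` transfers the relation between the `b j` to their images; the coefficients
    -- `c` then move across the pairing.
    have hφ (k : Fin m) : ∑ j, MulOpposite.op (c k j) • φ (e j).1 = 0 := by
      rw [← map_zero φ]
      simp only [← map_smul, ← map_sum]
      refine congrArg φ (Subtype.ext (MulOpposite.unop_injective (Eq.trans ?_ (hc.sum_eq_zero k))))
      simp
    have : q s = ∑ j, Characters.eval (φ (e j).1) (s (e j)) :=
      hsum' fun b ↦ Characters.eval (φ b) (s b)
    rw [this]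
    have h (j) : Characters.eval (φ (e j).1) (s (e j)) =
        ∑ k, Characters.eval (MulOpposite.op (c k j) • φ (e j).1) (y k) := by
      rw [hy j, map_sum]
      rfl
    simp only [h]
    rw [Finset.sum_comm]
    refine Finset.sum_eq_zero fun k _ ↦ ?_
    rw [← AddMonoidHom.finsetSum_apply, ← map_sum, hφ k, map_zero, AddMonoidHom.zero_apply]
  let p' : (I →₀ M) ⧸ p.ker →+ M := QuotientAddGroup.kerLift p
  let q' : (I →₀ M) ⧸ p.ker →+ AddCircle (1 : ℚ) := QuotientAddGroup.lift _ q hpq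
  obtain ⟨χ, hχ⟩ := CharacterModule.dual_surjective_of_injective p'.toIntLinearMap
    (QuotientAddGroup.kerLift_injective p) q'
  refine ⟨LinearMap.toSpanSingleton Bᵐᵒᵖ (Characters M) χ, fun b hb ↦ ?_⟩
  refine AddMonoidHom.ext fun x ↦ ?_
  have h := DFunLike.congr_fun hχ (QuotientAddGroup.mk (Finsupp.single ⟨b, hb⟩ x))
  have h₁ : p (Finsupp.single ⟨b, hb⟩ x) = b.unop • x := by simp [p]
  have h₂ : q (Finsupp.single ⟨b, hb⟩ x) = Characters.eval (φ ⟨b, hb⟩) x := by simp [q]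
  refine Eq.trans ?_ h₂
  refine Eq.trans ?_ h
  exact (congrArg χ h₁).symm

/-- A character of `N ⊗ F` is a linear map from `N` to the characters of `F`. Injectivity of the
latter extends it along `g`, so no character can detect a nonzero element of the kernel. -/
lemma SolvesEquations.isFlatLeft (F : ModuleCat.{u} B) (hF : SolvesEquations B F)
    (hB : IsRightCoherent B) : IsFlatLeft F := by
  intro N N' g hg
  rw [injective_iff_map_eq_zero]
  intro t ht
  by_contra h
  obtain ⟨c, hc⟩ := CharacterModule.exists_character_apply_ne_zero_of_ne_zero h
  let γ : N →ₗ[Bᵐᵒᵖ] Characters F :=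
    { toFun n := AddMonoidHom.mk' (fun x ↦ c (BalancedTensor.tmul n x)) fun x y ↦ by
        rw [BalancedTensor.tmul_add, map_add]
      map_add' n n' := AddMonoidHom.ext fun x ↦
        (congrArg c (BalancedTensor.add_tmul n n' x)).trans (map_add c _ _)
      map_smul' b n := AddMonoidHom.ext fun x ↦ congrArg c (BalancedTensor.smul_tmul n b.unop x) }
  obtain ⟨γ', hγ'⟩ := Module.Baer.extension_property (hF.baer_characters hB) g.hom hg γ
  let c' : BalancedTensor B N' F →+ AddCircle (1 : ℚ) :=
    BalancedTensor.lift (Characters.eval.comp γ'.toAddMonoidHom) fun n a x ↦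
      DFunLike.congr_fun (congrArg Characters.eval (γ'.map_smul (MulOpposite.op a) n)) x
  have : c'.comp (BalancedTensor.map g.hom LinearMap.id) = (c : _ →+ AddCircle (1 : ℚ)) :=
    BalancedTensor.hom_ext fun n x ↦
      DFunLike.congr_fun (congrArg Characters.eval (LinearMap.congr_fun hγ' n)) x
  refine hc ((DFunLike.congr_fun this t).symm.trans ?_)
  exact (congrArg c' ht).trans (map_zero c')

end LinearEquations

/-! ### Left resolutions -/

section Left

variable {B S : Type u} [Ring B] [Ring S] (g : B →+* S)

/-- The right adjoint of restriction is `Hom_B(S, -)`, which preserves epimorphisms because `S` is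
projective over `B`; hence restriction preserves projectives. -/
lemma relProjective_of_projective (hg : Projective (leftModule g)) (P : ModuleCat.{u} S)
    (hP : Projective P) : relProjective g P := by
  have : (ModuleCat.coextendScalars.{u, u, u} g).PreservesEpimorphisms := ⟨fun {M N} φ hφ ↦ by
    rw [ModuleCat.epi_iff_surjective]
    intro (ψ : leftModule g →ₗ[B] N)
    exact ⟨(Projective.factorThru (ModuleCat.ofHom ψ) φ).hom,
      congrArg ModuleCat.Hom.hom (Projective.factorThru_comp (ModuleCat.ofHom ψ) φ)⟩⟩
  exact (ModuleCat.restrictCoextendScalarsAdj.{u, u, u} g).map_projective P hP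

/-- The product of the family is flat, so its finite projective dimension bounds that of every
retract `N i`. -/
lemma exists_uniform_projectiveDimension {ι : Type} {N : ι → ModuleCat.{u} B}
    (hN : ∀ i, SolvesEquations B (N i)) (hB : IsRightCoherent B)
    (hF : ∀ F : ModuleCat.{u} B, IsFlatLeft F → ∃ n : ℕ, HasProjectiveDimensionLE F n) :
    ∃ n : ℕ, ∀ i, HasProjectiveDimensionLE (N i) n := by
  classical
  let H : ModuleCat.{u} B := ModuleCat.of B (∀ i, N i)
  have hH : SolvesEquations B H := .of_product hN (fun i ↦ LinearMap.proj i)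
    (fun x hx ↦ funext hx) fun y ↦ ⟨y, fun i ↦ rfl⟩
  obtain ⟨n, hn⟩ := hF H (hH.isFlatLeft H hB)
  refine ⟨n, fun i ↦ ?_⟩
  let r : Retract (N i) H :=
    { i := ModuleCat.ofHom (LinearMap.single B (fun i ↦ N i) i)
      r := ModuleCat.ofHom (LinearMap.proj i)
      retract := ModuleCat.hom_ext <| LinearMap.ext fun x ↦ Pi.single_eq_same (M := fun i ↦ N i) i x }
  exact r.hasProjectiveDimensionLT (n + 1)

lemma solvesEquations_restrictScalars_pi {N : ℕ → ModuleCat.{u} S}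
    (hN : ∀ i, relProjective g (N i)) :
    SolvesEquations B ((ModuleCat.restrictScalars g).obj (ModuleCat.of S (∀ i, N i))) :=
  .of_product (N := fun i ↦ (ModuleCat.restrictScalars g).obj (N i))
    (fun i ↦ have : Projective ((ModuleCat.restrictScalars g).obj (N i)) := hN i
      .of_projective _)
    (fun i ↦ ((ModuleCat.restrictScalars g).map
      (ModuleCat.ofHom (LinearMap.proj (φ := fun i ↦ N i) i))).hom)
    (fun _ hx ↦ funext hx) fun y ↦ ⟨y, fun _ ↦ rfl⟩

/-- The product totalization has flat terms over `B`, of uniformly bounded projective dimension;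
finitely many more steps reach `B`-projective terms. -/
lemma hasLeftResolution_semicontraacyclic (hg : Projective (leftModule g))
    (hB : IsRightCoherent B)
    (hF : ∀ F : ModuleCat.{u} B, IsFlatLeft F → ∃ n : ℕ, HasProjectiveDimensionLE F n)
    (X : CochainComplex (ModuleCat.{u} S) ℤ) :
    HasLeftResolution (semicontraacyclic g) (relProjective g)
      ((HomotopyCategory.quotient _ _).obj X) := by
  have hS := relProjective_of_projective g hg
  obtain ⟨n, hn⟩ := exists_uniform_projectiveDimension
    (N := fun k ↦ (ModuleCat.restrictScalars g).obj ((projectiveSkewResolution X).piTotal.X k))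
    (fun k ↦ solvesEquations_restrictScalars_pi g
      (N := fun i ↦ ((projectiveSkewResolution X).E i).X k)
      fun i ↦ hS _ (inferInstanceAs (Projective ((projectiveHull _).X k)))) hB hF
  exact (hasLeftResolution_of_projectiveDimension g (containsTotals_semicontraacyclic g) hS n _
    hn).of_trW _ (trW_fromPiTotal X (containsTotals_semicontraacyclic g)
      (stableUnderProducts_semicontraacyclic g))

end Left

/-- A complex with terms in a full subcategory, as a complex over this subcategory. -/
def liftComplex {C : Type*} [Category* C] [Preadditive C] (Q : ObjectProperty C)
    (J : CochainComplex C ℤ) (hJ : ∀ k, Q (J.X k)) : CochainComplex Q.FullSubcategory ℤ where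
  X k := ⟨J.X k, hJ k⟩
  d i j := ObjectProperty.homMk (J.d i j)
  shape i j h := by ext; exact J.shape i j h
  d_comp_d' i j k _ _ := by ext; exact J.d_comp_d i j k

/-! ### The comparison functors are equivalences -/

section

variable {A R : Type u} [Ring A] [Ring R] (f : A →+* R)

/-- Over `A` the terms are injective, and there coacyclic means contractible. Thus the embedding
reflects the localized morphisms. -/
lemma relInjectiveContractible_eq :
    relInjectiveContractible f = (semicoacyclic f).inverseImage (relInjectiveHot f) := by
  ext X
  refine ⟨fun h ↦ contractible_le_coacyclic _ _ h, fun h ↦ ?_⟩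
  obtain ⟨J, rfl⟩ := HomotopyCategory.quotient_obj_surjective X
  exact contractible_of_coacyclic (J := ((ModuleCat.restrictScalars f).mapHomologicalComplex _).obj
    (((relInjective f).ι.mapHomologicalComplex _).obj J)) (fun k ↦ (J.X k).property) h

lemma relProjectiveContractible_eq :
    relProjectiveContractible f = (semicontraacyclic f).inverseImage (relProjectiveHot f) := by
  ext X
  refine ⟨fun h ↦ contractible_le_contraacyclic _ _ h, fun h ↦ ?_⟩
  obtain ⟨J, rfl⟩ := HomotopyCategory.quotient_obj_surjective X
  exact contractible_of_contraacyclic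
    (J := ((ModuleCat.restrictScalars f).mapHomologicalComplex _).obj
      (((relProjective f).ι.mapHomologicalComplex _).obj J)) (fun k ↦ (J.X k).property) h

lemma semicoComparison_isEquivalence (hf : IsFlatRight (rightModule f))
    (hA : ∀ J : ModuleCat.{u} A, IsFpInjective J → ∃ n : ℕ, HasInjectiveDimensionLE J n) :
    (semicoComparison f).IsEquivalence := by
  have : (relInjectiveLocalizer f).functor.Full := inferInstanceAs (relInjectiveHot f).Full
  have : (relInjectiveLocalizer f).functor.Faithful :=
    inferInstanceAs (relInjectiveHot f).Faithful
  refine localizedFunctor_isEquivalence_of_right_resolutions (relInjectiveLocalizer f) _ _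
    (fun X Y s hs ↦ ?_) fun Y ↦ ?_
  · rw [relInjectiveContractible_eq, ObjectProperty.inverseImage_trW_iff]
    exact hs
  · obtain ⟨X, rfl⟩ := HomotopyCategory.quotient_obj_surjective Y
    obtain ⟨J, φ, hJ, hφ⟩ := hasRightResolution_semicoacyclic f hf hA X
    exact ⟨(HomotopyCategory.quotient _ _).obj (liftComplex _ J hJ), φ, hφ⟩

lemma semicontraComparison_isEquivalence (hf : Projective (leftModule f))
    (hA : IsRightCoherent A)
    (hF : ∀ F : ModuleCat.{u} A, IsFlatLeft F → ∃ n : ℕ, HasProjectiveDimensionLE F n) :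
    (semicontraComparison f).IsEquivalence := by
  have : (relProjectiveLocalizer f).functor.Full := inferInstanceAs (relProjectiveHot f).Full
  have : (relProjectiveLocalizer f).functor.Faithful :=
    inferInstanceAs (relProjectiveHot f).Faithful
  refine localizedFunctor_isEquivalence_of_left_resolutions (relProjectiveLocalizer f) _ _
    (fun X Y s hs ↦ ?_) fun Y ↦ ?_
  · rw [relProjectiveContractible_eq, ObjectProperty.inverseImage_trW_iff]
    exact hs
  · obtain ⟨X, rfl⟩ := HomotopyCategory.quotient_obj_surjective Y
    obtain ⟨J, φ, hJ, hφ⟩ := hasLeftResolution_semicontraacyclic f hf hA hF X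
    exact ⟨(HomotopyCategory.quotient _ _).obj (liftComplex _ J hJ), φ, hφ⟩

end

end Semiderived

theorem mainTheorem12 :
    (∀ (A R : Type u) [Ring A] [Ring R] (f : A →+* R),
      Semiderived.IsLeftCoherent A →
      Semiderived.IsFlatRight (Semiderived.rightModule f) →
      (∀ J : ModuleCat.{u} A, Semiderived.IsFpInjective J →
        ∃ n : ℕ, HasInjectiveDimensionLE J n) →
      (Semiderived.semicoComparison f).IsTriangulated ∧
        (Semiderived.semicoComparison f).IsEquivalence) ∧
    (∀ (B S : Type u) [Ring B] [Ring S] (g : B →+* S),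
      Semiderived.IsRightCoherent B →
      Projective (Semiderived.leftModule g) →
      (∀ F : ModuleCat.{u} B, Semiderived.IsFlatLeft F →
        ∃ n : ℕ, HasProjectiveDimensionLE F n) →
      (Semiderived.semicontraComparison g).IsTriangulated ∧
        (Semiderived.semicontraComparison g).IsEquivalence) :=
  ⟨fun _ _ _ _ f _ hf hA ↦
    ⟨Semiderived.semicoComparison_isTriangulated f,
      Semiderived.semicoComparison_isEquivalence f hf hA⟩,
    fun _ _ _ _ g hB hg hF ↦
    ⟨Semiderived.semicontraComparison_isTriangulated g,
      Semiderived.semicontraComparison_isEquivalence g hg hB hF⟩⟩
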